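/- Let $\kappa$ be a weakly compact cardinal, i.e. $\kappa>\omega$ and $\kappa\to(\kappa)^2_2$. **Conventions.** For a set $A$, ${}^{<\kappa}A$ is the set of sequences from $A$ of length $<\kappa$, and ${}^{\mathrm{Succ}(<\kappa)}A$ the set of those of successor length. ${}^{\kappa}2$ and ${}^{\kappa}\kappa$ carry the bounded topology, generated by the sets $\{x : s\subseteq x\}$ with $s$ a sequence of length $<\kappa$; $2^{\kappa\times\kappa}$ carries the topology generated by the sets $\{x : s\subseteq x\}$ with $s$ a partial function of size $<\kappa$. Borel sets are the members of the smallest family containing the open sets and closed under complements and unions of size $\le\kappa$; a map is Borel if preimages of open sets are Borel. A standard Borel $\kappa$-space is a topological space with a basis of size $\le\kappa$ that is Borel isomorphic to a Borel subset of ${}^\kappa\kappa$. A subset of such a space is analytic if it is a continuous image of a closed subset of ${}^\kappa\kappa$. An analytic quasi-order on $X$ is a reflexive transitive relation that is analytic in $X\times X$. It is complete if every analytic quasi-order $R$ on a standard Borel $\kappa$-space $X$ is Borel reducible to it, i.e. there is a Borel map $f$ defined on $X$ with $x\mathrel{R}y$ iff $f(x)$ is related to $f(y)$. A (generalized) tree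 is a partial order in which the set of strict predecessors of any point is linearly ordered; trees with domain $\kappa$ form a subspace of $2^{\kappa\times\kappa}$, and $\sqsubseteq^\kappa_{\mathsf{TREE}}$ is the relation of embeddability on it. A DST-tree on $2\times2\times\kappa$ is a set $T$ of triples $(u,v,s)\in{}^{<\kappa}2\times{}^{<\kappa}2\times{}^{<\kappa}\kappa$ of sequences of equal length, closed under initial segments; $\mathrm{p}[T]$ is the set of $(x,y)\in{}^\kappa2\times{}^\kappa2$ for which there is $\xi\in{}^\kappa\kappa$ with $(x\restriction\alpha,y\restriction\alpha,\xi\restriction\alpha)\in T$ for all $\alpha<\kappa$. **The tree $S_T$.** Let $\mathrm{Hes}$ be the order isomorphism of pairs of ordinals (ordered by maximum, then lexicographically) with the ordinals, $\rho(\alpha,\beta)=\mathrm{Hes}(\alpha,\beta)+1$ and $\theta(i,\gamma,\alpha)=1+2\cdot\mathrm{Hes}(\gamma,\alpha)+i$. For sequences $s,t$ of ordinals of equal length let $(s\oplus t)(0)=\rho(s(0),t(0))$ and $(s\oplus t)(\beta)=\rho(\sup_{\alpha\le\beta}s(\alpha)+\omega,\rho(s(\beta),t(\beta)))$ for $\beta>0$;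 let $(s\mathbin{\tilde\oplus}t)(\gamma)=((0^\smallfrown s)\oplus(0^\smallfrown t))(1+\gamma)$. For nonempty $u$, let $u^-$ be $u$ without its last entry if $u$ is finite, and $u^-=u$ otherwise. Given $T$, put $\hat T=T\cup\{(u,u,s): u\in{}^{<\kappa}2,\ s\in{}^{<\kappa}\kappa \text{ of equal length}\}$, $$S^T_0=\{\emptyset\}\cup\{(u,v,0^\smallfrown s):(u^-,v^-,s)\in\hat T\},$$ $$S^T_{n+1}=\{\emptyset\}\cup\{(u,v,(n+1)^\smallfrown s):(u,v,n^\smallfrown s)\in S^T_n\}\cup\{(u,w,(n+1)^\smallfrown(s\mathbin{\tilde\oplus}t)):\exists v\ (u,v,n^\smallfrown s),(v,w,n^\smallfrown t)\in S^T_n\},$$ let $S_T$ be $\bigcup_nS^T_n$ without the triples $(u,v,0^{(\mathrm{lh}\,u)})$ with $u\ne v$ (where $0^{(\gamma)}$ is the constant sequence $0$ of length $\gamma$), and for $x\in{}^\kappa2$ let $s_T(x)=\{(u,s):(u,x\restriction\mathrm{lh}(u),s)\in S_T\}$. **The trees $G_{\mathcal T}$.** Their construction depends on fixing the following *data*: (a)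 a map $\#:{}^{\mathrm{Succ}(<\kappa)}\kappa\to\kappa$ that is a bijection from ${}^{\gamma+1}\kappa$ onto $\kappa$ for each $\gamma<\kappa$ and satisfies $\#s\le\#(s\oplus t)$ whenever $s,t$ have equal length; (b) linear orders $L_\gamma$ ($\gamma<\kappa$) on $\kappa$ without greatest element, none of which embeds into another; (c) for $\gamma<\kappa$ and $u\in{}^{\gamma+1}2$, a linear order $L^*_u$ on $\mu(\gamma)$ that is not a well-order, such that $L^*_u$ does not embed into $L^*_v$ for $u\neq v$ of equal length; here $\mu(\gamma)=(\max\{\omega_1,|\gamma+1|,\sup_{\alpha<\gamma}\mu(\alpha)\})^+$. For a linear order $B$ and $k\in\omega$ let $B[k]$ be the tree consisting of $B$, above it a copy of $\omega$ in reverse order, and above that $k$ pairwise incomparable points, each with two incomparable points immediately above it. For $\gamma<\kappa$ let $\mathcal L_\gamma$ be the tree consisting of $L_\gamma$ together with, for every $\alpha<\kappa$, a copy of the ordinal $\theta(0,\gamma,\alpha)$ put above $\alpha$ (and above those points of $L_\gamma$ that are below $\alpha$, and no others). For a set $\mathcal T\subseteq{}^{<\kappa}2\times{}^{<\kappa}\kappa$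 of pairs of sequences of equal length, $G_{\mathcal T}$ is obtained from $({}^{\mathrm{Succ}(<\kappa)}\kappa,\subseteq)$ by placing, for every $s$ in it of length $\gamma+1$, a copy of $(\mathbb Z,\le)$ above $s$, and above this copy pairwise incomparable copies of $\mathcal L_\gamma$, of $\theta(1,\gamma,\#s)[3]$, and of $L^*_u[2]$ for each $u$ with $(u,s)\in\mathcal T$; what is placed at $s$ lies above the $t\subseteq s$, and no other relations hold. **Statement.** 1. $\sqsubseteq^\kappa_{\mathsf{TREE}}$ is a complete analytic quasi-order (in particular, it is an analytic quasi-order on a standard Borel $\kappa$-space). 2. Data as in (a)–(c) exist. Every analytic quasi-order $R$ on ${}^\kappa2$ is of the form $R=\mathrm p[T]$ for a DST-tree $T$ on $2\times2\times\kappa$. For every such $T$ and every choice of the data, the map $x\mapsto G_{s_T(x)}$, with $G_{s_T(x)}$ replaced by a suitable isomorphic copy with domain $\kappa$, is a Borel reduction of $R$ to $\sqsubseteq^\kappa_{\mathsf{TREE}}$: there is a Borel map $f$ from ${}^\kappa2$ to the space of trees with domain $\kappa$ such that $f(x)\cong G_{s_T(x)}$ for all $x$, and $x\mathrel{R}y\iff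 f(x)\sqsubseteq f(y)$ for all $x,y\in{}^\kappa2$. -/

import Mathlib

universe u v w

noncomputable section

namespace GenTree

open Ordinal Cardinal Set

/-! ## Weakly compact cardinals -/

/-- The cardinal `κ` regarded as the set of ordinals smaller than it. -/
abbrev Below (κ : Cardinal.{u}) : Type (u + 1) := Set.Iio κ.ord

/-- `κ` is weakly compact: it is uncountable and `κ → (κ)²₂`, that is, every colouring of the
two-element subsets `{α < β}` of `κ` with two colours has a homogeneous set of size `κ`. -/
def IsWeaklyCompact (κ : Cardinal.{u}) : Prop :=
  ℵ₀ < κ ∧ ∀ f : Below κ → Below κ → Bool, ∃ H : Set (Below κ),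
    Cardinal.mk H = Cardinal.lift.{u + 1} κ ∧
      ∃ c : Bool, ∀ α ∈ H, ∀ β ∈ H, α < β → f α β = c

/-! ## The spaces `2^κ`, `κ^κ` and their Borel structure -/

/-- The bounded topology on the set of `κ`-sequences from `A`: it is generated by the sets of all
sequences extending a given sequence of length `< κ`. -/
abbrev boundedSeqTopology (κ : Cardinal.{u}) (A : Type w) : TopologicalSpace (Below κ → A) :=
  TopologicalSpace.generateFrom
    {U | ∃ (α : Below κ) (y : Below κ → A), U = {x | ∀ β, β < α → x β = y β}}

/-- The generalized Cantor space `2^κ`. -/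
def Cantor (κ : Cardinal.{u}) : Type (u + 1) := Below κ → Bool

/-- The generalized Baire space `κ^κ`. -/
def Baire (κ : Cardinal.{u}) : Type (u + 1) := Below κ → Below κ

instance (κ : Cardinal.{u}) : TopologicalSpace (Cantor κ) := boundedSeqTopology κ Bool

instance (κ : Cardinal.{u}) : TopologicalSpace (Baire κ) := boundedSeqTopology κ (Below κ)

/-- The (`κ⁺`-)Borel sets: the smallest class containing the open sets and closed under
complements and unions of at most `κ` sets. -/
inductive IsBorelSet (κ : Cardinal.{u}) {X : Type v} [TopologicalSpace X] : Set X → Prop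
  | of_isOpen (U : Set X) : IsOpen U → IsBorelSet κ U
  | compl (A : Set X) : IsBorelSet κ A → IsBorelSet κ Aᶜ
  | iUnion (A : Below κ → Set X) : (∀ α, IsBorelSet κ (A α)) → IsBorelSet κ (⋃ α, A α)

/-- (`κ⁺`-)Borel functions. -/
def IsBorelMap (κ : Cardinal.{u}) {X : Type v} {Y : Type w} [TopologicalSpace X]
    [TopologicalSpace Y] (f : X → Y) : Prop :=
  ∀ U : Set Y, IsOpen U → IsBorelSet κ (f ⁻¹' U)

/-- Standard Borel `κ`-spaces: topological spaces with a basis of size `≤ κ` that are Borel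
isomorphic to a Borel subset (with the relative topology) of `κ^κ`. -/
def IsStandardBorel (κ : Cardinal.{u}) (X : Type v) [TopologicalSpace X] : Prop :=
  (∃ B : Set (Set X), TopologicalSpace.IsTopologicalBasis B ∧
    Cardinal.lift.{u} (Cardinal.mk B) ≤ Cardinal.lift.{v} κ) ∧
  ∃ (D : Set (Baire κ)) (e : X ≃ D), IsBorelSet κ D ∧ IsBorelMap κ e ∧ IsBorelMap κ e.symm

/-- Analytic sets: continuous images of closed subsets of `κ^κ`. -/
def IsAnalyticSet (κ : Cardinal.{u}) {X : Type v} [TopologicalSpace X] (A : Set X) : Prop :=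
  ∃ (C : Set (Baire κ)) (g : C → X), IsClosed C ∧ Continuous g ∧ Set.range g = A

/-- Analytic quasi-orders on `X`. -/
def IsAnalyticQuasiOrder (κ : Cardinal.{u}) {X : Type v} [TopologicalSpace X]
    (R : X → X → Prop) : Prop :=
  (∀ x, R x x) ∧ (∀ x y z, R x y → R y z → R x z) ∧
    IsAnalyticSet κ {p : X × X | R p.1 p.2}

/-- `f` is a Borel reduction of `R` to `S`. -/
def IsBorelReduction (κ : Cardinal.{u}) {X : Type v} {Y : Type w} [TopologicalSpace X]
    [TopologicalSpace Y] (R : X → X → Prop) (S : Y → Y → Prop) (f : X → Y) : Prop :=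
  IsBorelMap κ f ∧ ∀ x₀ x₁, R x₀ x₁ ↔ S (f x₀) (f x₁)

/-- `S` is a complete analytic quasi-order: it is an analytic quasi-order on a standard Borel
`κ`-space, and every analytic quasi-order on a standard Borel `κ`-space (in the universe `w`) is
Borel reducible to it. -/
def IsCompleteAnalyticQuasiOrder (κ : Cardinal.{u}) {Y : Type v} [TopologicalSpace Y]
    (S : Y → Y → Prop) : Prop :=
  IsStandardBorel κ Y ∧ IsAnalyticQuasiOrder κ S ∧
    ∀ (X : Type w) [TopologicalSpace X] (R : X → X → Prop),
      IsStandardBorel κ X → IsAnalyticQuasiOrder κ R → ∃ f : X → Y, IsBorelReduction κ R S f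

/-! ## The space of (generalized) trees with domain `κ` -/

/-- (Generalized) trees: partial orders in which the (strict) predecessors of any point are
linearly ordered. -/
def IsTree {D : Type v} (r : D → D → Prop) : Prop :=
  (∀ a, r a a) ∧ (∀ a b c, r a b → r b c → r a c) ∧ (∀ a b, r a b → r b a → a = b) ∧
    ∀ x a b, (r a x ∧ a ≠ x) → (r b x ∧ b ≠ x) → r a b ∨ r b a

/-- The space `Mod^κ_L` of structures with domain `κ` for a language consisting of one binary
relation symbol; the relation is given by its characteristic function. -/
def Structures (κ : Cardinal.{u}) : Type (u + 1) := Below κ × Below κ → Bool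

/-- The bounded topology on `2^(κ × κ)`: generated by the sets of all functions extending a
given partial function with domain of size `< κ`. -/
instance (κ : Cardinal.{u}) : TopologicalSpace (Structures κ) :=
  TopologicalSpace.generateFrom
    {U | ∃ (d : Set (Below κ × Below κ)) (y : Below κ × Below κ → Bool),
      Cardinal.mk d < Cardinal.lift.{u + 1} κ ∧
        U = {x : Below κ × Below κ → Bool | ∀ p ∈ d, x p = y p}}

/-- The binary relation of a structure. -/
def Structures.rel {κ : Cardinal.{u}} (M : Structures κ) : Below κ → Below κ → Prop :=
  fun a b => M (a, b) = true

/-- The space of trees with domain `κ`, with the relative topology. -/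
abbrev Trees (κ : Cardinal.{u}) : Type (u + 1) := {M : Structures κ // IsTree M.rel}

/-- Embeddability between trees of size `κ`. -/
def TreeEmb (κ : Cardinal.{u}) (M N : Trees κ) : Prop := Nonempty (M.1.rel ↪r N.1.rel)

/-! ## Transfinite sequences -/

/-- Sequences of elements of `A` indexed by an ordinal. -/
structure TSeq (A : Type w) where
  len : Ordinal.{u}
  val : Set.Iio len → A

namespace TSeq

variable {A : Type w}

/-- The restriction of `s` to `α` (equal to `s` if `α` is at least its length). -/
def restrict (s : TSeq.{u} A) (α : Ordinal.{u}) : TSeq.{u} A where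
  len := min s.len α
  val β := s.val ⟨β.1, (lt_min_iff.1 (Set.mem_Iio.1 β.2)).1⟩

/-- `s` is an initial segment of `t`. -/
def IsPrefix (s t : TSeq.{u} A) : Prop := s = t.restrict s.len

/-- The empty sequence. -/
def nil : TSeq.{u} A where
  len := 0
  val β := absurd (show β.1 < 0 from β.2) not_lt_zero

theorem sub_one_lt {β l : Ordinal.{u}} (h : β < 1 + l) (h0 : β ≠ 0) : β - 1 < l := by
  have h1 : 1 ≤ β := Order.one_le_iff_pos.2 (pos_iff_ne_zero.2 h0)
  rw [← Ordinal.add_sub_cancel_of_le h1] at h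
  exact (add_lt_add_iff_left 1).1 h

open Classical in
/-- The sequence `a ⌢ s`. -/
def cons (a : A) (s : TSeq.{u} A) : TSeq.{u} A where
  len := 1 + s.len
  val β := if h : β.1 = 0 then a else s.val ⟨β.1 - 1, sub_one_lt β.2 h⟩

/-- The constant sequence `a^(γ)`. -/
def const (a : A) (γ : Ordinal.{u}) : TSeq.{u} A where
  len := γ
  val _ := a

/-- The initial segment of length `α` of a `κ`-sequence. -/
def ofFun {κ : Cardinal.{u}} (x : Below κ → A) (α : Ordinal.{u}) : TSeq.{u} A where
  len := min κ.ord α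
  val β := x ⟨β.1, (lt_min_iff.1 (Set.mem_Iio.1 β.2)).1⟩

open Classical in
/-- `u⁻`: drop the last entry of a nonempty finite sequence, and do nothing to infinite ones.
(For `n` finite and nonzero, `n - 1` is the predecessor of `n`.) -/
def minus (s : TSeq.{u} A) : TSeq.{u} A := if s.len < ω then s.restrict (s.len - 1) else s

/-- For a sequence of length `γ + 1`, the ordinal `γ`. -/
def lastIndex (s : TSeq.{u} A) : Ordinal.{u} := sInf {γ | s.len ≤ γ + 1}

end TSeq

/-- `s` is a sequence of elements of `κ` of length `< κ`. -/
def IsSeqBelow (κ : Cardinal.{u}) (s : TSeq.{u} Ordinal.{u}) : Prop :=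
  s.len < κ.ord ∧ ∀ β, s.val β < κ.ord

/-- The set of all sequences of elements of `κ` whose length is a successor ordinal `< κ`. -/
def SuccSeq (κ : Cardinal.{u}) : Set (TSeq.{u} Ordinal.{u}) :=
  {s | IsSeqBelow κ s ∧ ∃ γ, s.len = γ + 1}

/-! ## Ordinal pairing functions and the operation `⊕` -/

/-- The well-order of pairs of ordinals by maximum, ties being broken lexicographically. -/
def PairLT (p q : Ordinal.{u} × Ordinal.{u}) : Prop :=
  max p.1 p.2 < max q.1 q.2 ∨
    (max p.1 p.2 = max q.1 q.2 ∧ (p.1 < q.1 ∨ (p.1 = q.1 ∧ p.2 < q.2)))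

theorem PairLT.wf : WellFounded PairLT.{u} := by
  have h : WellFounded (fun a b : Ordinal.{u} ×ₗ (Ordinal.{u} ×ₗ Ordinal.{u}) => a < b) :=
    wellFounded_lt
  refine Subrelation.wf ?_ (InvImage.wf
    (fun p : Ordinal.{u} × Ordinal.{u} => toLex (max p.1 p.2, toLex (p.1, p.2))) h)
  intro p q hpq
  simpa [InvImage, Prod.Lex.toLex_lt_toLex, PairLT] using hpq

/-- The Hessenberg pairing function, i.e. the order isomorphism between the well-order `PairLT`
and the ordinals: a pair is sent to the least ordinal above the values at smaller pairs. -/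
def hes : Ordinal.{u} × Ordinal.{u} → Ordinal.{u} :=
  PairLT.wf.fix fun p ih => sInf {δ | ∀ q (h : PairLT q p), ih q h < δ}

/-- `ρ(α, β) = Hes(α, β) + 1`. -/
def rho (α β : Ordinal.{u}) : Ordinal.{u} := hes (α, β) + 1

/-- `θ(i, γ, α) = 1 + 2 · Hes(γ, α) + i`, for `i = 0, 1`. -/
def theta (i γ α : Ordinal.{u}) : Ordinal.{u} := 1 + 2 * hes (γ, α) + i

open Classical in
/-- The sequence `s ⊕ t`, for `s` and `t` of the same length: its value at `0` is
`ρ(s(0), t(0))`, and at `β > 0` it is `ρ(sup_{α ≤ β} s(α) + ω, ρ(s(β), t(β)))`. -/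
def oplus (s t : TSeq.{u} Ordinal.{u}) : TSeq.{u} Ordinal.{u} where
  len := min s.len t.len
  val β :=
    let sβ := s.val ⟨β.1, (lt_min_iff.1 (Set.mem_Iio.1 β.2)).1⟩
    let tβ := t.val ⟨β.1, (lt_min_iff.1 (Set.mem_Iio.1 β.2)).2⟩
    if β.1 = 0 then rho sβ tβ
    else rho ((⨆ α : Set.Iic β.1,
      s.val ⟨α.1, lt_of_le_of_lt (Set.mem_Iic.1 α.2) (lt_min_iff.1 (Set.mem_Iio.1 β.2)).1⟩) + ω) (rho sβ tβ)

/-- The variant of `⊕` whose value at `γ` is the value of `(0 ⌢ s) ⊕ (0 ⌢ t)` at `1 + γ`. -/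
def oplusTilde (s t : TSeq.{u} Ordinal.{u}) : TSeq.{u} Ordinal.{u} where
  len := min s.len t.len
  val γ := (oplus (TSeq.cons 0 s) (TSeq.cons 0 t)).val ⟨1 + γ.1, lt_min (a := 1 + γ.1)
    ((add_lt_add_iff_left 1).2 (lt_min_iff.1 (Set.mem_Iio.1 γ.2)).1)
    ((add_lt_add_iff_left 1).2 (lt_min_iff.1 (Set.mem_Iio.1 γ.2)).2)⟩

/-! ## Descriptive set-theoretic trees and the map `s_T` -/

/-- Triples of sequences; a sequence of triples is identified with a triple of sequences of the
same length. -/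
abbrev Triple : Type (u + 1) := TSeq.{u} Bool × TSeq.{u} Bool × TSeq.{u} Ordinal.{u}

/-- `T` is a DST-tree on `2 × 2 × κ` all of whose elements have length `< κ`. -/
def IsDSTTree (κ : Cardinal.{u}) (T : Set Triple.{u}) : Prop :=
  ∀ p ∈ T, p.1.len = p.2.2.len ∧ p.2.1.len = p.2.2.len ∧ IsSeqBelow κ p.2.2 ∧
    ∀ α, (p.1.restrict α, p.2.1.restrict α, p.2.2.restrict α) ∈ T

/-- The projection of the body of `T`, as a relation on `2^κ`. -/
def proj (κ : Cardinal.{u}) (T : Set Triple.{u}) (x y : Cantor κ) : Prop :=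
  ∃ ξ : Baire κ, ∀ α < κ.ord,
    (TSeq.ofFun x α, TSeq.ofFun y α, TSeq.ofFun (fun β => (ξ β).1) α) ∈ T

/-- `T̂ = T ∪ {(u, u, s) | u ∈ 2^{<κ}, s ∈ κ^{<κ} of the same length}`. -/
def hat (κ : Cardinal.{u}) (T : Set Triple.{u}) : Set Triple.{u} :=
  T ∪ {p | p.1 = p.2.1 ∧ p.1.len = p.2.2.len ∧ IsSeqBelow κ p.2.2}

/-- The sets `S^T_n`. -/
def stage (κ : Cardinal.{u}) (T : Set Triple.{u}) : ℕ → Set Triple.{u}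
  | 0 => {(TSeq.nil, TSeq.nil, TSeq.nil)} ∪
      {p | p.1.len ≠ 0 ∧ p.2.1.len ≠ 0 ∧
        ∃ s, p.2.2 = TSeq.cons 0 s ∧ (p.1.minus, p.2.1.minus, s) ∈ hat κ T}
  | n + 1 => {(TSeq.nil, TSeq.nil, TSeq.nil)} ∪
      {p | ∃ s, p.2.2 = TSeq.cons ((n + 1 : ℕ) : Ordinal.{u}) s ∧
        (p.1, p.2.1, TSeq.cons (n : Ordinal.{u}) s) ∈ stage κ T n} ∪
      {p | ∃ v s t, p.2.2 = TSeq.cons ((n + 1 : ℕ) : Ordinal.{u}) (oplusTilde s t) ∧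
        (p.1, v, TSeq.cons (n : Ordinal.{u}) s) ∈ stage κ T n ∧
        (v, p.2.1, TSeq.cons (n : Ordinal.{u}) t) ∈ stage κ T n}

/-- `S_T`: the union of the `S^T_n`, without the triples `(u, v, 0^(leng u))` with `u ≠ v`. -/
def bigS (κ : Cardinal.{u}) (T : Set Triple.{u}) : Set Triple.{u} :=
  (⋃ n, stage κ T n) \ {p | p.2.2 = TSeq.const 0 p.1.len ∧ p.1 ≠ p.2.1}

/-- `s_T(x) = {(u, s) | (u, x ↾ leng u, s) ∈ S_T}`. -/
def sMap (κ : Cardinal.{u}) (T : Set Triple.{u}) (x : Cantor κ) :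
    Set (TSeq.{u} Bool × TSeq.{u} Ordinal.{u}) :=
  {p | (p.1, TSeq.ofFun x p.1.len, p.2) ∈ bigS κ T}

/-! ## Labels -/

/-- Linear orders (reflexive version). -/
def IsLinOrd {D : Type v} (r : D → D → Prop) : Prop :=
  (∀ a, r a a) ∧ (∀ a b c, r a b → r b c → r a c) ∧ (∀ a b, r a b → r b a → a = b) ∧
    ∀ a b, r a b ∨ r b a

/-- `μ(γ) = (max {ω₁, |γ + 1|, sup {μ(α) | α < γ}})⁺`. -/
def mu (γ : Ordinal.{u}) : Cardinal.{u} :=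
  Order.succ (max (max (Cardinal.aleph 1) (γ + 1).card) (⨆ α : Set.Iio γ, mu α.1))
termination_by γ
decreasing_by exact α.2

/-- The choices that enter into the construction of the trees `G`:
* a map `#` on sequences in `κ` of successor length, bijective onto `κ` on each `κ^(γ+1)`, with
  `# s ≤ # (s ⊕ t)`;
* linear orders `L_γ` on `κ`, for `γ < κ`, with no greatest element and pairwise not embeddable
  into each other;
* for `u ∈ 2^(γ+1)`, `γ < κ`, linear orders `L*_u` on `μ(γ)` which are not well-orders and such
  that `L*_u` does not embed into `L*_v` for distinct `u`, `v` of the same length. -/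
structure LabelData (κ : Cardinal.{u}) where
  num : TSeq.{u} Ordinal.{u} → Ordinal.{u}
  num_le : ∀ s ∈ SuccSeq κ, ∀ t ∈ SuccSeq κ, s.len = t.len → num s ≤ num (oplus s t)
  num_bijOn : ∀ γ < κ.ord, Set.BijOn num {s | IsSeqBelow κ s ∧ s.len = γ + 1} (Set.Iio κ.ord)
  L : Ordinal.{u} → Below κ → Below κ → Prop
  L_linOrd : ∀ γ < κ.ord, IsLinOrd (L γ)
  L_noMax : ∀ γ < κ.ord, ∀ a, ∃ b, L γ a b ∧ a ≠ b
  L_not_emb : ∀ γ < κ.ord, ∀ γ' < κ.ord, γ ≠ γ' → IsEmpty (L γ ↪r L γ')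
  Lstar : ∀ u : TSeq.{u} Bool, Below (mu u.lastIndex) → Below (mu u.lastIndex) → Prop
  Lstar_linOrd : ∀ γ < κ.ord, ∀ u : TSeq.{u} Bool, u.len = γ + 1 → IsLinOrd (Lstar u)
  Lstar_not_wf : ∀ γ < κ.ord, ∀ u : TSeq.{u} Bool, u.len = γ + 1 →
    ¬ WellFounded (fun a b => Lstar u a b ∧ a ≠ b)
  Lstar_not_emb : ∀ γ < κ.ord, ∀ u v : TSeq.{u} Bool, u.len = γ + 1 → v.len = γ + 1 → u ≠ v →
    IsEmpty (Lstar u ↪r Lstar v)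

/-- The domain of the label of type I coding `γ`: the points of `κ` and the pairs `(α, β)` with
`α < κ` and `β < θ(0, γ, α)`. -/
inductive DomI (κ : Cardinal.{u}) (γ : Ordinal.{u}) : Type (u + 1)
  | base (α : Below κ) : DomI κ γ
  | twig (α : Below κ) (β : Set.Iio (theta 0 γ α.1)) : DomI κ γ

/-- The order of the label of type I built on the linear order `r` of `κ`. -/
inductive DomI.le {κ : Cardinal.{u}} {γ : Ordinal.{u}} (r : Below κ → Below κ → Prop) :
    DomI κ γ → DomI κ γ → Prop
  | base_base {α α' : Below κ} : r α α' → DomI.le r (.base α) (.base α')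
  | base_twig {α' α : Below κ} (β : Set.Iio (theta 0 γ α.1)) : r α' α →
      DomI.le r (.base α') (.twig α β)
  | twig_twig (α : Below κ) {β β' : Set.Iio (theta 0 γ α.1)} : β ≤ β' →
      DomI.le r (.twig α β) (.twig α β')

/-- The common shape of the labels of type II and III: an initial part `B`, followed by a copy
`ω*` of the natural numbers in reverse order, followed by `k` pairwise incomparable points
`x`, each with two incomparable points `x⁺`, `x⁻` above it. -/
inductive Broom (B : Type v) (k : ℕ) : Type v
  | init (b : B) : Broom B k
  | star (n : ℕ) : Broom B k
  | fork (x : Fin k) : Broom B k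
  | tip (x : Fin k) (sign : Bool) : Broom B k

/-- The order of a `Broom` whose initial part is ordered by `r`. -/
inductive Broom.le {B : Type v} {k : ℕ} (r : B → B → Prop) : Broom B k → Broom B k → Prop
  | init_init {b b' : B} : r b b' → Broom.le r (.init b) (.init b')
  | init_star (b : B) (n : ℕ) : Broom.le r (.init b) (.star n)
  | init_fork (b : B) (x : Fin k) : Broom.le r (.init b) (.fork x)
  | init_tip (b : B) (x : Fin k) (i : Bool) : Broom.le r (.init b) (.tip x i)
  | star_star {n m : ℕ} : m ≤ n → Broom.le r (.star n) (.star m)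
  | star_fork (n : ℕ) (x : Fin k) : Broom.le r (.star n) (.fork x)
  | star_tip (n : ℕ) (x : Fin k) (i : Bool) : Broom.le r (.star n) (.tip x i)
  | fork_fork (x : Fin k) : Broom.le r (.fork x) (.fork x)
  | fork_tip (x : Fin k) (i : Bool) : Broom.le r (.fork x) (.tip x i)
  | tip_tip (x : Fin k) (i : Bool) : Broom.le r (.tip x i) (.tip x i)

/-! ## The tree `G` attached to a set of pairs of sequences -/

variable {κ : Cardinal.{u}}

/-- The domain of the label of type II coding `s`; its initial part is the ordinal
`θ(1, γ, # s)`, where `leng s = γ + 1`. -/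
abbrev DomII (c : LabelData κ) (s : TSeq.{u} Ordinal.{u}) : Type (u + 1) :=
  Broom (Set.Iio (theta 1 s.lastIndex (c.num s))) 3

/-- The domain of the label of type III coding `u`. -/
abbrev DomIII (u : TSeq.{u} Bool) : Type (u + 1) := Broom (Below (mu u.lastIndex)) 2

/-- The domain of `G_𝒯`: the sequences `s` in `κ` of successor length `< κ`; for each of them a
stem, which is a copy of the integers, a copy of the label of type I coding `leng s - 1` and a
copy of the label of type II coding `s`; moreover, for every `(u, s) ∈ 𝒯`, a copy of the label of
type III coding `u`. -/
inductive GDom (c : LabelData κ) (𝒯 : Set (TSeq.{u} Bool × TSeq.{u} Ordinal.{u})) :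
    Type (u + 1)
  | node (s : SuccSeq κ) : GDom c 𝒯
  | stem (s : SuccSeq κ) (z : ℤ) : GDom c 𝒯
  | labI (s : SuccSeq κ) (x : DomI κ s.1.lastIndex) : GDom c 𝒯
  | labII (s : SuccSeq κ) (x : DomII c s.1) : GDom c 𝒯
  | labIII (s : SuccSeq κ) (u : {u : TSeq.{u} Bool // (u, s.1) ∈ 𝒯}) (x : DomIII u.1) : GDom c 𝒯

/-- The order of `G_𝒯`. -/
inductive GDom.le (c : LabelData κ) (𝒯 : Set (TSeq.{u} Bool × TSeq.{u} Ordinal.{u})) :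
    GDom c 𝒯 → GDom c 𝒯 → Prop
  | node_node {s t : SuccSeq κ} : s.1.IsPrefix t.1 → GDom.le c 𝒯 (.node s) (.node t)
  | node_stem {s t : SuccSeq κ} (z : ℤ) : s.1.IsPrefix t.1 → GDom.le c 𝒯 (.node s) (.stem t z)
  | node_labI {s t : SuccSeq κ} (x : DomI κ t.1.lastIndex) : s.1.IsPrefix t.1 →
      GDom.le c 𝒯 (.node s) (.labI t x)
  | node_labII {s t : SuccSeq κ} (x : DomII c t.1) : s.1.IsPrefix t.1 →
      GDom.le c 𝒯 (.node s) (.labII t x)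
  | node_labIII {s t : SuccSeq κ} (u : {u : TSeq.{u} Bool // (u, t.1) ∈ 𝒯}) (x : DomIII u.1) :
      s.1.IsPrefix t.1 → GDom.le c 𝒯 (.node s) (.labIII t u x)
  | stem_stem (s : SuccSeq κ) {z z' : ℤ} : z ≤ z' → GDom.le c 𝒯 (.stem s z) (.stem s z')
  | stem_labI (s : SuccSeq κ) (z : ℤ) (x : DomI κ s.1.lastIndex) :
      GDom.le c 𝒯 (.stem s z) (.labI s x)
  | stem_labII (s : SuccSeq κ) (z : ℤ) (x : DomII c s.1) : GDom.le c 𝒯 (.stem s z) (.labII s x)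
  | stem_labIII (s : SuccSeq κ) (z : ℤ) (u : {u : TSeq.{u} Bool // (u, s.1) ∈ 𝒯})
      (x : DomIII u.1) : GDom.le c 𝒯 (.stem s z) (.labIII s u x)
  | labI_labI (s : SuccSeq κ) {x x' : DomI κ s.1.lastIndex} :
      DomI.le (c.L s.1.lastIndex) x x' → GDom.le c 𝒯 (.labI s x) (.labI s x')
  | labII_labII (s : SuccSeq κ) {x x' : DomII c s.1} :
      Broom.le (fun β β' => β ≤ β') x x' → GDom.le c 𝒯 (.labII s x) (.labII s x')
  | labIII_labIII (s : SuccSeq κ) (u : {u : TSeq.{u} Bool // (u, s.1) ∈ 𝒯}) {x x' : DomIII u.1} :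
      Broom.le (c.Lstar u.1) x x' → GDom.le c 𝒯 (.labIII s u x) (.labIII s u x')

end GenTree

end

noncomputable section
namespace GenTree
open Ordinal Cardinal Set

/-! ### Combinatorics of weakly compact cardinals: regularity, strong limit, tree property -/

section WeaklyCompact

variable {κ : Cardinal.{u}}

/-! Embeddability is analytic because the codes of triples (M, N, f), with f an embedding of M into
N, form a closed subset of κ^κ. For hardness, an analytic quasi-order on a standard Borel space is
first moved to 2^κ: it is pushed forward along a Borel injection and the diagonal is added, which
keeps transitivity (`exists_reduction_cantor`). The result is p[T] for a DST-tree T, and T has to be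
turned into generalized trees.

The passage from T to S_T makes reflexivity and transitivity of p[T] visible on initial segments.
Level 0 consists of T and the diagonal, level n + 1 adds compositions of two elements of level n,
and the sequence attached to a composition determines and bounds both of its parts, because ρ is
injective and exceeds its arguments. If ξ witnesses x R y, then s ↦ s ⊕ (0⌢ξ), cut to the length of
s, preserves length and inclusion and takes s_T(x) into s_T(y) (`exists_map_of_rel`). Conversely, a
map of this kind, applied to the constant sequences 0, produces a branch through (x, y) in one fixed
level of S_T (`rel_of_map`). Such a branch is unfolded by induction on the level (`rel_of_core`):
the possible intermediate points of a composition form a tree of height κ whose levels are smaller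
than κ, since the branch bounds the witnesses. Weak compactness yields a branch of that tree, and
transitivity of R applies.

It remains to see that embeddings between the trees G amount to such maps
(`exists_map_of_embedding`, `exists_embedding_of_map`). Nodes and labels are recognised by the
amount of branching above them, and a copy of ℤ does not fit into the well-ordered chains of nodes.
So nodes go to nodes, stems to stems, and the relevant points of each label into a label of the same
type. Labels of type I force lengths to be preserved and labels of type III force membership in s_T.
Labels of type II keep the other two apart, and they may grow, in accordance with # s ≤ # (s ⊕ t).

Mutually non-embeddable linear orders are obtained from disjoint stationary sets of points of
cofinality ω: by Baumgartner's theorem (`not_isStationary_of_embedding`) the lexicographic order of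
a ladder system remembers its set of limit points modulo nonstationary sets. Finally all trees G lie
inside a single one, and a shift as in Hilbert's hotel puts them on the domain κ continuously in x
(`exists_continuous_map`). -/

theorem mk_below (κ : Cardinal.{u}) : #(Below κ) = Cardinal.lift.{u + 1} κ := by
  rw [Cardinal.mk_Iio_ordinal, card_ord]

theorem ord_mk_below (κ : Cardinal.{u}) : ord #(Below κ) = typeLT (Below κ) := by
  rw [mk_below, type_lt_Iio, Cardinal.lift_ord]

theorem mk_Iio_below (β : Below κ) : #(Set.Iio β) < Cardinal.lift.{u + 1} κ := by
  rw [← mk_below]; exact mk_Iio_lt β (ord_mk_below κ)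

theorem IsWeaklyCompact.aleph0_lt_lift (hκ : IsWeaklyCompact κ) :
    ℵ₀ < Cardinal.lift.{u + 1} κ := by
  simpa using hκ.1

theorem IsWeaklyCompact.isSuccLimit (hκ : IsWeaklyCompact κ) : Order.IsSuccLimit κ.ord :=
  isSuccLimit_ord hκ.1.le

theorem IsWeaklyCompact.succ_lt (hκ : IsWeaklyCompact κ) {α : Ordinal.{u}} (h : α < κ.ord) :
    α + 1 < κ.ord := hκ.isSuccLimit.succ_lt h

theorem IsWeaklyCompact.pos (hκ : IsWeaklyCompact κ) : 0 < κ.ord := by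
  simpa using hκ.isSuccLimit.bot_lt

/-- Regularity of a weakly compact cardinal. -/
theorem IsWeaklyCompact.exists_forall_lt (hκ : IsWeaklyCompact κ) {ι : Type (u + 1)}
    (hι : #ι < Cardinal.lift.{u + 1} κ) (f : ι → Below κ) : ∃ b, ∀ i, f i < b := by
  classical
  by_contra! hf
  choose p hp using hf
  -- The index p β has a value that is at least β. A set on which p is constant is bounded, and one
  -- on which p is injective embeds into ι; a homogeneous set of size κ allows neither.
  obtain ⟨H, hH, c, hc⟩ := hκ.2 fun β β' => decide (p β = p β')
  have hmk : ∀ b : Below κ, #(Set.Iic b) < Cardinal.lift.{u + 1} κ := fun b => by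
    have : Set.Iic b ⊆ Set.Iio (⟨b.1 + 1, hκ.succ_lt b.2⟩ : Below κ) := fun x hx => by
      have hx : x.1 ≤ b.1 := hx
      exact Order.lt_succ_iff.2 hx
    exact (mk_le_mk_of_subset this).trans_lt (mk_Iio_below _)
  cases c with
  | true =>
    have : H.Nonempty := by
      rw [Set.nonempty_iff_ne_empty]
      rintro rfl
      rw [mk_eq_zero] at hH
      exact absurd hκ.aleph0_lt_lift (by rw [← hH]; simp)
    obtain ⟨a, ha⟩ := this
    have hsub : H ⊆ Set.Iic (f (p a)) := fun b hb => by
      have : p b = p a := by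
        rcases lt_trichotomy a b with h | h | h
        · simpa [eq_comm] using hc a ha b hb h
        · rw [h]
        · simpa using hc b hb a ha h
      exact this ▸ hp b
    exact (hH ▸ mk_le_mk_of_subset hsub).not_gt (hmk _)
  | false =>
    have hinj : Function.Injective fun a : H => p a.1 := fun a b hab => by
      rcases lt_trichotomy a.1 b.1 with h | h | h
      · simpa [hab] using hc a a.2 b b.2 h
      · exact Subtype.ext h
      · simpa [hab] using hc b b.2 a a.2 h
    exact ((mk_le_of_injective hinj).trans_lt hι).ne hH

theorem IsWeaklyCompact.exists_gt (hκ : IsWeaklyCompact κ) (b : Below κ) : ∃ c : Below κ, b < c :=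
  ⟨⟨b.1 + 1, hκ.succ_lt b.2⟩, Order.lt_succ b.1⟩

theorem unbounded_of_mk {H : Set (Below κ)} (hH : #H = Cardinal.lift.{u + 1} κ) (b : Below κ) :
    ∃ a ∈ H, b ≤ a := by
  by_contra! h
  exact ((mk_le_mk_of_subset (show H ⊆ Set.Iio b from h)).trans_lt (mk_Iio_below b)).ne hH

theorem IsWeaklyCompact.exists_fiber (hκ : IsWeaklyCompact κ) {X : Type (u + 1)}
    {H : Set (Below κ)} (hH : ∀ b : Below κ, ∃ a ∈ H, b ≤ a) (g : Below κ → X)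
    (hX : #(g '' H) < Cardinal.lift.{u + 1} κ) :
    ∃ x, ∀ b, ∃ a ∈ H, b ≤ a ∧ g a = x := by
  by_contra! h
  choose B hB using h
  obtain ⟨b, hb⟩ := hκ.exists_forall_lt hX fun x => B x.1
  obtain ⟨a, ha, hba⟩ := hH b
  exact hB (g a) a ha ((hb ⟨g a, mem_image_of_mem _ ha⟩).le.trans hba) rfl

/-- A sequence on an unbounded set that is monotone or antitone and takes few values is eventually
constant. -/
theorem IsWeaklyCompact.exists_eventually (hκ : IsWeaklyCompact κ) {X : Type (u + 1)}
    [PartialOrder X] {H : Set (Below κ)} (hH : ∀ b : Below κ, ∃ a ∈ H, b ≤ a) (g : Below κ → X)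
    (hX : #(g '' H) < Cardinal.lift.{u + 1} κ) (hg : MonotoneOn g H ∨ AntitoneOn g H) :
    ∃ x, ∃ b, ∀ a ∈ H, b ≤ a → g a = x := by
  obtain ⟨x, hx⟩ := hκ.exists_fiber hH g hX
  obtain ⟨a₀, ha₀, -, h₀⟩ := hx ⟨0, hκ.pos⟩
  refine ⟨x, a₀, fun a ha hle => ?_⟩
  obtain ⟨a₁, ha₁, hle₁, h₁⟩ := hx a
  rcases hg with hg | hg
  · exact le_antisymm (h₁ ▸ hg ha ha₁ hle₁) (h₀ ▸ hg ha₀ ha hle)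
  · exact le_antisymm (h₀ ▸ hg ha₀ ha hle) (h₁ ▸ hg ha ha₁ hle₁)

/-- Every `κ`-sequence in a linear order is weakly monotone or antitone on an unbounded set. -/
theorem IsWeaklyCompact.exists_monotoneOn (hκ : IsWeaklyCompact κ) {X : Type v}
    [LinearOrder X] (g : Below κ → X) :
    ∃ H : Set (Below κ), (∀ b : Below κ, ∃ a ∈ H, b ≤ a) ∧ (MonotoneOn g H ∨ AntitoneOn g H) := by
  classical
  obtain ⟨H, hH, c, hc⟩ := hκ.2 fun β β' => decide (g β ≤ g β')
  refine ⟨H, unbounded_of_mk hH, ?_⟩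
  cases c with
  | true =>
    refine Or.inl fun a ha b hb hab => ?_
    rcases hab.eq_or_lt with rfl | h
    · rfl
    · simpa using hc a ha b hb h
  | false =>
    refine Or.inr fun a ha b hb hab => ?_
    rcases hab.eq_or_lt with rfl | h
    · rfl
    · exact (by simpa using hc a ha b hb h : g b < g a).le

/-- The lexicographic order is decided at the least difference. Truncation to a lower set either
keeps that place or erases every difference, so it is weakly monotone. -/
theorem toLex_trunc_mono {ι : Type v} {A : Type w} [LinearOrder ι] [WellFoundedLT ι] [LinearOrder A]
    (d : A) (P : Set ι) (hP : IsLowerSet P) [DecidablePred (· ∈ P)] {f g : ι → A}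
    (h : toLex f ≤ toLex g) :
    toLex (fun i => if i ∈ P then f i else d) ≤ toLex (fun i => if i ∈ P then g i else d) := by
  rcases h.eq_or_lt with h | ⟨i, hi, hlt⟩
  · rw [toLex_inj.1 h]
  · by_cases hiP : i ∈ P
    · refine le_of_lt ⟨i, fun j hj => ?_, ?_⟩
      · have := hi j hj
        change f j = g j at this
        change (if j ∈ P then f j else d) = if j ∈ P then g j else d
        rw [this]
      · simpa [hiP] using hlt
    · refine le_of_eq (congrArg toLex (funext fun j => ?_))
      by_cases hj : j ∈ P
      · have : j < i := by
          by_contra hji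
          exact hiP (hP (not_lt.1 hji) hj)
        simpa [hj] using hi j this
      · simp [hj]

/-- The branch lemma behind the tree property: for any `κ`-sequence of functions with fewer than
`κ` initial parts of every length, there is a function all of whose initial parts are
initial parts of arbitrarily late members. -/
theorem IsWeaklyCompact.exists_branch (hκ : IsWeaklyCompact κ) {A : Type (u + 1)} [LinearOrder A]
    [Nonempty A] (f : Below κ → Below κ → A)
    (hf : ∀ β : Below κ, #(range fun γ : Set.Ici β => fun i : Set.Iio β => f γ i) <
      Cardinal.lift.{u + 1} κ) :
    ∃ b : Below κ → A, ∀ β : Below κ, ∃ γ, β ≤ γ ∧ ∀ i < β, f γ i = b i := by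
  classical
  let d : A := Classical.arbitrary A
  obtain ⟨H, hH, hmono⟩ := hκ.exists_monotoneOn fun γ => toLex (f γ)
  -- Truncations are padded with a fixed value so that all of them lie in one order. Along H they
  -- remain monotone or antitone, and they take fewer than κ values, hence they stabilise.
  let tr : Below κ → Below κ → Lex (Below κ → A) := fun β γ =>
    toLex fun i => if i ∈ Set.Iio β then f γ i else d
  have key : ∀ β : Below κ, ∃ x : Lex (Below κ → A), ∃ b : Below κ, ∀ a ∈ H ∩ Set.Ici β,
      b ≤ a → tr β a = x := by
    intro β
    refine hκ.exists_eventually (fun b => ?_) (tr β) ?_ ?_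
    · obtain ⟨a, ha, hb⟩ := hH (max b β)
      exact ⟨a, ⟨ha, (le_max_right _ _).trans hb⟩, (le_max_left _ _).trans hb⟩
    · refine lt_of_le_of_lt ?_ (hf β)
      let ex : (Set.Iio β → A) → Lex (Below κ → A) := fun g =>
        toLex fun i => if h : i ∈ Set.Iio β then g ⟨i, h⟩ else d
      have : tr β '' (H ∩ Set.Ici β) ⊆
          ex '' (range fun γ : Set.Ici β => fun i : Set.Iio β => f γ i) := by
        rintro _ ⟨a, ⟨-, ha⟩, rfl⟩
        refine ⟨_, ⟨⟨a, ha⟩, rfl⟩, ?_⟩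
        simp only [ex, tr]
        congr 1
      exact (mk_le_mk_of_subset this).trans mk_image_le
    · have hlow := isLowerSet_Iio β
      rcases hmono with h | h
      · exact Or.inl fun a ha b hb hab => toLex_trunc_mono d _ hlow (h ha.1 hb.1 hab)
      · exact Or.inr fun a ha b hb hab => toLex_trunc_mono d _ hlow (h ha.1 hb.1 hab)
  choose x b hb using key
  choose s hs using hκ.exists_gt
  have hcoh : ∀ β i, i < β → ofLex (x β) i = ofLex (x (s i)) i := by
    intro β i hi
    obtain ⟨a, ha, hab⟩ := hH (max (max (b β) (b (s i))) (max β (s i)))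
    simp only [max_le_iff] at hab
    rw [← hb β a ⟨ha, hab.2.1⟩ hab.1.1, ← hb (s i) a ⟨ha, hab.2.2⟩ hab.1.2]
    simp [tr, hi, hs i]
  refine ⟨fun i => ofLex (x (s i)) i, fun β => ?_⟩
  obtain ⟨a, ha, hab⟩ := hH (max (b β) β)
  simp only [max_le_iff] at hab
  refine ⟨a, hab.2, fun i hi => ?_⟩
  have h1 := congrFun (congrArg ofLex (hb β a ⟨ha, hab.2⟩ hab.1)) i
  rw [hcoh β i hi] at h1
  simpa [tr, hi] using h1

/-- No κ-sequence of distinct points of 2^r, r < κ, is lexicographically monotone: the coordinates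
stabilise one after another, and by regularity all have stabilised from some point on. A homogeneous
set would provide such a sequence if 2^r had size at least κ. -/
theorem IsWeaklyCompact.two_power_lt (hκ : IsWeaklyCompact κ) {c : Cardinal.{u + 1}}
    (hc : c < Cardinal.lift.{u + 1} κ) : 2 ^ c < Cardinal.lift.{u + 1} κ := by
  classical
  by_contra! h
  obtain ⟨r, rfl⟩ : ∃ l : Below κ, #(Set.Iio l) = c := by
    obtain ⟨c, hc', rfl⟩ := lt_lift_iff.1 hc
    refine ⟨⟨c.ord, ord_lt_ord.2 hc'⟩, ?_⟩
    have e : Set.Iio (⟨c.ord, ord_lt_ord.2 hc'⟩ : Below κ) ≃ Set.Iio c.ord :=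
      { toFun := fun x => ⟨x.1.1, x.2⟩
        invFun := fun x => ⟨⟨x.1, lt_trans (show x.1 < c.ord from x.2) (ord_lt_ord.2 hc')⟩, x.2⟩
        left_inv := fun _ => rfl
        right_inv := fun _ => rfl }
    rw [mk_congr e, Cardinal.mk_Iio_ordinal, card_ord]
  let I := Set.Iio r
  have h' : #(Below κ) ≤ #(I → ULift.{u+1} Bool) := by
    rw [mk_below]; simpa [I] using h
  obtain ⟨g⟩ := h'
  obtain ⟨H, hH, hmono⟩ := hκ.exists_monotoneOn
    fun γ => toLex fun i => (g γ i).down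
  have hfin : ∀ Y : Set (ULift.{u + 1} Bool), #Y < Cardinal.lift.{u + 1} κ := fun Y =>
    (lt_aleph0_of_finite Y).trans hκ.aleph0_lt_lift
  have key : ∀ i : I, ∃ x : Bool, ∃ b : Below κ, ∀ a ∈ H, b ≤ a → (g a i).down = x := by
    intro i
    induction i using WellFoundedLT.induction with
    | ind i ih =>
      have ih' : ∀ j : Set.Iio i, ∃ x : Bool, ∃ b : Below κ, ∀ a ∈ H, b ≤ a →
          (g a j.1).down = x := fun j => ih j.1 j.2
      choose x b hb using ih'
      -- Beyond b₀ all earlier coordinates are constant, so the lexicographic order makes coordinate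
      -- i itself monotone or antitone.
      obtain ⟨b₀, hb₀⟩ := hκ.exists_forall_lt (ι := Set.Iio i)
        ((mk_le_of_injective (Subtype.val_injective)).trans_lt (mk_Iio_below r)) b
      obtain ⟨x, c, hc⟩ := hκ.exists_eventually (H := H ∩ Set.Ici b₀)
        (g := fun γ => (ULift.up (g γ i).down : ULift.{u + 1} Bool)) (fun c => by
          obtain ⟨a, ha, hac⟩ := hH (max c b₀)
          exact ⟨a, ⟨ha, (le_max_right _ _).trans hac⟩, (le_max_left _ _).trans hac⟩)
        (hfin _) (by
          have hag : ∀ a ∈ H ∩ Set.Ici b₀, ∀ a' ∈ H ∩ Set.Ici b₀, ∀ j < i,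
              (g a j).down = (g a' j).down := fun a ha a' ha' j hj => by
            rw [hb ⟨j, hj⟩ a ha.1 ((hb₀ ⟨j, hj⟩).le.trans ha.2),
              hb ⟨j, hj⟩ a' ha'.1 ((hb₀ ⟨j, hj⟩).le.trans ha'.2)]
          rcases hmono with h | h
          · exact Or.inl fun a ha a' ha' haa => Pi.apply_le_of_toLex (h ha.1 ha'.1 haa)
              (hag a ha a' ha')
          · exact Or.inr fun a ha a' ha' haa => Pi.apply_le_of_toLex (h ha.1 ha'.1 haa)
              (hag a' ha' a ha))
      refine ⟨x.down, max b₀ c, fun a ha hle => ?_⟩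
      rw [max_le_iff] at hle
      exact congrArg ULift.down (hc a ⟨ha, hle.1⟩ hle.2)
  choose x b hb using key
  obtain ⟨b₀, hb₀⟩ := hκ.exists_forall_lt (ι := I) (mk_Iio_below r) b
  obtain ⟨a, ha, hle⟩ := hH b₀
  obtain ⟨c, hc⟩ := hκ.exists_gt a
  obtain ⟨a', ha', hle'⟩ := hH c
  have : a = a' := g.injective <| funext fun i => ULift.ext _ _ <| by
    rw [hb i a ha ((hb₀ i).le.trans hle),
      hb i a' ha' ((hb₀ i).le.trans (hle.trans (hc.le.trans hle')))]
  exact absurd (hc.trans_le hle') this.not_lt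

theorem IsWeaklyCompact.cof_below (hκ : IsWeaklyCompact κ) :
    Order.cof (Below κ) = Cardinal.lift.{u + 1} κ := by
  refine le_antisymm ((Order.cof_le_cardinalMk _).trans_eq (mk_below κ)) (Order.le_cof_iff.2 ?_)
  intro s hs
  by_contra! h
  obtain ⟨b, hb⟩ := hκ.exists_forall_lt h Subtype.val
  obtain ⟨c, hc, hbc⟩ := hs b
  exact (hb ⟨c, hc⟩).not_ge hbc

theorem IsWeaklyCompact.isRegular (hκ : IsWeaklyCompact κ) : κ.IsRegular := by
  refine ⟨hκ.1.le, ?_⟩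
  have := hκ.cof_below
  rw [cof_Iio, ← Ordinal.lift_cof, Cardinal.lift_inj] at this
  exact this.ge

theorem IsWeaklyCompact.mk_fun_lt (hκ : IsWeaklyCompact κ) {X Y : Type (u + 1)}
    (hX : #X < Cardinal.lift.{u + 1} κ) (hY : #Y < Cardinal.lift.{u + 1} κ) :
    #(X → Y) < Cardinal.lift.{u + 1} κ := by
  rw [← power_def]
  refine (power_le_power_right (cantor #Y).le).trans_lt ?_
  rw [← power_mul]
  exact hκ.two_power_lt (mul_lt_of_lt hκ.aleph0_lt_lift.le hY hX)

theorem IsWeaklyCompact.mk_sigma_le (hκ : IsWeaklyCompact κ) {X : Below κ → Type (u + 1)}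
    (hX : ∀ α, #(X α) ≤ Cardinal.lift.{u + 1} κ) : #(Σ α, X α) ≤ Cardinal.lift.{u + 1} κ := by
  rw [mk_sigma]
  refine (sum_le_sum _ _ hX).trans ?_
  rw [sum_const', mk_below, mul_eq_self hκ.aleph0_lt_lift.le]

/-- `κ ^ (< κ) = κ`. -/
theorem IsWeaklyCompact.mk_sigma_fun_le (hκ : IsWeaklyCompact κ) {A : Type (u + 1)}
    (hA : #A ≤ Cardinal.lift.{u + 1} κ) :
    #(Σ α : Below κ, Set.Iio α → A) ≤ Cardinal.lift.{u + 1} κ := by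
  refine hκ.mk_sigma_le fun α => ?_
  rw [← mk_below] at hA
  obtain ⟨e⟩ := hA
  -- By regularity every such function is bounded, which distributes all of them over κ many
  -- function spaces of size less than κ.
  have hb : ∀ f : Set.Iio α → A, ∃ b : Below κ, ∀ i, e (f i) < b := fun f =>
    hκ.exists_forall_lt (mk_Iio_below α) _
  choose b hb using hb
  refine (mk_le_of_injective (β := Σ b : Below κ, Set.Iio α → Set.Iio b)
    (f := fun f => ⟨b f, fun i => ⟨e (f i), hb f i⟩⟩) fun f g hfg => ?_).trans
    (hκ.mk_sigma_le fun b => (hκ.mk_fun_lt (mk_Iio_below α) (mk_Iio_below b)).le)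
  have : ∀ i, e (f i) = e (g i) := fun i => by
    have h : ∀ p q : (Σ b : Below κ, Set.Iio α → Set.Iio b), p = q → (p.2 i).1 = (q.2 i).1 := by
      rintro p q rfl; rfl
    exact h _ _ hfg
  exact funext fun i => e.injective (this i)

theorem IsWeaklyCompact.two_power_lt' (hκ : IsWeaklyCompact κ) {c : Cardinal.{u}}
    (hc : c < κ) : 2 ^ c < κ := by
  have := hκ.two_power_lt (Cardinal.lift_lt.2 hc)
  rwa [← lift_two_power, Cardinal.lift_lt] at this

end WeaklyCompact

/-! ### Transfinite sequences, initial segments and their number -/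

section Sequences

variable {A : Type w}

theorem TSeq.ext_val {s t : TSeq.{u} A} (h : s.len = t.len)
    (hv : ∀ β (h₁ : β < s.len) (h₂ : β < t.len), s.val ⟨β, h₁⟩ = t.val ⟨β, h₂⟩) : s = t := by
  obtain ⟨l, f⟩ := s
  obtain ⟨l', g⟩ := t
  obtain rfl : l = l' := h
  congr 1
  exact funext fun β => hv β.1 β.2 β.2

theorem TSeq.val_congr {s t : TSeq.{u} A} (h : s = t) {β : Ordinal.{u}} (h₁ : β < s.len)
    (h₂ : β < t.len) : s.val ⟨β, h₁⟩ = t.val ⟨β, h₂⟩ := by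
  subst h; rfl

theorem TSeq.restrict_len (s : TSeq.{u} A) (α : Ordinal.{u}) : (s.restrict α).len = min s.len α :=
  rfl

theorem TSeq.restrict_len_of_le {s : TSeq.{u} A} {α : Ordinal.{u}} (h : α ≤ s.len) :
    (s.restrict α).len = α := min_eq_right h

theorem TSeq.restrict_val (s : TSeq.{u} A) (α : Ordinal.{u}) {β : Ordinal.{u}}
    (h : β < (s.restrict α).len) :
    (s.restrict α).val ⟨β, h⟩ = s.val ⟨β, (lt_min_iff.1 h).1⟩ := rfl

theorem TSeq.restrict_of_le {s : TSeq.{u} A} {α : Ordinal.{u}} (h : s.len ≤ α) :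
    s.restrict α = s :=
  TSeq.ext_val (min_eq_left h) fun _ _ _ => rfl

theorem TSeq.restrict_restrict (s : TSeq.{u} A) (α β : Ordinal.{u}) :
    (s.restrict α).restrict β = s.restrict (min α β) :=
  TSeq.ext_val (min_assoc _ _ _) fun _ _ _ => rfl

theorem TSeq.isPrefix_iff {s t : TSeq.{u} A} : s.IsPrefix t ↔ s.len ≤ t.len ∧
    ∀ β (h₁ : β < s.len) (h₂ : β < t.len), s.val ⟨β, h₁⟩ = t.val ⟨β, h₂⟩ := by
  constructor
  · intro h
    have hl : s.len ≤ t.len := by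
      have := congrArg TSeq.len h
      rw [this]; exact min_le_left _ _
    refine ⟨hl, fun β h₁ h₂ => ?_⟩
    rw [TSeq.val_congr h h₁ (lt_min h₂ h₁)]; rfl
  · rintro ⟨hl, hv⟩
    exact TSeq.ext_val (min_eq_right hl).symm fun β h₁ h₂ => hv β h₁ _

theorem TSeq.IsPrefix.refl (s : TSeq.{u} A) : s.IsPrefix s :=
  (TSeq.restrict_of_le le_rfl).symm

theorem TSeq.IsPrefix.len_le {s t : TSeq.{u} A} (h : s.IsPrefix t) : s.len ≤ t.len :=
  (TSeq.isPrefix_iff.1 h).1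

theorem TSeq.IsPrefix.trans {s t r : TSeq.{u} A} (h₁ : s.IsPrefix t) (h₂ : t.IsPrefix r) :
    s.IsPrefix r := by
  rw [TSeq.isPrefix_iff] at *
  exact ⟨h₁.1.trans h₂.1, fun β hs hr =>
    (h₁.2 β hs (hs.trans_le h₁.1)).trans (h₂.2 β (hs.trans_le h₁.1) hr)⟩

theorem TSeq.IsPrefix.eq_of_len_le {s t : TSeq.{u} A} (h : s.IsPrefix t) (hl : t.len ≤ s.len) :
    s = t := by
  rw [TSeq.isPrefix_iff] at h
  exact TSeq.ext_val (h.1.antisymm hl) h.2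

theorem TSeq.IsPrefix.antisymm {s t : TSeq.{u} A} (h₁ : s.IsPrefix t) (h₂ : t.IsPrefix s) :
    s = t := h₁.eq_of_len_le h₂.len_le

theorem TSeq.IsPrefix.of_len_le {s t r : TSeq.{u} A} (h₁ : s.IsPrefix r) (h₂ : t.IsPrefix r)
    (hl : s.len ≤ t.len) : s.IsPrefix t := by
  rw [TSeq.isPrefix_iff] at *
  exact ⟨hl, fun β hs ht => (h₁.2 β hs (ht.trans_le h₂.1)).trans
    (h₂.2 β ht (ht.trans_le h₂.1)).symm⟩

theorem TSeq.IsPrefix.total {s t r : TSeq.{u} A} (h₁ : s.IsPrefix r) (h₂ : t.IsPrefix r) :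
    s.IsPrefix t ∨ t.IsPrefix s :=
  (le_total s.len t.len).imp (h₁.of_len_le h₂) (h₂.of_len_le h₁)

theorem TSeq.restrict_isPrefix (s : TSeq.{u} A) (α : Ordinal.{u}) : (s.restrict α).IsPrefix s :=
  TSeq.isPrefix_iff.2 ⟨min_le_left _ _, fun _ _ _ => rfl⟩

theorem TSeq.lastIndex_eq {s : TSeq.{u} A} {γ : Ordinal.{u}} (h : s.len = γ + 1) :
    s.lastIndex = γ := by
  have : {γ' | s.len ≤ γ' + 1} = Set.Ici γ := by
    ext x
    simp only [mem_ofPred_eq, mem_Ici, h]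
    exact Order.add_one_le_iff.trans Order.lt_add_one_iff
  rw [TSeq.lastIndex, this, csInf_Ici]

variable {κ : Cardinal.{u}}

theorem TSeq.ofFun_len (x : Below κ → A) {α : Ordinal.{u}} (h : α ≤ κ.ord) :
    (TSeq.ofFun x α).len = α := min_eq_right h

theorem TSeq.ofFun_val (x : Below κ → A) (α : Ordinal.{u}) {β : Ordinal.{u}}
    (h : β < (TSeq.ofFun x α).len) :
    (TSeq.ofFun x α).val ⟨β, h⟩ = x ⟨β, (lt_min_iff.1 h).1⟩ := rfl

theorem TSeq.ofFun_restrict (x : Below κ → A) (α β : Ordinal.{u}) :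
    (TSeq.ofFun x α).restrict β = TSeq.ofFun x (min α β) :=
  TSeq.ext_val (min_assoc _ _ _) fun _ _ _ => rfl

theorem TSeq.ofFun_eq_iff {x y : Below κ → A} {α : Ordinal.{u}} :
    TSeq.ofFun x α = TSeq.ofFun y α ↔ ∀ β : Below κ, β.1 < α → x β = y β := by
  constructor
  · intro h β hβ
    exact TSeq.val_congr h (lt_min β.2 hβ) (lt_min β.2 hβ)
  · intro h
    exact TSeq.ext_val rfl fun β h₁ h₂ => h _ (lt_min_iff.1 h₁).2

theorem mk_seq_le (hκ : IsWeaklyCompact κ) {A : Type (u + 1)} {B : Set A}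
    (hB : #B ≤ Cardinal.lift.{u + 1} κ) :
    #{s : TSeq.{u} A | s.len < κ.ord ∧ ∀ β, s.val β ∈ B} ≤ Cardinal.lift.{u + 1} κ := by
  refine (mk_le_of_injective (β := Σ α : Below κ, Set.Iio α → B)
    (f := fun s => ⟨⟨s.1.len, s.2.1⟩, fun i => ⟨s.1.val ⟨i.1.1, i.2⟩, s.2.2 _⟩⟩) ?_).trans
    (hκ.mk_sigma_fun_le hB)
  intro s t hst
  have h : ∀ p q : (Σ α : Below κ, Set.Iio α → B), p = q → p.1 = q.1 ∧
      ∀ i (h₁ : i < p.1) (h₂ : i < q.1), p.2 ⟨i, h₁⟩ = q.2 ⟨i, h₂⟩ := by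
    rintro p q rfl; exact ⟨rfl, fun _ _ _ => rfl⟩
  obtain ⟨h₁, h₂⟩ := h _ _ hst
  refine Subtype.ext (TSeq.ext_val (congrArg Subtype.val h₁) fun β hs ht => ?_)
  exact congrArg Subtype.val (h₂ ⟨β, hs.trans s.2.1⟩ hs ht)

theorem mk_boolSeq_le (hκ : IsWeaklyCompact κ) :
    #{u : TSeq.{u} Bool | u.len < κ.ord} ≤ Cardinal.lift.{u + 1} κ := by
  refine (mk_le_of_injective (β := Σ α : Below κ, Set.Iio α → ULift.{u + 1} Bool)
    (f := fun s => ⟨⟨s.1.len, s.2⟩, fun i => ⟨s.1.val ⟨i.1.1, i.2⟩⟩⟩) ?_).trans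
    (hκ.mk_sigma_fun_le ((lt_aleph0_of_finite _).trans hκ.aleph0_lt_lift).le)
  intro s t hst
  have h : ∀ p q : (Σ α : Below κ, Set.Iio α → ULift.{u + 1} Bool), p = q → p.1 = q.1 ∧
      ∀ i (h₁ : i < p.1) (h₂ : i < q.1), p.2 ⟨i, h₁⟩ = q.2 ⟨i, h₂⟩ := by
    rintro p q rfl; exact ⟨rfl, fun _ _ _ => rfl⟩
  obtain ⟨h₁, h₂⟩ := h _ _ hst
  refine Subtype.ext (TSeq.ext_val (congrArg Subtype.val h₁) fun β hs ht => ?_)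
  exact congrArg ULift.down (h₂ ⟨β, hs.trans s.2⟩ hs ht)

theorem mk_succSeq (hκ : IsWeaklyCompact κ) : #(SuccSeq κ) = Cardinal.lift.{u + 1} κ := by
  refine le_antisymm ((mk_le_mk_of_subset (t := {s : TSeq.{u} Ordinal.{u} |
    s.len < κ.ord ∧ ∀ β, s.val β ∈ Set.Iio κ.ord}) fun s hs => hs.1).trans
    (mk_seq_le hκ (mk_below κ).le)) ?_
  rw [← mk_below]
  have h1 : (0 : Ordinal.{u}) + 1 < κ.ord := hκ.succ_lt hκ.pos
  refine mk_le_of_injective (f := fun a : Below κ =>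
    (⟨TSeq.const a.1 (0 + 1), ⟨h1, fun _ => a.2⟩, 0, rfl⟩ : SuccSeq κ)) fun a b hab => ?_
  exact Subtype.ext (TSeq.val_congr (congrArg Subtype.val hab) (β := 0)
    (show (0 : Ordinal.{u}) < 0 + 1 by simp) (show (0 : Ordinal.{u}) < 0 + 1 by simp))

end Sequences
end GenTree
end

noncomputable section
namespace GenTree
open Ordinal Cardinal Set

/-! ### Clubs, Fodor's lemma and splitting of stationary sets on a regular cardinal -/

section Club

variable {c : Cardinal.{u}}

theorem cof_below_of_isRegular (hc : c.IsRegular) :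
    Order.cof (Below c) = Cardinal.lift.{u + 1} c := by
  rw [cof_Iio, ← Ordinal.lift_cof, hc.cof_ord]

/-- The club arguments are needed on the successor cardinals μ(γ) as well as on κ, so bounds are
derived from regularity alone. -/
theorem exists_bound (hc : c.IsRegular) {ι : Type v}
    (hι : Cardinal.lift.{u + 1} #ι < Cardinal.lift.{v} (Cardinal.lift.{u + 1} c))
    (f : ι → Below c) : ∃ b, ∀ i, f i < b := by
  by_contra! h
  have h1 : IsCofinal (range f) := fun b => by
    obtain ⟨i, hi⟩ := h b
    exact ⟨f i, mem_range_self i, hi⟩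
  have h2 := Order.cof_le h1
  rw [cof_below_of_isRegular hc] at h2
  have h3 := mk_range_le_lift (f := f)
  have h4 := Cardinal.lift_le.{v}.2 h2
  exact (h4.trans h3).not_gt hι

theorem exists_bound_of_mk_lt (hc : c.IsRegular) {ι : Type (u + 1)}
    (hι : #ι < Cardinal.lift.{u + 1} c) (f : ι → Below c) : ∃ b, ∀ i, f i < b :=
  exists_bound hc (by rwa [Cardinal.lift_id, Cardinal.lift_lift] at *) f

theorem exists_gt_below (hc : c.IsRegular) (b : Below c) : ∃ b' : Below c, b < b' :=
  ⟨⟨b.1 + 1, (isSuccLimit_ord hc.aleph0_le).succ_lt b.2⟩, Order.lt_succ b.1⟩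


theorem exists_isLUB_of_bddAbove {α : Type v} [LinearOrder α] [WellFoundedLT α] {t : Set α}
    (h : BddAbove t) : ∃ δ, IsLUB t δ := by
  obtain ⟨m, hm, hmin⟩ := wellFounded_lt.has_min (upperBounds t) h
  exact ⟨m, hm, fun x hx => not_lt.1 (hmin x hx)⟩

theorem cof_below_ne (hc : c.IsRegular) (h0 : ℵ₀ < c) : Order.cof (Below c) ≠ ℵ₀ := by
  rw [cof_below_of_isRegular hc]
  exact (show ℵ₀ < Cardinal.lift.{u + 1} c by simpa using h0).ne'

/-- `ω`-sequences below an uncountable regular cardinal have a supremum. -/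
theorem exists_isLUB_seq (hc : c.IsRegular) (h0 : ℵ₀ < c) (a : ℕ → Below c) :
    ∃ δ, IsLUB (range a) δ := by
  obtain ⟨b, hb⟩ := exists_bound hc (by simpa using h0) a
  exact exists_isLUB_of_bddAbove ⟨b, by rintro _ ⟨n, rfl⟩; exact (hb n).le⟩

/-- Iterating ω times a function that dominates H on initial segments leads to a closed point; the
supremum stays below c by uncountable regularity. -/
theorem isClub_closed (hc : c.IsRegular) (h0 : ℵ₀ < c) (H : Below c → Below c) :
    IsClub {δ : Below c | ∀ b < δ, H b < δ} := by
  refine ⟨fun d hd _ _ a ha b hb => ?_, fun a => ?_⟩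
  · obtain ⟨x, hx, hbx⟩ := (lt_isLUB_iff ha).1 hb
    exact (hd hx b hbx).trans_le (ha.1 hx)
  · have hb : ∀ b : Below c, ∃ b', b < b' ∧ ∀ x : Set.Iio b, H x.1 < b' := fun b => by
      obtain ⟨b₁, h₁⟩ := exists_bound_of_mk_lt hc (mk_Iio_below b) fun x => H x.1
      obtain ⟨b₂, h₂⟩ := exists_gt_below hc (max b b₁)
      exact ⟨b₂, (le_max_left _ _).trans_lt h₂,
        fun x => (h₁ x).trans ((le_max_right _ _).trans_lt h₂)⟩
    choose N hN hH using hb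
    let s : ℕ → Below c := fun n => N^[n] a
    obtain ⟨δ, hδ⟩ := exists_isLUB_seq hc h0 s
    refine ⟨δ, fun b hb => ?_, hδ.1 ⟨0, rfl⟩⟩
    obtain ⟨_, ⟨n, rfl⟩, hbx⟩ := (lt_isLUB_iff hδ).1 hb
    refine (hH (s n) ⟨b, hbx⟩).trans_le (hδ.1 ⟨n + 1, ?_⟩)
    exact Function.iterate_succ_apply' N n a

/-- If δ is closed under finding, for every ζ < δ, later elements of C ζ, then δ is a limit of each
of these clubs. -/
theorem isClub_diagonal (hc : c.IsRegular) (h0 : ℵ₀ < c) {C : Below c → Set (Below c)}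
    (hC : ∀ ζ, IsClub (C ζ)) : IsClub {δ : Below c | ∀ ζ < δ, δ ∈ C ζ} := by
  refine ⟨fun d hd _ _ a ha ζ hζ => ?_, fun a => ?_⟩
  · obtain ⟨x, hx, hζx⟩ := (lt_isLUB_iff ha).1 hζ
    refine (hC ζ).isLUB_mem (t := d ∩ Set.Ioi ζ) (fun y hy => hd hy.1 ζ hy.2) ⟨x, hx, hζx⟩ ?_
    refine ⟨fun y hy => ha.1 hy.1, fun y hy => ha.2 fun z hz => ?_⟩
    rcases lt_or_ge ζ z with h | h
    · exact hy ⟨hz, h⟩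
    · exact h.trans (hζx.le.trans (hy ⟨hx, hζx⟩))
  · have hb : ∀ b : Below c, ∃ b', b < b' ∧ ∀ ζ ≤ b, ∃ x ∈ C ζ, b < x ∧ x < b' := fun b => by
      obtain ⟨b₂, h₂⟩ := exists_gt_below hc b
      choose x hx using fun ζ : Set.Iio b₂ => (hC ζ.1).isCofinal b₂
      obtain ⟨b₁, h₁⟩ := exists_bound_of_mk_lt hc (mk_Iio_below b₂) x
      exact ⟨max b₁ b₂, h₂.trans_le (le_max_right _ _), fun ζ hζ =>
        ⟨x ⟨ζ, hζ.trans_lt h₂⟩, (hx ⟨ζ, hζ.trans_lt h₂⟩).1, h₂.trans_le (hx _).2,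
          (h₁ _).trans_le (le_max_left _ _)⟩⟩
    choose N hN hx using hb
    obtain ⟨a', ha'⟩ := exists_gt_below hc a
    obtain ⟨δ, hδ, haδ⟩ := (isClub_closed hc h0 N).isCofinal a'
    refine ⟨δ, fun ζ hζ => ?_, ha'.le.trans haδ⟩
    refine (hC ζ).isLUB_mem (t := C ζ ∩ Set.Iio δ) inter_subset_left ?_ ?_
    · obtain ⟨x, hx, -, hxN⟩ := hx ζ ζ le_rfl
      exact ⟨x, hx, hxN.trans (hδ ζ hζ)⟩
    · refine ⟨fun y hy => (show y < δ from hy.2).le, fun y hy => ?_⟩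
      by_contra! hlt
      obtain ⟨x, hxC, hlx, hxN⟩ := hx (max ζ y) ζ (le_max_left _ _)
      have h1 : x < δ := hxN.trans (hδ _ (max_lt hζ hlt))
      exact ((le_max_right _ _).trans_lt hlx).not_ge (hy ⟨hxC, h1⟩)

/-- Fodor's lemma. -/
theorem exists_stationary_fiber (hc : c.IsRegular) (h0 : ℵ₀ < c) {S : Set (Below c)}
    (hS : IsStationary S) (g : Below c → Below c) (hg : ∀ α ∈ S, g α < α) :
    ∃ ζ, IsStationary {α ∈ S | g α = ζ} := by
  by_contra! h
  simp_rw [not_isStationary_iff] at h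
  choose C hC hd using h
  obtain ⟨δ, hδ, hδC⟩ := hS (isClub_diagonal hc h0 hC)
  exact Set.disjoint_left.1 (hd (g δ)) ⟨hδ, rfl⟩ (hδC _ (hg δ hδ))

/-- The points of cofinality `ω`. -/
def cofOmega (c : Cardinal.{u}) : Set (Below c) :=
  {δ | ∃ f : ℕ → Below c, (∀ n, f n < δ) ∧ ∀ b < δ, ∃ n, b ≤ f n}

/-- The supremum of ω successive elements of a club lies in the club, and these elements are cofinal
in it. -/
theorem isStationary_cofOmega (hc : c.IsRegular) (h0 : ℵ₀ < c) : IsStationary (cofOmega c) := by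
  intro C hC
  have : ∀ b : Below c, ∃ b' ∈ C, b < b' := fun b => by
    obtain ⟨b', hb'⟩ := exists_gt_below hc b
    obtain ⟨x, hx, hle⟩ := hC.isCofinal b'
    exact ⟨x, hx, hb'.trans_le hle⟩
  choose N hNC hN using this
  let a : Below c := ⟨0, by simpa using (isSuccLimit_ord hc.aleph0_le).bot_lt⟩
  let s : ℕ → Below c := fun n => N^[n + 1] a
  have hs : ∀ n, s n < s (n + 1) := fun n => by
    simp only [s]
    rw [Function.iterate_succ_apply' N (n + 1)]
    exact hN _
  obtain ⟨δ, hδ⟩ := exists_isLUB_seq hc h0 s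
  refine ⟨δ, ⟨s, fun n => (hs n).trans_le (hδ.1 ⟨n + 1, rfl⟩), fun b hb => ?_⟩, ?_⟩
  · obtain ⟨_, ⟨n, rfl⟩, h⟩ := (lt_isLUB_iff hδ).1 hb
    exact ⟨n, h.le⟩
  · refine hC.isLUB_mem (t := range s) ?_ (range_nonempty _) hδ
    rintro _ ⟨n, rfl⟩
    simp only [s, Function.iterate_succ_apply' N]
    exact hNC _

/-- The points of cofinality `ω` contain `c` many disjoint stationary sets. -/
theorem exists_disjoint_stationary (hc : c.IsRegular) (h0 : ℵ₀ < c) :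
    ∃ S : Below c → Set (Below c), (∀ i, IsStationary (S i)) ∧ (∀ i, S i ⊆ cofOmega c) ∧
      Pairwise fun i j => Disjoint (S i) (S j) := by
  have : ∀ δ : Below c, ∃ f : ℕ → Below c, δ ∈ cofOmega c →
      (∀ n, f n < δ) ∧ ∀ b < δ, ∃ n, b ≤ f n := fun δ => by
    by_cases h : δ ∈ cofOmega c
    · obtain ⟨f, hf⟩ := h
      exact ⟨f, fun _ => hf⟩
    · exact ⟨fun _ => δ, fun h' => absurd h' h⟩
  choose f hf using this
  -- Otherwise for each n the values f α n are below some η n on a club of α. On the intersection of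
  -- these clubs all ladders are then below one common bound, which contradicts cofinality of the
  -- ladder of a large α.
  obtain ⟨n, hn⟩ : ∃ n, ∀ η, IsStationary {α ∈ cofOmega c | η ≤ f α n} := by
    by_contra! h
    choose η hη using h
    simp_rw [not_isStationary_iff] at hη
    choose C hC hd using hη
    obtain ⟨b, hb⟩ := exists_bound hc (by simpa using h0) η
    obtain ⟨b', hb'⟩ := exists_gt_below hc b
    obtain ⟨α, hα, hαC, hbα⟩ := isStationary_cofOmega hc h0
      ((IsClub.iInter_of_countable (cof_below_ne hc h0) hC).inter (cof_below_ne hc h0)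
        (show IsClub (Set.Ici b') from ⟨fun d hd hne _ a ha => by
          obtain ⟨x, hx⟩ := hne
          exact (hd hx).trans (ha.1 hx), fun a => ⟨max a b', mem_Ici.2 (le_max_right a b'),
            le_max_left _ _⟩⟩))
    obtain ⟨n, hn⟩ := (hf α hα).2 b (hb'.trans_le hbα)
    exact Set.disjoint_left.1 (hd n) ⟨hα, (hb n).le.trans hn⟩ (mem_iInter.1 hαC n)
  -- Pressing down gives stationary fibres over arbitrarily large ζ, hence over c many; distinct
  -- fibres are disjoint.
  let Z : Set (Below c) := {ζ | IsStationary {α ∈ cofOmega c | f α n = ζ}}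
  have hZ : IsCofinal Z := fun η => by
    obtain ⟨ζ, hζ⟩ := exists_stationary_fiber hc h0 (hn η) (fun α => f α n)
      fun α hα => (hf α hα.1).1 n
    obtain ⟨α, hα, hαζ⟩ := hζ.nonempty
    exact ⟨ζ, hζ.mono fun α hα => ⟨hα.1.1, hα.2⟩, hαζ ▸ hα.2⟩
  have hmk : #(Below c) ≤ #Z := by
    rw [mk_below, ← cof_below_of_isRegular hc]
    exact Order.cof_le hZ
  obtain ⟨e⟩ := hmk
  refine ⟨fun i => {α ∈ cofOmega c | f α n = (e i).1}, fun i => (e i).2, fun i α hα => hα.1,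
    fun i j hij => Set.disjoint_left.2 fun α hα hα' => hij (e.injective (Subtype.ext ?_))⟩
  exact hα.2.symm.trans hα'.2

end Club

/-! ### Baumgartner's theorem on lexicographically ordered ladder systems -/

section Ladder

variable {c : Cardinal.{u}}

/-- `g a` is a cofinal `ω`-sequence in `e a`, for an injective enumeration `e`. -/
structure IsLadder (e : Below c → Below c) (g : Below c → ℕ → Below c) : Prop where
  inj : Function.Injective e
  lt : ∀ a n, g a n < e a
  cofinal : ∀ a, ∀ b < e a, ∃ n, b ≤ g a n

/-- The lexicographic order on the indices of a ladder system. -/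
def lexRel (g : Below c → ℕ → Below c) (a b : Below c) : Prop := toLex (g a) ≤ toLex (g b)

theorem IsLadder.injective {e : Below c → Below c} {g : Below c → ℕ → Below c}
    (h : IsLadder e g) : Function.Injective g := by
  intro a b hab
  by_contra hne
  wlog hlt : e a < e b generalizing a b
  · exact this hab.symm (Ne.symm hne)
      ((not_lt.1 hlt).lt_of_ne fun heq => hne (h.inj heq.symm))
  obtain ⟨n, hn⟩ := h.cofinal b _ hlt
  exact (hn.trans_lt (hab ▸ h.lt a n)).false

theorem IsLadder.isLinOrd {e : Below c → Below c} {g : Below c → ℕ → Below c}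
    (h : IsLadder e g) : IsLinOrd (lexRel g) :=
  ⟨fun _ => le_refl _, fun _ _ _ h₁ h₂ => le_trans h₁ h₂,
    fun _ _ h₁ h₂ => h.injective (toLex_inj.1 (le_antisymm h₁ h₂)), fun _ _ => le_total _ _⟩

theorem IsLadder.comp {e : Below c → Below c} {g : Below c → ℕ → Below c}
    (h : IsLadder e g) {i : Below c → Below c} (hi : Function.Injective i) :
    IsLadder (e ∘ i) (g ∘ i) :=
  ⟨h.inj.comp hi, fun _ => h.lt _, fun _ => h.cofinal _⟩

/-- Baumgartner's theorem: if the lexicographic order of one ladder system embeds into that of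
another one, then the first set of limit points is contained in the second up to a nonstationary
set. -/
theorem not_isStationary_of_embedding (hc : c.IsRegular) (h0 : ℵ₀ < c)
    {e e' : Below c → Below c} {g g' : Below c → ℕ → Below c} (hg : IsLadder e g)
    (hg' : IsLadder e' g') (h : lexRel g ↪r lexRel g') :
    ¬ IsStationary (range e \ range e') := by
  classical
  intro hS
  have hlt : ∀ {a b}, toLex (g a) < toLex (g b) → toLex (g' (h a)) < toLex (g' (h b)) :=
    fun {a b} hab => not_le.1 fun hle => hab.not_ge (h.map_rel_iff.1 hle)
  let pre : (ℕ → Below c) → ℕ → List (Below c) := fun f n => (List.range n).map f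
  -- `I s` collects the indices whose image ladder begins with s; below, m s is its greatest element
  -- in the order of g, if there is one.
  let I : List (Below c) → Set (Below c) := fun s => {a | pre (g' (h a)) s.length = s}
  let z : Below c := ⟨0, by simpa using (isSuccLimit_ord hc.aleph0_le).bot_lt⟩
  have hm : ∀ s, ∃ m, ∀ a ∈ I s, (∀ b ∈ I s, toLex (g b) ≤ toLex (g a)) → m = a := fun s => by
    by_cases hex : ∃ a ∈ I s, ∀ b ∈ I s, toLex (g b) ≤ toLex (g a)
    · obtain ⟨a, ha, hmax⟩ := hex
      exact ⟨a, fun a' ha' hmax' => hg.injective (toLex_inj.1 ((hmax' a ha).antisymm (hmax a' ha')))⟩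
    · exact ⟨z, fun a ha hmax => absurd ⟨a, ha, hmax⟩ hex⟩
  choose m hm using hm
  -- The witness w s t γ is an index in `I s` whose ladder lies lexicographically above every ladder
  -- beginning with t followed by γ.
  let Q : List (Below c) → List (Below c) → Below c → Below c → Prop := fun s t γ b =>
    b ∈ I s ∧ pre (g b) t.length = t ∧ γ < g b t.length
  have hw : ∀ s t γ, ∃ w, (∃ b, Q s t γ b) → Q s t γ w := fun s t γ => by
    by_cases hex : ∃ b, Q s t γ b
    · exact ⟨_, fun _ => hex.choose_spec⟩
    · exact ⟨z, fun h => absurd h hex⟩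
  choose w hw using hw
  have hmk : ∀ b : Below c, #(Set.Iio b) < Cardinal.lift.{u + 1} c := mk_Iio_below
  have h0' : ℵ₀ < Cardinal.lift.{u + 1} c := by simpa using h0
  have hlist : ∀ b : Below c, #(List (Set.Iio b)) < Cardinal.lift.{u + 1} c := fun b =>
    (mk_list_le_max _).trans_lt (max_lt h0' (hmk b))
  have hpreim : ∀ (b : Below c) (f : Below c → Below c), Function.Injective f →
      #(f ⁻¹' Set.Iio b) < Cardinal.lift.{u + 1} c := fun b f hf =>
    (mk_preimage_of_injective _ _ hf).trans_lt (hmk b)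
  have hH : ∀ b : Below c, ∃ b', b < b' ∧
      (∀ s : List (Set.Iio b), e (m (s.map Subtype.val)) < b') ∧
      (∀ (s t : List (Set.Iio b)) (γ : Set.Iio b),
        e (w (s.map Subtype.val) (t.map Subtype.val) γ) < b') ∧
      (∀ a, e a < b → e' (h a) < b') ∧ ∀ a, e' (h a) < b → e a < b' := fun b => by
    obtain ⟨b₁, h₁⟩ := exists_bound_of_mk_lt hc (hlist b) fun s => e (m (s.map Subtype.val))
    obtain ⟨b₂, h₂⟩ := exists_bound_of_mk_lt hc
      (ι := List (Set.Iio b) × List (Set.Iio b) × Set.Iio b) (by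
        simp only [mk_prod, Cardinal.lift_id]
        exact mul_lt_of_lt h0'.le (hlist b) (mul_lt_of_lt h0'.le (hlist b) (hmk b)))
      fun p => e (w (p.1.map Subtype.val) (p.2.1.map Subtype.val) p.2.2)
    obtain ⟨b₃, h₃⟩ := exists_bound_of_mk_lt hc (hpreim b e hg.inj) fun a => e' (h a.1)
    obtain ⟨b₄, h₄⟩ := exists_bound_of_mk_lt hc
      (hpreim b (fun a => e' (h a)) (hg'.inj.comp h.injective)) fun a => e a.1
    obtain ⟨b₅, h₅⟩ := exists_gt_below hc (max b (max (max b₁ b₂) (max b₃ b₄)))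
    simp only [max_lt_iff] at h₅
    exact ⟨b₅, h₅.1, fun s => (h₁ s).trans h₅.2.1.1, fun s t γ => (h₂ (s, t, γ)).trans h₅.2.1.2,
      fun a ha => (h₃ ⟨a, ha⟩).trans h₅.2.2.1, fun a ha => (h₄ ⟨a, ha⟩).trans h₅.2.2.2⟩
  choose N hN hNm hNw hNh hNh' using hH
  -- The point e d is a limit of the first system and not of the second, and all choices made from
  -- parameters below e d stay below e d.
  obtain ⟨_, ⟨⟨d, rfl⟩, hd'⟩, hC⟩ := hS (isClub_closed hc h0 N)
  have hup : ∀ b < e d, ∃ b' < e d, b < b' := fun b hb => ⟨N b, hC b hb, hN b⟩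
  have hlistlt : ∀ l : List (Below c), (∀ x ∈ l, x < e d) → ∃ b < e d, ∀ x ∈ l, x < b := by
    intro l
    induction l with
    | nil => exact fun _ => ⟨g d 0, hg.lt d 0, by simp⟩
    | cons x l ih =>
      intro hl
      obtain ⟨b, hb, hlb⟩ := ih fun y hy => hl y (List.mem_cons_of_mem _ hy)
      obtain ⟨b', hb', hxb⟩ := hup (max b x) (max_lt hb (hl x List.mem_cons_self))
      refine ⟨b', hb', fun y hy => ?_⟩
      rcases List.mem_cons.1 hy with rfl | hy
      · exact (le_max_right _ _).trans_lt hxb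
      · exact (hlb y hy).trans ((le_max_left _ _).trans_lt hxb)
  have hlift : ∀ (b : Below c) (l : List (Below c)), (∀ x ∈ l, x < b) →
      ∃ l' : List (Set.Iio b), l'.map Subtype.val = l := fun b l hl =>
    ⟨l.attach.map fun x => ⟨x.1, hl x.1 x.2⟩, by
      rw [List.map_map]; exact List.attach_map_subtype_val l⟩
  have hge : e d ≤ e' (h d) := by
    by_contra! hlt
    obtain ⟨b, hb, hlb⟩ := hup _ hlt
    exact (hNh' b d hlb).not_gt (hC b hb)
  have hgt : e d < e' (h d) := hge.lt_of_ne fun heq => hd' ⟨h d, heq.symm⟩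
  have hex := hg'.cofinal (h d) _ hgt
  -- The first place where the image ladder of d leaves e d. The entries before it form a finite
  -- list s of ordinals below e d.
  let n := Nat.find hex
  have hn : e d ≤ g' (h d) n := Nat.find_spec hex
  have hn' : ∀ j < n, g' (h d) j < e d := fun j hj => not_le.1 (Nat.find_min hex hj)
  let s := pre (g' (h d)) n
  have hsl : s.length = n := by simp [s, pre]
  have hs : ∀ x ∈ s, x < e d := by
    intro x hx
    simp only [s, pre, List.mem_map, List.mem_range] at hx
    obtain ⟨j, hj, rfl⟩ := hx
    exact hn' j hj
  have hpre : ∀ (f f' : ℕ → Below c) (k : ℕ), pre f k = pre f' k → ∀ j < k, f j = f' j := by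
    intro f f' k hff j hj
    exact List.map_inj_left.1 hff j (List.mem_range.2 hj)
  have hdI : d ∈ I s := by simp only [I, mem_ofPred_eq, hsl]; rfl
  -- The image of a is above that of d and agrees with it before n, so it leaves e d at n as well.
  -- By closure such an a cannot have its own limit point below e d.
  have hIval : ∀ a ∈ I s, toLex (g d) < toLex (g a) → e d ≤ g' (h a) n := by
    intro a ha hda
    refine hn.trans (Pi.apply_le_of_toLex (hlt hda).le fun j hj => ?_)
    have : pre (g' (h a)) n = pre (g' (h d)) n := by
      have : pre (g' (h a)) s.length = s := ha
      rwa [hsl] at this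
    exact (hpre _ _ _ this j hj).symm
  -- If something in `I s` were above d, the witness w taken at the first difference would be above
  -- d too while its limit point is below e d.
  have hmax : ∀ a ∈ I s, toLex (g a) ≤ toLex (g d) := by
    intro a ha
    by_contra! hda
    obtain ⟨k, hk, hlk⟩ := hda
    have hk : ∀ j < k, g d j = g a j := hk
    have hlk : g d k < g a k := hlk
    let t := pre (g d) k
    have htl : t.length = k := by simp [t, pre]
    have ht : ∀ x ∈ t, x < e d := by
      intro x hx
      simp only [t, pre, List.mem_map, List.mem_range] at hx
      obtain ⟨j, hj, rfl⟩ := hx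
      exact hg.lt d j
    have hQ : Q s t (g d k) a := by
      refine ⟨ha, ?_, by rwa [htl]⟩
      rw [htl]
      exact List.map_inj_left.2 fun j hj => (hk j (List.mem_range.1 hj)).symm
    have hQw := hw s t (g d k) ⟨a, hQ⟩
    obtain ⟨b, hb, hbl⟩ := hlistlt (g d k :: (s ++ t)) (by
      intro x hx
      rcases List.mem_cons.1 hx with rfl | hx
      · exact hg.lt d k
      · rcases List.mem_append.1 hx with hx | hx
        exacts [hs x hx, ht x hx])
    obtain ⟨s', hs'⟩ := hlift b s fun x hx => hbl x (by simp [hx])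
    obtain ⟨t', ht'⟩ := hlift b t fun x hx => hbl x (by simp [hx])
    have hwlt : e (w s t (g d k)) < e d := by
      have := hNw b s' t' ⟨g d k, hbl _ (by simp)⟩
      rw [hs', ht'] at this
      exact this.trans (hC b hb)
    generalize w s t (g d k) = x at hQw hwlt
    have hlx : toLex (g d) < toLex (g x) := by
      refine ⟨k, fun j hj => ?_, by simpa [htl] using hQw.2.2⟩
      have := hQw.2.1
      rw [htl] at this
      exact (hpre _ _ _ this j hj).symm
    obtain ⟨b', hb', hxb'⟩ := hup _ hwlt
    exact ((hIval x hQw.1 hlx).trans_lt (hg'.lt _ _)).not_gt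
      ((hNh b' x hxb').trans (hC b' hb'))
  -- Thus d = m s is determined by a list of ordinals below e d, and closure gives e d < e d.
  obtain ⟨b, hb, hbl⟩ := hlistlt s hs
  obtain ⟨s', hs'⟩ := hlift b s hbl
  have := hNm b s'
  rw [hs', hm s d hdI hmax] at this
  exact (this.trans (hC b hb)).false

/-- Every stationary set of points of cofinality `ω` carries a ladder system whose first
entries are unbounded. -/
theorem exists_isLadder (hc : c.IsRegular) (h0 : ℵ₀ < c) {S : Set (Below c)}
    (hS : IsStationary S) (hE : S ⊆ cofOmega c) :
    ∃ e g, IsLadder e g ∧ range e = S ∧ ∀ b, ∃ a, b < g a 0 := by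
  have hcof : IsCofinal S := fun b => by
    obtain ⟨x, hx, hxb⟩ := hS (show IsClub (Set.Ici b) from ⟨fun d hd hne _ a ha => by
          obtain ⟨x, hx⟩ := hne
          exact (hd hx).trans (ha.1 hx), fun a => ⟨max a b, mem_Ici.2 (le_max_right a b),
            le_max_left _ _⟩⟩)
    exact ⟨x, hx, hxb⟩
  have hmk : #(Below c) = #S := by
    refine le_antisymm ?_ (mk_set_le S)
    rw [mk_below, ← cof_below_of_isRegular hc]
    exact Order.cof_le hcof
  obtain ⟨i⟩ := Cardinal.eq.1 hmk
  have hf : ∀ a, ∃ f : ℕ → Below c, (∀ n, f n < (i a).1) ∧ ∀ b < (i a).1, ∃ n, b ≤ f n :=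
    fun a => hE (i a).2
  choose f hf using hf
  -- If each coordinate were bounded, countably many bounds would have a common one, although
  -- ladders are cofinal in arbitrarily large points.
  have hn : ∃ n, ∀ b, ∃ a, b < f a n := by
    by_contra! h
    choose b hb using h
    obtain ⟨b₀, hb₀⟩ := exists_bound hc (by simpa using h0) b
    obtain ⟨b₁, hb₁⟩ := exists_gt_below hc b₀
    obtain ⟨x, hx, hle⟩ := hcof b₁
    obtain ⟨a, ha⟩ := i.surjective ⟨x, hx⟩
    obtain ⟨n, hn⟩ := (hf a).2 b₀ (by rw [ha]; exact hb₁.trans_le hle)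
    exact (hn.trans (hb n a)).not_gt (hb₀ n)
  obtain ⟨n, hn⟩ := hn
  -- The unbounded coordinate is repeated in front, where it dominates the lexicographic order; this
  -- will exclude a greatest element.
  refine ⟨fun a => (i a).1, fun a k => if k = 0 then f a n else f a (k - 1),
    ⟨Subtype.val_injective.comp i.injective, fun a k => ?_, fun a b hb => ?_⟩, ?_, fun b => ?_⟩
  · split_ifs
    exacts [(hf a).1 _, (hf a).1 _]
  · obtain ⟨k, hk⟩ := (hf a).2 b hb
    exact ⟨k + 1, by simpa using hk⟩
  · rw [range_comp' Subtype.val i, i.surjective.range_eq]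
    simp
  · simpa using hn b

/-- Well-orders are comparable. A well-founded order would restrict to well-orders on the ladders
over A and over B, and an embedding of one into the other contradicts Baumgartner's theorem, A and B
being disjoint. -/
theorem IsLadder.not_wellFounded (hc : c.IsRegular) (h0 : ℵ₀ < c)
    {e : Below c → Below c} {g : Below c → ℕ → Below c} (hg : IsLadder e g)
    {A B : Set (Below c)} (hA : IsStationary A) (hB : IsStationary B) (hAe : A ⊆ range e)
    (hBe : B ⊆ range e) (hAB : Disjoint A B) :
    ¬ WellFounded fun a b => lexRel g a b ∧ a ≠ b := by
  intro hwf
  have key : ∀ A : Set (Below c), IsStationary A → A ⊆ range e →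
      ∃ i : Below c → Below c, Function.Injective i ∧ range (e ∘ i) = A := by
    intro A hA hAe
    have hcof : IsCofinal A := fun b => by
      obtain ⟨x, hx, hxb⟩ := hA (show IsClub (Set.Ici b) from ⟨fun d hd hne _ a ha => by
          obtain ⟨x, hx⟩ := hne
          exact (hd hx).trans (ha.1 hx), fun a => ⟨max a b, mem_Ici.2 (le_max_right a b),
            le_max_left _ _⟩⟩)
      exact ⟨x, hx, hxb⟩
    have hmk : #(Below c) = #A := by
      refine le_antisymm ?_ (mk_set_le A)
      rw [mk_below, ← cof_below_of_isRegular hc]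
      exact Order.cof_le hcof
    obtain ⟨j⟩ := Cardinal.eq.1 hmk
    choose i hi using fun a => hAe (j a).2
    refine ⟨i, fun a b hab => j.injective (Subtype.ext ?_), ?_⟩
    · rw [← hi a, ← hi b, hab]
    · have : e ∘ i = fun a => (j a).1 := funext hi
      rw [this, range_comp' Subtype.val j, j.surjective.range_eq]
      simp
  obtain ⟨i, hi, hiA⟩ := key A hA hAe
  obtain ⟨j, hj, hjB⟩ := key B hB hBe
  let o : LinearOrder (Below c) := LinearOrder.lift' (fun a => toLex (g a))
    (toLex.injective.comp hg.injective)
  have hwo : ∀ k : Below c → Below c, Function.Injective k →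
      IsWellOrder (Below c) fun a b => lexRel (g ∘ k) a b ∧ a ≠ b := fun k hk =>
    { wf := by
        refine Subrelation.wf ?_ (InvImage.wf k hwf)
        exact fun {a b} hab => ⟨hab.1, fun h => hab.2 (hk h)⟩
      trichotomous := fun a b h₁ h₂ => by
        by_contra hne
        rcases (hg.comp hk).isLinOrd.2.2.2 a b with h | h
        · exact h₁ ⟨h, hne⟩
        · exact h₂ ⟨h, Ne.symm hne⟩ }
  have hemb : ∀ k l : Below c → Below c, Function.Injective k → Function.Injective l →
      ((fun a b => lexRel (g ∘ k) a b ∧ a ≠ b) ↪r fun a b => lexRel (g ∘ l) a b ∧ a ≠ b) →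
      Nonempty (lexRel (g ∘ k) ↪r lexRel (g ∘ l)) := fun k l hk hl f =>
    ⟨f.toEmbedding, fun {a b} => by
      rcases eq_or_ne a b with rfl | hab
      · exact ⟨fun _ => le_refl _, fun _ => le_refl _⟩
      · have := f.map_rel_iff (a := a) (b := b)
        simpa [hab, f.injective.ne hab] using this⟩
  have := hwo i hi
  have := hwo j hj
  rcases InitialSeg.total (fun a b => lexRel (g ∘ i) a b ∧ a ≠ b)
    (fun a b => lexRel (g ∘ j) a b ∧ a ≠ b) with f | f
  · obtain ⟨f⟩ := hemb i j hi hj f.toRelEmbedding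
    refine not_isStationary_of_embedding hc h0 (hg.comp hi) (hg.comp hj) f ?_
    rwa [hiA, hjB, hAB.sdiff_eq_left]
  · obtain ⟨f⟩ := hemb j i hj hi f.toRelEmbedding
    refine not_isStationary_of_embedding hc h0 (hg.comp hj) (hg.comp hi) f ?_
    rwa [hiA, hjB, hAB.sdiff_eq_right]

end Ladder
end GenTree
end

noncomputable section
namespace GenTree
open Ordinal Cardinal Set

/-! ### The Hessenberg pairing and the functions ρ and θ -/

section Hessenberg

/-- Only a small set of pairs precedes p, so the infimum defining `hes` is taken over a nonempty
set. -/
theorem exists_forall_hes_lt (p : Ordinal.{u} × Ordinal.{u}) :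
    ∃ δ, ∀ q, PairLT q p → hes q < δ := by
  have hs : Small.{u} {q | PairLT q p} := by
    have hsub : {q | PairLT q p} ⊆ Set.Iic (max p.1 p.2) ×ˢ Set.Iic (max p.1 p.2) := by
      intro q hq
      have : max q.1 q.2 ≤ max p.1 p.2 := hq.elim le_of_lt fun h => h.1.le
      exact ⟨(le_max_left _ _).trans this, (le_max_right _ _).trans this⟩
    exact small_subset hsub
  have hb : BddAbove (range fun q : {q | PairLT q p} => hes q.1) := bddAbove_of_small
  obtain ⟨δ, hδ⟩ := hb
  exact ⟨δ + 1, fun q hq => Order.lt_add_one_iff.2 (hδ ⟨⟨q, hq⟩, rfl⟩)⟩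

theorem hes_eq (p : Ordinal.{u} × Ordinal.{u}) :
    hes p = sInf {δ | ∀ q, PairLT q p → hes q < δ} := by
  rw [hes, WellFounded.fix_eq]

theorem hes_lt_hes {p q : Ordinal.{u} × Ordinal.{u}} (h : PairLT q p) : hes q < hes p := by
  rw [hes_eq p]
  exact csInf_mem (s := {δ | ∀ q, PairLT q p → hes q < δ}) (exists_forall_hes_lt p) q h

theorem hes_le {p : Ordinal.{u} × Ordinal.{u}} {δ : Ordinal.{u}}
    (h : ∀ q, PairLT q p → hes q < δ) : hes p ≤ δ := by
  rw [hes_eq]; exact csInf_le' h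

theorem PairLT.trichotomy (p q : Ordinal.{u} × Ordinal.{u}) : PairLT p q ∨ p = q ∨ PairLT q p := by
  rcases lt_trichotomy (max p.1 p.2) (max q.1 q.2) with h | h | h
  · exact Or.inl (Or.inl h)
  · rcases lt_trichotomy p.1 q.1 with h1 | h1 | h1
    · exact Or.inl (Or.inr ⟨h, Or.inl h1⟩)
    · rcases lt_trichotomy p.2 q.2 with h2 | h2 | h2
      · exact Or.inl (Or.inr ⟨h, Or.inr ⟨h1, h2⟩⟩)
      · exact Or.inr (Or.inl (Prod.ext h1 h2))
      · exact Or.inr (Or.inr (Or.inr ⟨h.symm, Or.inr ⟨h1.symm, h2⟩⟩))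
    · exact Or.inr (Or.inr (Or.inr ⟨h.symm, Or.inl h1⟩))
  · exact Or.inr (Or.inr (Or.inl h))

theorem hes_injective : Function.Injective hes.{u} := by
  intro p q h
  rcases PairLT.trichotomy p q with h' | h' | h'
  · exact absurd h (hes_lt_hes h').ne
  · exact h'
  · exact absurd h.symm (hes_lt_hes h').ne

theorem hes_strictMono_left (β : Ordinal.{u}) : StrictMono fun α => hes (α, β) := by
  intro α α' h
  refine hes_lt_hes ?_
  rcases (max_le_max_right β h.le).lt_or_eq with h' | h'
  · exact Or.inl h'
  · exact Or.inr ⟨h', Or.inl h⟩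

theorem hes_strictMono_right (α : Ordinal.{u}) : StrictMono fun β => hes (α, β) := by
  intro β β' h
  refine hes_lt_hes ?_
  rcases (max_le_max_left α h.le).lt_or_eq with h' | h'
  · exact Or.inl h'
  · exact Or.inr ⟨h', Or.inr ⟨rfl, h⟩⟩

theorem left_le_hes (α β : Ordinal.{u}) : α ≤ hes (α, β) := (hes_strictMono_left β).le_apply

theorem right_le_hes (α β : Ordinal.{u}) : β ≤ hes (α, β) := (hes_strictMono_right α).le_apply

/-- A pair of ordinals below c has fewer than c predecessors, so regularity bounds their values, by
induction along `PairLT`. -/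
theorem hes_lt_ord {c : Cardinal.{u}} (hc : c.IsRegular) {α β : Ordinal.{u}} (hα : α < c.ord)
    (hβ : β < c.ord) : hes (α, β) < c.ord := by
  suffices ∀ p : Ordinal.{u} × Ordinal.{u}, p.1 < c.ord → p.2 < c.ord → hes p < c.ord from
    this (α, β) hα hβ
  intro p
  induction p using PairLT.wf.induction with
  | h p ih =>
  intro h1 h2
  have hsub : {q | PairLT q p} ⊆ Set.Iio (max p.1 p.2 + 1) ×ˢ Set.Iio (max p.1 p.2 + 1) := by
    intro q hq
    have : max q.1 q.2 ≤ max p.1 p.2 := hq.elim le_of_lt fun h => h.1.le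
    exact ⟨Order.lt_add_one_iff.2 ((le_max_left _ _).trans this),
      Order.lt_add_one_iff.2 ((le_max_right _ _).trans this)⟩
  have hm : max p.1 p.2 + 1 < c.ord := (isSuccLimit_ord hc.aleph0_le).succ_lt (max_lt h1 h2)
  have hI : #(Set.Iio (max p.1 p.2 + 1)) < Cardinal.lift.{u + 1} c := by
    rw [Cardinal.mk_Iio_ordinal, Cardinal.lift_lt]
    exact lt_ord.1 hm
  have hmk : #{q | PairLT q p} < Cardinal.lift.{u + 1} c := by
    refine (mk_le_mk_of_subset hsub).trans_lt ?_
    rw [mk_setProd]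
    exact mul_lt_of_lt (by simpa using hc.aleph0_le) hI hI
  obtain ⟨b, hb⟩ := exists_bound_of_mk_lt hc hmk fun q => (⟨hes q.1,
    ih q.1 q.2 ((hsub q.2).1.out.trans hm) ((hsub q.2).2.out.trans hm)⟩ : Below c)
  exact (hes_le fun q hq => hb ⟨q, hq⟩).trans_lt b.2

theorem theta_mono {i γ α α' : Ordinal.{u}} (h : α ≤ α') : theta i γ α ≤ theta i γ α' := by
  unfold theta
  gcongr
  exact (hes_strictMono_right γ).monotone h

theorem rho_injective {α β α' β' : Ordinal.{u}} (h : rho α β = rho α' β') : α = α' ∧ β = β' := by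
  have := hes_injective ((Order.succ_injective) h)
  exact ⟨congrArg Prod.fst this, congrArg Prod.snd this⟩

theorem left_lt_rho (α β : Ordinal.{u}) : α < rho α β := Order.lt_add_one_iff.2 (left_le_hes α β)

theorem right_lt_rho (α β : Ordinal.{u}) : β < rho α β := Order.lt_add_one_iff.2 (right_le_hes α β)

theorem rho_lt_ord {c : Cardinal.{u}} (hc : c.IsRegular) {α β : Ordinal.{u}} (hα : α < c.ord)
    (hβ : β < c.ord) : rho α β < c.ord :=
  (isSuccLimit_ord hc.aleph0_le).succ_lt (hes_lt_ord hc hα hβ)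

theorem iSup_Iic_lt {c : Cardinal.{u}} (hc : c.IsRegular) {β : Ordinal.{u}} (hβ : β < c.ord)
    (f : Set.Iic β → Ordinal.{u}) (hf : ∀ i, f i < c.ord) : ⨆ i, f i < c.ord := by
  have hβ' : β + 1 < c.ord := (isSuccLimit_ord hc.aleph0_le).succ_lt hβ
  have hI : #(Set.Iic β) < Cardinal.lift.{u + 1} c := by
    have : Set.Iic β = Set.Iio (β + 1) := by ext x; simp [Order.lt_add_one_iff]
    rw [this, Cardinal.mk_Iio_ordinal, Cardinal.lift_lt]
    exact lt_ord.1 hβ'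
  obtain ⟨b, hb⟩ := exists_bound_of_mk_lt hc hI fun i => (⟨f i, hf i⟩ : Below c)
  have : Nonempty (Set.Iic β) := ⟨⟨β, mem_Iic.2 le_rfl⟩⟩
  exact (ciSup_le fun i => (show f i < b.1 from hb i).le).trans_lt b.2

end Hessenberg

/-! ### The operation ⊕ -/

section Oplus

theorem oplus_len (s t : TSeq.{u} Ordinal.{u}) : (oplus s t).len = min s.len t.len := rfl

/-- The values of `s ⊕ t` at positive arguments. -/
theorem oplus_val_pos (s t : TSeq.{u} Ordinal.{u}) {β : Ordinal.{u}} (h0 : β ≠ 0)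
    (h : β < (oplus s t).len) (hs : β < s.len) (ht : β < t.len) :
    (oplus s t).val ⟨β, h⟩ = rho ((⨆ α : Set.Iic β, s.val ⟨α.1, lt_of_le_of_lt α.2 hs⟩) + ω)
      (rho (s.val ⟨β, hs⟩) (t.val ⟨β, ht⟩)) := if_neg h0

theorem oplus_val_zero (s t : TSeq.{u} Ordinal.{u})
    (h : 0 < (oplus s t).len) (hs : 0 < s.len) (ht : 0 < t.len) :
    (oplus s t).val ⟨0, h⟩ = rho (s.val ⟨0, hs⟩) (t.val ⟨0, ht⟩) := if_pos rfl

theorem isSeqBelow_oplus {κ : Cardinal.{u}} (hκ : κ.IsRegular) (h0 : ℵ₀ < κ)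
    {s t : TSeq.{u} Ordinal.{u}} (hs : IsSeqBelow κ s) (ht : IsSeqBelow κ t) :
    IsSeqBelow κ (oplus s t) := by
  refine ⟨(min_le_left _ _).trans_lt hs.1, fun ⟨β, hβ⟩ => ?_⟩
  have h1 := (lt_min_iff.1 (mem_Iio.1 hβ)).1
  have h2 := (lt_min_iff.1 (mem_Iio.1 hβ)).2
  rcases eq_or_ne β 0 with rfl | hne
  · rw [oplus_val_zero s t hβ h1 h2]
    exact rho_lt_ord hκ (hs.2 _) (ht.2 _)
  · rw [oplus_val_pos s t hne hβ h1 h2]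
    refine rho_lt_ord hκ ?_ (rho_lt_ord hκ (hs.2 _) (ht.2 _))
    refine isPrincipal_add_ord hκ.aleph0_le
      (iSup_Iic_lt hκ (h1.trans hs.1) _ fun i => hs.2 _) ?_
    rwa [← ord_aleph0, ord_lt_ord]

end Oplus

/-! ### The cardinals μ(γ) -/

section Mu

theorem mu_isRegular (γ : Ordinal.{u}) : (mu γ).IsRegular := by
  rw [mu]
  exact isRegular_succ (((aleph0_le_aleph 1).trans (le_max_left _ _)).trans (le_max_left _ _))

theorem aleph0_lt_mu (γ : Ordinal.{u}) : ℵ₀ < mu γ := by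
  rw [mu, Order.lt_succ_iff]
  exact ((aleph0_le_aleph 1).trans (le_max_left _ _)).trans (le_max_left _ _)

theorem card_lt_mu (γ : Ordinal.{u}) : (γ + 1).card < mu γ := by
  rw [mu, Order.lt_succ_iff]
  exact (le_max_right _ _).trans (le_max_left _ _)

/-- As a regular strong limit, κ is closed under cardinal successors and under suprema of families
shorter than κ. -/
theorem mu_lt {κ : Cardinal.{u}} (hκ : IsWeaklyCompact κ) {γ : Ordinal.{u}} (hγ : γ < κ.ord) :
    mu γ < κ := by
  induction γ using WellFoundedLT.induction with
  | ind γ ih =>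
  have hsucc : ∀ c < κ, Order.succ c < κ := fun c hc =>
    (Order.succ_le_of_lt (cantor c)).trans_lt (hκ.two_power_lt' hc)
  rw [mu]
  refine hsucc _ (max_lt (max_lt ?_ (lt_ord.1 (hκ.succ_lt hγ))) ?_)
  · rw [← succ_aleph0]
    exact hsucc _ hκ.1
  · refine Cardinal.lift_iSup_lt_of_lt_cof_ord ?_ fun α => ih α.1 α.2 (α.2.out.trans hγ)
    rw [hκ.isRegular.lift.cof_ord, Cardinal.mk_Iio_ordinal, Cardinal.lift_lift, Cardinal.lift_lt]
    exact lt_ord.1 hγ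

end Mu

/-! ### Existence of the data for the labels -/

section Labels

/-- A well-order of size `κ` all of whose proper initial segments have size `< κ` is isomorphic to
`κ`. -/
theorem exists_relIso_below {κ : Cardinal.{u}} {X : Type (u + 1)} (r : X → X → Prop)
    [IsWellOrder X r] (hr : ∀ x, #{y // r y x} < Cardinal.lift.{u + 1} κ)
    (hX : Cardinal.lift.{u + 1} κ ≤ #X) :
    Nonempty (r ≃r ((· < ·) : Below κ → Below κ → Prop)) := by
  have h1 : Ordinal.type r = typeLT (Below κ) := by
    rw [← ord_mk_below, mk_below]
    refine le_antisymm (not_lt.1 fun hlt => ?_) ?_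
    · have h2 := hr (enum r ⟨_, hlt⟩)
      rw [← card_typein, typein_enum, card_ord] at h2
      exact h2.false
    · rw [ord_le, card_type]
      exact hX
  exact Ordinal.type_eq.1 h1

/-- Sequences are ordered by their supremum, ties being broken by an arbitrary well-order. A
supremum below κ admits fewer than κ sequences of the given length, so the order has type κ and the
position in it serves as `num`. The last entry of `oplus s t` exceeds the supremum of s, which gives
the monotonicity. -/
theorem exists_num {κ : Cardinal.{u}} (hκ : IsWeaklyCompact κ) {γ : Ordinal.{u}}
    (hγ : γ < κ.ord) :
    ∃ num : TSeq.{u} Ordinal.{u} → Ordinal.{u},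
      Set.BijOn num {s | IsSeqBelow κ s ∧ s.len = γ + 1} (Set.Iio κ.ord) ∧
      ∀ s ∈ SuccSeq κ, ∀ t ∈ SuccSeq κ, s.len = γ + 1 → t.len = γ + 1 →
        num s ≤ num (oplus s t) := by
  classical
  let X : Set (TSeq.{u} Ordinal.{u}) := {s | IsSeqBelow κ s ∧ s.len = γ + 1}
  let σ : TSeq.{u} Ordinal.{u} → Ordinal.{u} := fun s => ⨆ β, s.val β
  have hbdd : ∀ s : TSeq.{u} Ordinal.{u}, BddAbove (range s.val) := fun _ => bddAbove_of_small
  have hσ : ∀ s ∈ X, σ s < κ.ord := by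
    intro s hs
    obtain ⟨b, hb⟩ := hκ.exists_forall_lt (ι := Set.Iio s.len) (by
      rw [Cardinal.mk_Iio_ordinal, Cardinal.lift_lt]
      exact lt_ord.1 hs.1.1) fun β => (⟨s.val β, hs.1.2 β⟩ : Below κ)
    exact (Ordinal.iSup_le fun i => (show s.val i < b.1 from hb i).le).trans_lt b.2
  let r : X → X → Prop := InvImage (Prod.Lex (· < ·) WellOrderingRel) fun s => (σ s.1, s)
  have hwo : IsWellOrder X r :=
    { wf := InvImage.wf _ (WellFounded.prod_lex wellFounded_lt WellOrderingRel.isWellOrder.wf)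
      trichotomous := fun a b h₁ h₂ => by
        have := (inferInstance : Std.Trichotomous
          (Prod.Lex ((· < ·) : Ordinal → Ordinal → Prop) (WellOrderingRel (α := X)))).trichotomous
          _ _ h₁ h₂
        exact congrArg Prod.snd this }
  have hseg : ∀ s : X, #{t // r t s} < Cardinal.lift.{u + 1} κ := by
    intro s
    have h1 : #(Set.Iio (γ + 1)) < Cardinal.lift.{u + 1} κ := by
      rw [Cardinal.mk_Iio_ordinal, Cardinal.lift_lt]
      exact lt_ord.1 (hκ.succ_lt hγ)
    have h2 : #(Set.Iio (σ s.1 + 1)) < Cardinal.lift.{u + 1} κ := by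
      rw [Cardinal.mk_Iio_ordinal, Cardinal.lift_lt]
      exact lt_ord.1 (hκ.succ_lt (hσ _ s.2))
    refine (mk_le_of_injective (β := Set.Iio (γ + 1) → Set.Iio (σ s.1 + 1)) (f := fun t i =>
      ⟨t.1.1.val ⟨i.1, by rw [t.1.2.2]; exact i.2⟩, ?_⟩) ?_).trans_lt (hκ.mk_fun_lt h1 h2)
    · have hle : σ t.1.1 ≤ σ s.1 := by
        rcases Prod.lex_def.1 t.2 with h | h
        exacts [h.le, h.1.le]
      exact Order.lt_add_one_iff.2 ((le_ciSup (hbdd _) _).trans hle)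
    · intro t t' htt
      refine Subtype.ext (Subtype.ext (TSeq.ext_val (t.1.2.2.trans t'.1.2.2.symm) ?_))
      intro β h₁ h₂
      exact congrArg Subtype.val (congrFun htt ⟨β, by rw [← t.1.2.2]; exact h₁⟩)
  have hX : Cardinal.lift.{u + 1} κ ≤ #X := by
    rw [← mk_below]
    have hpos : (0 : Ordinal.{u}) < γ + 1 := by simp
    refine mk_le_of_injective (f := fun a : Below κ =>
      (⟨TSeq.const a.1 (γ + 1), ⟨hκ.succ_lt hγ, fun _ => a.2⟩, rfl⟩ : X)) fun a b hab => ?_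
    exact Subtype.ext (TSeq.val_congr (congrArg Subtype.val hab) (β := 0) hpos hpos)
  obtain ⟨e⟩ := exists_relIso_below r hseg hX
  refine ⟨fun s => if h : s ∈ X then (e ⟨s, h⟩).1 else 0, ⟨fun s hs => ?_, fun s hs t ht hst => ?_,
    fun a ha => ?_⟩, fun s hs t ht hsl htl => ?_⟩
  · have hs : s ∈ X := hs
    simp only [dif_pos hs]
    exact (e ⟨s, hs⟩).2
  · have hs : s ∈ X := hs
    have ht : t ∈ X := ht
    simp only [dif_pos hs, dif_pos ht] at hst
    exact congrArg Subtype.val (e.injective (Subtype.ext hst))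
  · refine ⟨(e.symm ⟨a, ha⟩).1, (e.symm ⟨a, ha⟩).2, ?_⟩
    simp only [dif_pos (e.symm ⟨a, ha⟩).2, Subtype.coe_eta, e.apply_symm_apply]
  · have hsX : s ∈ X := ⟨hs.1, hsl⟩
    have hlen : (oplus s t).len = γ + 1 := by rw [oplus_len, hsl, htl, min_self]
    have hX' : oplus s t ∈ X := ⟨isSeqBelow_oplus hκ.isRegular hκ.1 hs.1 ht.1, hlen⟩
    simp only [dif_pos hsX, dif_pos hX']
    refine (show e ⟨s, hsX⟩ < e ⟨oplus s t, hX'⟩ from e.map_rel_iff.2 ?_).le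
    refine Prod.Lex.left _ _ ?_
    have hγs : γ < s.len := by rw [hsl]; exact Order.lt_add_one_iff.2 le_rfl
    have hγt : γ < t.len := by rw [htl]; exact Order.lt_add_one_iff.2 le_rfl
    have hγo : γ < (oplus s t).len := lt_min hγs hγt
    refine lt_of_lt_of_le ?_ (le_ciSup (hbdd _) ⟨γ, hγo⟩)
    rcases eq_or_ne γ 0 with rfl | hne
    · rw [oplus_val_zero s t hγo hγs hγt]
      refine lt_of_le_of_lt ?_ (left_lt_rho _ _)
      refine Ordinal.iSup_le fun i => ?_
      have hi : i = ⟨0, hγs⟩ := Subtype.ext (by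
        have : i.1 < 0 + 1 := lt_of_lt_of_eq i.2.out hsl
        simpa using this)
      rw [hi]
    · rw [oplus_val_pos s t hne hγo hγs hγt]
      refine lt_of_le_of_lt ?_ (left_lt_rho _ _)
      refine le_trans ?_ le_self_add
      refine Ordinal.iSup_le fun i => ?_
      have hi : i.1 ≤ γ := by
        have : i.1 < γ + 1 := lt_of_lt_of_eq i.2.out hsl
        exact Order.lt_add_one_iff.1 this
      exact le_ciSup (f := fun α : Set.Iic γ => s.val ⟨α.1, lt_of_le_of_lt α.2 hγs⟩)
        bddAbove_of_small ⟨i.1, hi⟩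

/-- On a regular uncountable cardinal `c` there are linear orders indexed by sequences of `0, 1`
of fixed length `< c`, which are not well-orders and do not embed into each other. -/
theorem exists_linOrd_family {c : Cardinal.{u}} (hc : c.IsRegular) (h0 : ℵ₀ < c) {l : Ordinal.{u}}
    (hl : l.card < c) :
    ∃ r : TSeq.{u} Bool → Below c → Below c → Prop,
      (∀ u, IsLinOrd (r u)) ∧ (∀ u, ¬ WellFounded fun a b => r u a b ∧ a ≠ b) ∧
      ∀ u v, u.len = l → v.len = l → u ≠ v → IsEmpty (r u ↪r r v) := by
  obtain ⟨S, hS, hE, hd⟩ := exists_disjoint_stationary hc h0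
  have hJ : #(ULift.{u + 1} Bool ⊕ (Set.Iio l × ULift.{u + 1} Bool)) ≤ #(Below c) := by
    have h0' : ℵ₀ < Cardinal.lift.{u + 1} c := by simpa using h0
    have h2 : #(ULift.{u + 1} Bool) < Cardinal.lift.{u + 1} c :=
      (lt_aleph0_of_finite _).trans h0'
    rw [mk_below, mk_sum, mk_prod]
    simp only [Cardinal.lift_id]
    refine (add_lt_of_lt h0'.le h2 (mul_lt_of_lt h0'.le ?_ h2)).le
    rwa [Cardinal.mk_Iio_ordinal, Cardinal.lift_lt]
  obtain ⟨j⟩ := hJ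
  -- The left summand belongs to every `P u`; it contributes two disjoint stationary sets and so
  -- prevents well-foundedness. The pairs (β, u β) on the right separate different u of length l.
  let P : TSeq.{u} Bool → Set (ULift.{u + 1} Bool ⊕ (Set.Iio l × ULift.{u + 1} Bool)) := fun u =>
    {x | ∀ p, x = Sum.inr p → ∃ h : p.1.1 < u.len, u.val ⟨p.1.1, h⟩ = p.2.down}
  let Q : TSeq.{u} Bool → Set (Below c) := fun u => ⋃ x ∈ P u, S (j x)
  have hQ : ∀ u, ∀ x ∈ P u, S (j x) ⊆ Q u := fun u x hx => subset_biUnion_of_mem (u := fun x => S (j x)) hx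
  have hinl : ∀ u b, Sum.inl b ∈ P u := fun u b p hp => by simp at hp
  have hL : ∀ u, ∃ g, ∃ e, IsLadder e g ∧ range e = Q u := fun u => by
    obtain ⟨e, g, h, h', -⟩ := exists_isLadder hc h0 ((hS _).mono (hQ u _ (hinl u ⟨true⟩)))
      (iUnion₂_subset fun x _ => hE _)
    exact ⟨g, e, h, h'⟩
  choose g e hg he using hL
  refine ⟨fun u => lexRel (g u), fun u => (hg u).isLinOrd, fun u => ?_, fun u v hu hv huv => ⟨?_⟩⟩
  · refine (hg u).not_wellFounded hc h0 (hS (j (Sum.inl ⟨true⟩))) (hS (j (Sum.inl ⟨false⟩))) ?_ ?_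
      (hd (j.injective.ne (by simp)))
    · rw [he]; exact hQ u _ (hinl u _)
    · rw [he]; exact hQ u _ (hinl u _)
  · intro f
    refine not_isStationary_of_embedding hc h0 (hg u) (hg v) f ?_
    rw [he, he]
    obtain ⟨β, h₁, h₂, hne⟩ : ∃ β, ∃ (h₁ : β < u.len) (h₂ : β < v.len),
        u.val ⟨β, h₁⟩ ≠ v.val ⟨β, h₂⟩ := by
      by_contra! h
      exact huv (TSeq.ext_val (hu.trans hv.symm) h)
    have hβ : β < l := hu ▸ h₁
    refine (hS (j (Sum.inr (⟨β, hβ⟩, ⟨u.val ⟨β, h₁⟩⟩)))).mono fun x hx => ⟨hQ u _ ?_ hx, ?_⟩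
    · rintro p hp
      obtain rfl := Sum.inr_injective hp
      exact ⟨h₁, rfl⟩
    · intro hxv
      obtain ⟨y, hy, hxy⟩ := mem_iUnion₂.1 hxv
      have : y = Sum.inr (⟨β, hβ⟩, ⟨u.val ⟨β, h₁⟩⟩) := by
        by_contra hyne
        exact Set.disjoint_left.1 (hd (j.injective.ne hyne)) hxy hx
      obtain ⟨h, h'⟩ := hy _ this
      exact hne h'.symm

/-- Disjoint stationary subsets of κ carry the orders L_γ, with ladders whose first entries are
unbounded so that no greatest element exists; the orders L*_u come from stationary subsets of the
regular cardinals μ(γ). -/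
theorem nonempty_labelData {κ : Cardinal.{u}} (hκ : IsWeaklyCompact κ) :
    Nonempty (LabelData κ) := by
  classical
  have hnum : ∀ γ : Ordinal.{u}, ∃ num : TSeq.{u} Ordinal.{u} → Ordinal.{u}, γ < κ.ord →
      Set.BijOn num {s | IsSeqBelow κ s ∧ s.len = γ + 1} (Set.Iio κ.ord) ∧
      ∀ s ∈ SuccSeq κ, ∀ t ∈ SuccSeq κ, s.len = γ + 1 → t.len = γ + 1 →
        num s ≤ num (oplus s t) := fun γ => by
    by_cases h : γ < κ.ord
    · obtain ⟨n, hn⟩ := exists_num hκ h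
      exact ⟨n, fun _ => hn⟩
    · exact ⟨fun _ => 0, fun h' => absurd h' h⟩
  choose num hnum using hnum
  obtain ⟨S, hS, hE, hd⟩ := exists_disjoint_stationary hκ.isRegular hκ.1
  choose e g hg he hmax using fun i => exists_isLadder hκ.isRegular hκ.1 (hS i) (hE i)
  let ix : Ordinal.{u} → Below κ := fun γ => if h : γ < κ.ord then ⟨γ, h⟩ else ⟨0, hκ.pos⟩
  choose r hr1 hr2 hr3 using fun γ : Ordinal.{u} =>
    exists_linOrd_family (mu_isRegular γ) (aleph0_lt_mu γ) (card_lt_mu γ)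
  refine ⟨{ num := fun s => num s.lastIndex s
            num_le := fun s hs t ht hst => ?_
            num_bijOn := fun γ hγ => ?_
            L := fun γ => lexRel (g (ix γ))
            L_linOrd := fun γ _ => (hg _).isLinOrd
            L_noMax := fun γ hγ a => ?_
            L_not_emb := fun γ hγ γ' hγ' hne => ⟨fun f => ?_⟩
            Lstar := fun u => r u.lastIndex u
            Lstar_linOrd := fun γ _ u _ => hr1 _ _
            Lstar_not_wf := fun γ _ u _ => hr2 _ _
            Lstar_not_emb := fun γ _ u v hu hv huv => ?_ }⟩
  · obtain ⟨γ, hγ⟩ := hs.2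
    have hs1 : s.lastIndex = γ := TSeq.lastIndex_eq hγ
    have hs2 : (oplus s t).lastIndex = γ := TSeq.lastIndex_eq (by rw [oplus_len, ← hst, min_self, hγ])
    simp only [hs1, hs2]
    refine (hnum γ ?_).2 s hs t ht hγ (hst ▸ hγ)
    exact (Order.lt_add_one_iff.2 le_rfl).trans (hγ ▸ hs.1.1)
  · refine (hnum γ hγ).1.congr fun s hs => ?_
    simp only [TSeq.lastIndex_eq hs.2]
  · obtain ⟨b, hb⟩ := hmax (ix γ) (g (ix γ) a 0)
    have hlt : toLex (g (ix γ) a) < toLex (g (ix γ) b) :=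
      ⟨0, fun j hj => absurd hj (Nat.not_lt_zero j), hb⟩
    exact ⟨b, hlt.le, fun hab => hlt.ne (by rw [hab])⟩
  · refine not_isStationary_of_embedding hκ.isRegular hκ.1 (hg _) (hg _) f ?_
    rw [he, he, (hd ?_).sdiff_eq_left]
    · exact hS _
    · simpa [ix, hγ, hγ', Subtype.ext_iff] using hne
  · have huv' : u.lastIndex = v.lastIndex := by
      rw [TSeq.lastIndex_eq hu, TSeq.lastIndex_eq hv]
    have hγ := TSeq.lastIndex_eq hv
    rw [← hγ] at hu hv
    generalize v.lastIndex = γ' at *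
    generalize u.lastIndex = γ'' at *
    subst huv'
    exact hr3 _ u v hu hv huv

end Labels
end GenTree
end

noncomputable section
namespace GenTree
open Ordinal Cardinal Set

/-! ### Prepending an entry, the operation u⁻ and the variant of ⊕ -/

section ConsLemmas

variable {A : Type w}

theorem TSeq.cons_len (a : A) (s : TSeq.{u} A) : (TSeq.cons a s).len = 1 + s.len := rfl

theorem TSeq.cons_len_pos (a : A) (s : TSeq.{u} A) : 0 < (TSeq.cons a s).len :=
  zero_lt_one.trans_le le_self_add

theorem TSeq.cons_val_zero (a : A) (s : TSeq.{u} A) (h : 0 < (TSeq.cons a s).len) :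
    (TSeq.cons a s).val ⟨0, h⟩ = a := dif_pos rfl

theorem TSeq.cons_val_add (a : A) (s : TSeq.{u} A) {β : Ordinal.{u}}
    (h : 1 + β < (TSeq.cons a s).len) (h' : β < s.len) :
    (TSeq.cons a s).val ⟨1 + β, h⟩ = s.val ⟨β, h'⟩ := by
  have hne : (1 + β : Ordinal.{u}) ≠ 0 := (zero_lt_one.trans_le le_self_add).ne'
  refine (dif_neg hne).trans ?_
  congr 2
  exact Ordinal.add_sub_cancel 1 β

/-- Prepending shifts arguments by `1 + ·`, which fixes infinite ordinals. Positive arguments are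
therefore written as 1 + β throughout, with no distinction between finite and infinite. -/
theorem one_add_cases (β : Ordinal.{u}) : β = 0 ∨ ∃ β', β = 1 + β' := by
  rcases eq_or_ne β 0 with h | h
  · exact Or.inl h
  · exact Or.inr ⟨β - 1, (Ordinal.add_sub_cancel_of_le (Order.one_le_iff_pos.2
      (pos_iff_ne_zero.2 h))).symm⟩

theorem one_add_lt_iff {α β : Ordinal.{u}} : 1 + α < 1 + β ↔ α < β := add_lt_add_iff_left 1

theorem one_add_inj {α β : Ordinal.{u}} : 1 + α = 1 + β ↔ α = β := add_right_inj 1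

theorem TSeq.eq_cons_iff {a : A} {s w : TSeq.{u} A} : w = TSeq.cons a s ↔ w.len = 1 + s.len ∧
    (∀ h, w.val ⟨0, h⟩ = a) ∧
      ∀ β (h : 1 + β < w.len) (h' : β < s.len), w.val ⟨1 + β, h⟩ = s.val ⟨β, h'⟩ := by
  constructor
  · rintro rfl
    exact ⟨rfl, fun h => TSeq.cons_val_zero a s h, fun β h h' => TSeq.cons_val_add a s h h'⟩
  · rintro ⟨hl, h0, hv⟩
    refine TSeq.ext_val hl fun β h₁ h₂ => ?_
    rcases one_add_cases β with rfl | ⟨β, rfl⟩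
    · exact (h0 h₁).trans (TSeq.cons_val_zero a s h₂).symm
    · rw [hv β h₁ (one_add_lt_iff.1 h₂), TSeq.cons_val_add _ _ h₂ (one_add_lt_iff.1 h₂)]

theorem TSeq.cons_inj {a b : A} {s t : TSeq.{u} A} (h : TSeq.cons a s = TSeq.cons b t) :
    a = b ∧ s = t := by
  obtain ⟨hl, h0, hv⟩ := TSeq.eq_cons_iff.1 h
  refine ⟨(TSeq.cons_val_zero a s (TSeq.cons_len_pos a s)).symm.trans (h0 _),
    TSeq.ext_val (one_add_inj.1 hl) fun β h₁ h₂ => ?_⟩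
  exact (TSeq.cons_val_add a s (one_add_lt_iff.2 h₁) h₁).symm.trans (hv β _ h₂)

theorem TSeq.cons_ne_nil (a : A) (s : TSeq.{u} A) : TSeq.cons a s ≠ TSeq.nil := fun h =>
  (TSeq.cons_len_pos a s).ne' (congrArg TSeq.len h)

theorem TSeq.cons_restrict (a : A) (s : TSeq.{u} A) (α : Ordinal.{u}) :
    (TSeq.cons a s).restrict (1 + α) = TSeq.cons a (s.restrict α) := by
  refine TSeq.eq_cons_iff.2 ⟨?_, fun h => ?_, fun β h h' => ?_⟩
  · exact ((add_right_mono (a := (1 : Ordinal.{u}))).map_min).symm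
  · exact TSeq.cons_val_zero a s _
  · rw [TSeq.restrict_val, TSeq.restrict_val, TSeq.cons_val_add]

/-- An infinite ordinal l satisfies 1 + l = l, so removing a leading unit from the length describes
u⁻ in the finite and in the infinite case. -/
theorem TSeq.minus_eq (s : TSeq.{u} A) : s.minus = s.restrict (s.len - 1) := by
  rw [TSeq.minus]
  split_ifs with h
  · rfl
  · refine (TSeq.restrict_of_le ?_).symm
    rw [Ordinal.le_sub_of_le (one_lt_omega0.le.trans (not_lt.1 h)), Ordinal.one_add_of_omega0_le
      (not_lt.1 h)]

theorem TSeq.minus_eq_of_len {s : TSeq.{u} A} {l : Ordinal.{u}} (h : s.len = 1 + l) :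
    s.minus = s.restrict l := by
  rw [TSeq.minus_eq, h, Ordinal.add_sub_cancel]

theorem le_one_add (l : Ordinal.{u}) : l ≤ 1 + l := le_add_self

theorem TSeq.minus_len {s : TSeq.{u} A} {l : Ordinal.{u}} (h : s.len = 1 + l) :
    s.minus.len = l := by
  rw [TSeq.minus_eq_of_len h, TSeq.restrict_len_of_le (h ▸ le_one_add l)]

theorem TSeq.len_of_minus_len {s : TSeq.{u} A} {l : Ordinal.{u}} (h0 : s.len ≠ 0)
    (h : s.minus.len = l) : s.len = 1 + l := by
  obtain ⟨l', hl'⟩ := (one_add_cases s.len).resolve_left h0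
  rw [TSeq.minus_len hl'] at h
  rw [hl', h]

theorem TSeq.restrict_minus {s : TSeq.{u} A} {l : Ordinal.{u}} (h : s.len = 1 + l)
    (α : Ordinal.{u}) : (s.restrict (1 + α)).minus = s.minus.restrict α := by
  have h' : (s.restrict (1 + α)).len = 1 + min l α := by
    rw [TSeq.restrict_len, h]
    exact ((add_right_mono (a := (1 : Ordinal.{u}))).map_min).symm
  rw [TSeq.minus_eq_of_len h', TSeq.minus_eq_of_len h, TSeq.restrict_restrict,
    TSeq.restrict_restrict]
  congr 1
  exact min_eq_right ((min_le_right _ _).trans (le_one_add α))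

theorem iSup_cons (a : Ordinal.{u}) (s : TSeq.{u} Ordinal.{u}) {γ : Ordinal.{u}} (hγ : γ < s.len) :
    (⨆ α : Set.Iic (1 + γ), (TSeq.cons a s).val ⟨α.1, lt_of_le_of_lt α.2
      (show 1 + γ < (TSeq.cons a s).len from one_add_lt_iff.2 hγ)⟩) =
    max a (⨆ α : Set.Iic γ, s.val ⟨α.1, lt_of_le_of_lt α.2 hγ⟩) := by
  apply le_antisymm
  · refine Ordinal.iSup_le fun ⟨α, hα⟩ => ?_
    rcases one_add_cases α with rfl | ⟨α, rfl⟩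
    · exact (TSeq.cons_val_zero a s _).le.trans (le_max_left _ _)
    · have hα' : α ≤ γ := (add_le_add_iff_left (1 : Ordinal.{u})).1 hα
      refine (TSeq.cons_val_add a s _ (hα'.trans_lt hγ)).le.trans (le_trans ?_ (le_max_right _ _))
      exact le_ciSup (f := fun α : Set.Iic γ => s.val ⟨α.1, lt_of_le_of_lt α.2 hγ⟩)
        bddAbove_of_small ⟨α, hα'⟩
  · have hb : BddAbove (range fun α : Set.Iic (1 + γ) => (TSeq.cons a s).val ⟨α.1,
        lt_of_le_of_lt α.2 (show 1 + γ < (TSeq.cons a s).len from one_add_lt_iff.2 hγ)⟩) :=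
      bddAbove_of_small
    refine max_le ?_ (Ordinal.iSup_le fun ⟨α, hα⟩ => ?_)
    · exact (TSeq.cons_val_zero a s (TSeq.cons_len_pos a s)).ge.trans
        (le_ciSup hb ⟨0, mem_Iic.2 zero_le⟩)
    · have hα : α ≤ γ := hα
      exact (TSeq.cons_val_add a s (one_add_lt_iff.2 (hα.trans_lt hγ)) _).ge.trans
        (le_ciSup hb ⟨1 + α, mem_Iic.2 (by gcongr)⟩)

theorem oplusTilde_len (s t : TSeq.{u} Ordinal.{u}) :
    (oplusTilde s t).len = min s.len t.len := rfl

theorem oplusTilde_val (s t : TSeq.{u} Ordinal.{u}) {γ : Ordinal.{u}}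
    (h : γ < (oplusTilde s t).len) (hs : γ < s.len) (ht : γ < t.len) :
    (oplusTilde s t).val ⟨γ, h⟩ = rho ((⨆ α : Set.Iic γ, s.val ⟨α.1, lt_of_le_of_lt α.2 hs⟩) + ω)
      (rho (s.val ⟨γ, hs⟩) (t.val ⟨γ, ht⟩)) := by
  have hne : (1 + γ : Ordinal.{u}) ≠ 0 := (zero_lt_one.trans_le le_self_add).ne'
  have h1 : 1 + γ < (TSeq.cons 0 s).len := one_add_lt_iff.2 hs
  have h2 : 1 + γ < (TSeq.cons 0 t).len := one_add_lt_iff.2 ht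
  refine (oplus_val_pos _ _ hne (lt_min h1 h2) h1 h2).trans ?_
  rw [TSeq.cons_val_add _ _ h1 hs, TSeq.cons_val_add _ _ h2 ht, iSup_cons 0 s hs,
    max_eq_right zero_le]

theorem oplusTilde_restrict (s t : TSeq.{u} Ordinal.{u}) (α : Ordinal.{u}) :
    (oplusTilde s t).restrict α = oplusTilde (s.restrict α) (t.restrict α) := by
  refine TSeq.ext_val ?_ fun β h₁ h₂ => ?_
  · simp only [TSeq.restrict_len, oplusTilde_len]
    exact min_min_min_comm _ _ _ _ |>.trans (by rw [min_self]) |>.symm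
  · have hs := (lt_min_iff.1 h₂).1
    have ht := (lt_min_iff.1 h₂).2
    rw [TSeq.restrict_val, oplusTilde_val s t _ (lt_min_iff.1 hs).1 (lt_min_iff.1 ht).1,
      oplusTilde_val _ _ _ hs ht]
    rfl

/-- This is the effect of the summand ω in ⊕: a finite first entry, which merely records the level,
leaves no trace in the later values. -/
theorem nat_max_add_omega0 (n : ℕ) (x : Ordinal.{u}) : max (n : Ordinal.{u}) x + ω = x + ω := by
  rcases le_total (n : Ordinal.{u}) x with h | h
  · rw [max_eq_right h]
  · rw [max_eq_left h]
    obtain ⟨m, rfl⟩ := lt_omega0.1 (h.trans_lt (natCast_lt_omega0 n))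
    rw [natCast_add_omega0, natCast_add_omega0]

/-- Composition of an element of level n with one of level 0. Only the first entry of the result
depends on n. -/
theorem oplus_cons (n : ℕ) (s t : TSeq.{u} Ordinal.{u}) :
    oplus (TSeq.cons n s) (TSeq.cons 0 t) = TSeq.cons (rho n 0) (oplusTilde s t) := by
  refine TSeq.eq_cons_iff.2 ⟨?_, fun h => ?_, fun β h h' => ?_⟩
  · exact ((add_right_mono (a := (1 : Ordinal.{u}))).map_min).symm
  · rw [oplus_val_zero _ _ h (TSeq.cons_len_pos _ _) (TSeq.cons_len_pos _ _), TSeq.cons_val_zero,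
      TSeq.cons_val_zero]
  · have hne : (1 + β : Ordinal.{u}) ≠ 0 := (zero_lt_one.trans_le le_self_add).ne'
    have h1 := (lt_min_iff.1 h).1
    have h2 := (lt_min_iff.1 h).2
    have hs := (lt_min_iff.1 h').1
    have ht := (lt_min_iff.1 h').2
    rw [oplus_val_pos _ _ hne h h1 h2, oplusTilde_val s t h' hs ht, TSeq.cons_val_add _ _ h1 hs,
      TSeq.cons_val_add _ _ h2 ht, iSup_cons _ _ hs, nat_max_add_omega0]

/-- Since ω is closed under the pairing, the new first entry is again the number of a level, and of
a later one. -/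
theorem exists_rho_eq_nat (n : ℕ) : ∃ m : ℕ, n < m ∧ rho (n : Ordinal.{u}) 0 = m := by
  have h : rho (n : Ordinal.{u}) 0 < ω := by
    rw [← ord_aleph0]
    exact rho_lt_ord isRegular_aleph0 (by rw [ord_aleph0]; exact natCast_lt_omega0 n)
      (by rw [ord_aleph0]; exact omega0_pos)
  obtain ⟨m, hm⟩ := lt_omega0.1 h
  refine ⟨m, ?_, hm⟩
  have := left_lt_rho (n : Ordinal.{u}) 0
  rw [hm] at this
  exact_mod_cast this

end ConsLemmas

/-! ### The levels of S_T, their branches, and maps between sequences -/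

section Core

variable {κ : Cardinal.{u}} {T : Set Triple.{u}}

/-- The stages, described in terms of the sequence without its first entry. -/
def Core (κ : Cardinal.{u}) (T : Set Triple.{u}) :
    ℕ → TSeq.{u} Bool → TSeq.{u} Bool → TSeq.{u} Ordinal.{u} → Prop
  | 0, x, y, s => x.len ≠ 0 ∧ y.len ≠ 0 ∧ (x.minus, y.minus, s) ∈ hat κ T
  | n + 1, x, y, s => Core κ T n x y s ∨
      ∃ z s₁ s₂, s = oplusTilde s₁ s₂ ∧ Core κ T n x z s₁ ∧ Core κ T n z y s₂

/-- The first entry of a nonempty sequence in a stage is the number of that stage, so nothing is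
lost by removing it. -/
theorem mem_stage_iff (n : ℕ) (x y : TSeq.{u} Bool) (r : TSeq.{u} Ordinal.{u}) :
    (x, y, r) ∈ stage κ T n ↔ (x, y, r) = (TSeq.nil, TSeq.nil, TSeq.nil) ∨
      ∃ s, r = TSeq.cons (n : Ordinal.{u}) s ∧ Core κ T n x y s := by
  induction n generalizing x y r with
  | zero =>
    simp only [stage, mem_union, mem_singleton_iff, mem_ofPred_eq, Core, Nat.cast_zero]
    constructor
    · rintro (h | ⟨h1, h2, s, h3, h4⟩)
      exacts [Or.inl h, Or.inr ⟨s, h3, h1, h2, h4⟩]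
    · rintro (h | ⟨s, h3, h1, h2, h4⟩)
      exacts [Or.inl h, Or.inr ⟨h1, h2, s, h3, h4⟩]
  | succ n ih =>
    have key : ∀ x y s, (x, y, TSeq.cons (n : Ordinal.{u}) s) ∈ stage κ T n ↔ Core κ T n x y s := by
      intro x y s
      rw [ih]
      constructor
      · rintro (h | ⟨s', hs, h⟩)
        · exact absurd (congrArg (fun p => p.2.2) h) (TSeq.cons_ne_nil _ _)
        · rwa [(TSeq.cons_inj hs).2]
      · exact fun h => Or.inr ⟨s, rfl, h⟩
    simp only [stage, mem_union, mem_singleton_iff, mem_ofPred_eq, Core, key]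
    constructor
    · rintro ((h | ⟨s, h1, h2⟩) | ⟨z, s, t, h1, h2, h3⟩)
      exacts [Or.inl h, Or.inr ⟨s, h1, Or.inl h2⟩, Or.inr ⟨_, h1, Or.inr ⟨z, s, t, rfl, h2, h3⟩⟩]
    · rintro (h | ⟨_, h1, h2 | ⟨z, s, t, rfl, h2, h3⟩⟩)
      exacts [Or.inl (Or.inl h), Or.inl (Or.inr ⟨_, h1, h2⟩), Or.inr ⟨z, s, t, h1, h2, h3⟩]

theorem isSeqBelow_cons {κ : Cardinal.{u}} (hκ : IsWeaklyCompact κ) {a : Ordinal.{u}}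
    (ha : a < κ.ord) {s : TSeq.{u} Ordinal.{u}} (hs : IsSeqBelow κ s) :
    IsSeqBelow κ (TSeq.cons a s) := by
  refine ⟨isPrincipal_add_ord hκ.1.le (by simpa using hκ.succ_lt hκ.pos) hs.1, fun ⟨β, hβ⟩ => ?_⟩
  rcases one_add_cases β with rfl | ⟨β, rfl⟩
  · exact (TSeq.cons_val_zero a s hβ).trans_lt ha
  · rw [TSeq.cons_val_add _ _ hβ (one_add_lt_iff.1 hβ)]; exact hs.2 _

theorem isSeqBelow_oplusTilde {κ : Cardinal.{u}} (hκ : IsWeaklyCompact κ)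
    {s t : TSeq.{u} Ordinal.{u}} (hs : IsSeqBelow κ s) (ht : IsSeqBelow κ t) :
    IsSeqBelow κ (oplusTilde s t) :=
  ⟨(min_le_left _ _).trans_lt hs.1, fun _ => (isSeqBelow_oplus hκ.isRegular hκ.1
    (isSeqBelow_cons hκ hκ.pos hs) (isSeqBelow_cons hκ hκ.pos ht)).2 _⟩

theorem IsSeqBelow.restrict {s : TSeq.{u} Ordinal.{u}} (hs : IsSeqBelow κ s) (α : Ordinal.{u}) :
    IsSeqBelow κ (s.restrict α) := ⟨(min_le_left _ _).trans_lt hs.1, fun _ => hs.2 _⟩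

theorem hat_len (hT : IsDSTTree κ T) {x y : TSeq.{u} Bool} {s : TSeq.{u} Ordinal.{u}}
    (h : (x, y, s) ∈ hat κ T) : x.len = s.len ∧ y.len = s.len ∧ IsSeqBelow κ s := by
  rcases h with h | ⟨h1, h2, h3⟩
  · exact ⟨(hT _ h).1, (hT _ h).2.1, (hT _ h).2.2.1⟩
  · have h1 : x = y := h1
    exact ⟨h2, h1 ▸ h2, h3⟩

theorem hat_restrict (hT : IsDSTTree κ T) {x y : TSeq.{u} Bool} {s : TSeq.{u} Ordinal.{u}}
    (h : (x, y, s) ∈ hat κ T) (α : Ordinal.{u}) :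
    (x.restrict α, y.restrict α, s.restrict α) ∈ hat κ T := by
  rcases h with h | ⟨h1, h2, h3⟩
  · exact Or.inl ((hT _ h).2.2.2 α)
  · have h1 : x = y := h1
    have h2 : x.len = s.len := h2
    exact Or.inr ⟨congrArg (fun z => z.restrict α) h1, by simp only [TSeq.restrict_len, h2],
      h3.restrict α⟩

theorem core_len (hκ : IsWeaklyCompact κ) (hT : IsDSTTree κ T) {n : ℕ} {x y : TSeq.{u} Bool}
    {s : TSeq.{u} Ordinal.{u}} (h : Core κ T n x y s) :
    x.len = 1 + s.len ∧ y.len = 1 + s.len ∧ IsSeqBelow κ s := by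
  induction n generalizing x y s with
  | zero =>
    obtain ⟨hx, hy, h⟩ := h
    obtain ⟨h1, h2, h3⟩ := hat_len hT h
    exact ⟨TSeq.len_of_minus_len hx h1, TSeq.len_of_minus_len hy h2, h3⟩
  | succ n ih =>
    rcases h with h | ⟨z, s, t, rfl, h1, h2⟩
    · exact ih h
    · obtain ⟨a1, a2, a3⟩ := ih h1
      obtain ⟨b1, b2, b3⟩ := ih h2
      have hst : s.len = t.len := one_add_inj.1 (a2.symm.trans b1)
      rw [oplusTilde_len, hst, min_self]
      exact ⟨hst ▸ a1, b2, isSeqBelow_oplusTilde hκ a3 b3⟩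

/-- Composition commutes with restriction, since the value of `oplusTilde` at γ involves entries up
to γ only. -/
theorem core_restrict (hκ : IsWeaklyCompact κ) (hT : IsDSTTree κ T) {n : ℕ} {x y : TSeq.{u} Bool}
    {s : TSeq.{u} Ordinal.{u}} (h : Core κ T n x y s) (α : Ordinal.{u}) :
    Core κ T n (x.restrict (1 + α)) (y.restrict (1 + α)) (s.restrict α) := by
  induction n generalizing x y s with
  | zero =>
    obtain ⟨lx, ly, -⟩ := core_len hκ hT h
    obtain ⟨hx, hy, h⟩ := h
    have hpos : ∀ w : TSeq.{u} Bool, w.len ≠ 0 → (w.restrict (1 + α)).len ≠ 0 := fun w hw =>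
      (lt_min (pos_iff_ne_zero.2 hw) (zero_lt_one.trans_le le_self_add)).ne'
    refine ⟨hpos x hx, hpos y hy, ?_⟩
    rw [TSeq.restrict_minus lx, TSeq.restrict_minus ly]
    exact hat_restrict hT h α
  | succ n ih =>
    rcases h with h | ⟨z, s, t, rfl, h1, h2⟩
    · exact Or.inl (ih h)
    · exact Or.inr ⟨_, _, _, oplusTilde_restrict s t α, ih h1, ih h2⟩

theorem core_mono {n m : ℕ} (hnm : n ≤ m) {x y : TSeq.{u} Bool}
    {s : TSeq.{u} Ordinal.{u}} (h : Core κ T n x y s) : Core κ T m x y s := by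
  induction hnm with
  | refl => exact h
  | step _ ih => exact Or.inl ih

theorem one_add_lt_ord (hκ : IsWeaklyCompact κ) {γ : Ordinal.{u}} (h : γ < κ.ord) :
    1 + γ < κ.ord := isPrincipal_add_ord hκ.1.le (by simpa using hκ.succ_lt hκ.pos) h

theorem one_add_le_add_one (γ : Ordinal.{u}) : 1 + γ ≤ γ + 1 := by
  rcases lt_or_ge γ ω with h | h
  · obtain ⟨n, rfl⟩ := lt_omega0.1 h
    exact_mod_cast (Nat.add_comm 1 n).le
  · rw [one_add_of_omega0_le h]; exact le_self_add

/-- The branch lemma without an order on the values. -/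
theorem IsWeaklyCompact.exists_branch' (hκ : IsWeaklyCompact κ) {A : Type (u + 1)}
    [Nonempty A] (f : Below κ → Below κ → A)
    (hf : ∀ β : Below κ, #(range fun γ : Set.Ici β => fun i : Set.Iio β => f γ i) <
      Cardinal.lift.{u + 1} κ) :
    ∃ b : Below κ → A, ∀ β : Below κ, ∃ γ, β ≤ γ ∧ ∀ i < β, f γ i = b i := by
  classical
  let _ := linearOrderOfSTO (WellOrderingRel (α := A))
  exact hκ.exists_branch f hf

/-- Induction on the level. At level 0, triples longer than a difference of x and y must come from
T. At level n + 1, a branch that is not contained in level n splits at every length; the tree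
property makes the splittings coherent, and transitivity composes the two branches obtained. -/
theorem rel_of_core (hκ : IsWeaklyCompact κ) (hT : IsDSTTree κ T)
    (hrefl : ∀ x, proj κ T x x) (htrans : ∀ x y z, proj κ T x y → proj κ T y z → proj κ T x z)
    (n : ℕ) (x y : Below κ → Bool) (s : Below κ → Below κ)
    (h : ∀ γ < κ.ord, Core κ T n (TSeq.ofFun x (1 + γ)) (TSeq.ofFun y (1 + γ))
      (TSeq.ofFun (fun β => (s β).1) γ)) : proj κ T x y := by
  classical
  induction n generalizing x y s with
  | zero =>
    have hm : ∀ (x : Below κ → Bool) (γ), γ < κ.ord → (TSeq.ofFun x (1 + γ)).minus = TSeq.ofFun x γ := by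
      intro x γ hγ
      rw [TSeq.minus_eq_of_len (TSeq.ofFun_len x (one_add_lt_ord hκ hγ).le), TSeq.ofFun_restrict,
        min_eq_right (le_one_add γ)]
    have hh : ∀ γ < κ.ord, (TSeq.ofFun x γ, TSeq.ofFun y γ,
        TSeq.ofFun (fun β => (s β).1) γ) ∈ hat κ T := fun γ hγ => by
      have := (h γ hγ).2.2
      rwa [hm x γ hγ, hm y γ hγ] at this
    by_cases hxy : x = y
    · exact hxy ▸ hrefl x
    · obtain ⟨β, hβ⟩ : ∃ β, x β ≠ y β := by
        by_contra! h'
        exact hxy (funext h')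
      refine ⟨s, fun α hα => ?_⟩
      have hm : max α (β.1 + 1) < κ.ord := max_lt hα (hκ.succ_lt β.2)
      rcases hh _ hm with h' | ⟨h', -⟩
      · have := (hT _ h').2.2.2 α
        simpa only [TSeq.ofFun_restrict, min_eq_right (le_max_left α (β.1 + 1))] using this
      · exact absurd (TSeq.ofFun_eq_iff.1 h' β
          ((Order.lt_add_one_iff.2 le_rfl).trans_le (le_max_right _ _))) hβ
  | succ n ih =>
    by_cases hall : ∀ γ < κ.ord, Core κ T n (TSeq.ofFun x (1 + γ)) (TSeq.ofFun y (1 + γ))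
        (TSeq.ofFun (fun β => (s β).1) γ)
    · exact ih x y s hall
    push Not at hall
    obtain ⟨γ₀, hγ₀, hnot⟩ := hall
    -- Level n is closed under restriction, so failure at γ₀ persists at greater lengths. There the
    -- triple is a composition, and restricting one gives a splitting at any smaller length.
    have hsplit : ∀ γ : Below κ, ∃ (v : TSeq.{u} Bool) (s₁ s₂ : TSeq.{u} Ordinal.{u}),
        TSeq.ofFun (fun β => (s β).1) γ.1 = oplusTilde s₁ s₂ ∧
        Core κ T n (TSeq.ofFun x (1 + γ.1)) v s₁ ∧ Core κ T n v (TSeq.ofFun y (1 + γ.1)) s₂ := by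
      intro γ
      have hres : ∀ δ ε : Ordinal.{u}, δ ≤ ε → ∀ z : Below κ → Bool,
          (TSeq.ofFun z (1 + ε)).restrict (1 + δ) = TSeq.ofFun z (1 + δ) := fun δ ε hle z => by
        rw [TSeq.ofFun_restrict, min_eq_right (by gcongr)]
      have hres' : ∀ δ ε : Ordinal.{u}, δ ≤ ε → (TSeq.ofFun (fun β => (s β).1) ε).restrict δ =
          TSeq.ofFun (fun β => (s β).1) δ := fun δ ε hle => by
        rw [TSeq.ofFun_restrict, min_eq_right hle]
      rcases h (max γ.1 γ₀) (max_lt γ.2 hγ₀) with h' | ⟨v, s₁, s₂, h1, h2, h3⟩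
      · have := core_restrict hκ hT h' γ₀
        rw [hres _ _ (le_max_right _ _), hres _ _ (le_max_right _ _),
          hres' _ _ (le_max_right _ _)] at this
        exact absurd this hnot
      · refine ⟨v.restrict (1 + γ.1), s₁.restrict γ.1, s₂.restrict γ.1, ?_, ?_, ?_⟩
        · rw [← oplusTilde_restrict, ← h1, hres' _ _ (le_max_left _ _)]
        · have := core_restrict hκ hT h2 γ.1
          rwa [hres _ _ (le_max_left _ _)] at this
        · have := core_restrict hκ hT h3 γ.1
          rwa [hres _ _ (le_max_left _ _)] at this
    choose v s₁ s₂ h1 h2 h3 using hsplit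
    have hlen : ∀ γ : Below κ, (v γ).len = 1 + γ.1 ∧ (s₁ γ).len = γ.1 ∧ (s₂ γ).len = γ.1 := by
      intro γ
      obtain ⟨a1, a2, -⟩ := core_len hκ hT (h2 γ)
      obtain ⟨b1, b2, -⟩ := core_len hκ hT (h3 γ)
      rw [TSeq.ofFun_len _ (one_add_lt_ord hκ γ.2).le] at a1 b2
      have e1 := one_add_inj.1 a1
      have e2 := one_add_inj.1 b2
      exact ⟨a2.trans a1.symm, e1.symm, e2.symm⟩
    have hv1 : ∀ (γ : Below κ) {i : Ordinal.{u}}, i < γ.1 → i < (v γ).len := fun γ i hi => by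
      rw [(hlen γ).1]; exact hi.trans_le (le_one_add _)
    have hv2 : ∀ (γ : Below κ) {i : Ordinal.{u}}, i < γ.1 → i < (s₁ γ).len := fun γ i hi => by
      rwa [(hlen γ).2.1]
    have hv3 : ∀ (γ : Below κ) {i : Ordinal.{u}}, i < γ.1 → i < (s₂ γ).len := fun γ i hi => by
      rwa [(hlen γ).2.2]
    have hb1 : ∀ γ, IsSeqBelow κ (s₁ γ) := fun γ => (core_len hκ hT (h2 γ)).2.2
    have hb2 : ∀ γ, IsSeqBelow κ (s₂ γ) := fun γ => (core_len hκ hT (h3 γ)).2.2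
    let z₀ : Below κ := ⟨0, hκ.pos⟩
    have : Nonempty (ULift.{u + 1} Bool × Below κ × Below κ) := ⟨(⟨true⟩, z₀, z₀)⟩
    -- A splitting of length γ is coded as one function on κ: a bit of the intermediate point and an
    -- entry of each witness, with default values from γ on.
    let f : Below κ → Below κ → ULift.{u + 1} Bool × Below κ × Below κ := fun γ i =>
      if hi : i.1 < γ.1 then (⟨(v γ).val ⟨i.1, hv1 γ hi⟩⟩,
        ⟨(s₁ γ).val ⟨i.1, hv2 γ hi⟩, (hb1 γ).2 _⟩, ⟨(s₂ γ).val ⟨i.1, hv3 γ hi⟩, (hb2 γ).2 _⟩)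
      else (⟨true⟩, z₀, z₀)
    -- Because ρ exceeds both arguments, the given branch bounds the witnesses; this is why the tree
    -- of splittings has small levels.
    have hfs : ∀ γ i, i < γ → (f γ i).2.1 < s i ∧ (f γ i).2.2 < s i := by
      intro γ i hi
      have hi' : i.1 < γ.1 := hi
      have h4 : i.1 < (TSeq.ofFun (fun β => (s β).1) γ.1).len := lt_min i.2 hi'
      have h5 : i.1 < (oplusTilde (s₁ γ) (s₂ γ)).len := lt_min (hv2 γ hi') (hv3 γ hi')
      have h6 := TSeq.val_congr (h1 γ) h4 h5
      rw [oplusTilde_val _ _ h5 (hv2 γ hi') (hv3 γ hi')] at h6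
      have h6 : (s i).1 = rho _ (rho _ _) := h6
      simp only [f, dif_pos hi']
      constructor
      · change Subtype.val _ < (s i).1
        refine lt_of_lt_of_eq ?_ h6.symm
        exact (left_lt_rho _ _).trans (right_lt_rho _ _)
      · change Subtype.val _ < (s i).1
        refine lt_of_lt_of_eq ?_ h6.symm
        exact (right_lt_rho _ _).trans (right_lt_rho _ _)
    have hcard : ∀ β : Below κ, #(range fun γ : Set.Ici β => fun i : Set.Iio β => f γ i) <
        Cardinal.lift.{u + 1} κ := by
      intro β
      obtain ⟨b, hb⟩ := hκ.exists_forall_lt (mk_Iio_below β) fun i => s i.1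
      have hI := mk_Iio_below b
      have hA : #(ULift.{u + 1} Bool × Set.Iio b × Set.Iio b) < Cardinal.lift.{u + 1} κ := by
        simp only [mk_prod, Cardinal.lift_id]
        exact mul_lt_of_lt hκ.aleph0_lt_lift.le ((lt_aleph0_of_finite _).trans hκ.aleph0_lt_lift)
          (mul_lt_of_lt hκ.aleph0_lt_lift.le hI hI)
      refine lt_of_le_of_lt ?_ (hκ.mk_fun_lt (mk_Iio_below β) hA)
      refine mk_le_of_surjective (α := Set.Iio β → ULift.{u + 1} Bool × Set.Iio b × Set.Iio b)
        (f := fun g => if hg : (fun i => ((g i).1, (g i).2.1.1, (g i).2.2.1)) ∈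
          (range fun γ : Set.Ici β => fun i : Set.Iio β => f γ i) then ⟨_, hg⟩
          else ⟨_, ⟨β, mem_Ici.2 le_rfl⟩, rfl⟩) ?_
      rintro ⟨_, ⟨γ, hγ⟩, rfl⟩
      have hlt : ∀ i : Set.Iio β, i.1 < γ := fun i => lt_of_lt_of_le i.2 hγ
      refine ⟨fun i => ((f γ i).1, ⟨(f γ i).2.1, (hfs γ i (hlt i)).1.trans (hb i)⟩,
        ⟨(f γ i).2.2, (hfs γ i (hlt i)).2.trans (hb i)⟩), ?_⟩
      dsimp only
      rw [dif_pos ⟨⟨γ, hγ⟩, rfl⟩]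
    obtain ⟨b, hb⟩ := hκ.exists_branch' f hcard
    have key : ∀ γ < κ.ord,
        Core κ T n (TSeq.ofFun x (1 + γ)) (TSeq.ofFun (fun i => (b i).1.down) (1 + γ))
          (TSeq.ofFun (fun i => ((b i).2.1).1) γ) ∧
        Core κ T n (TSeq.ofFun (fun i => (b i).1.down) (1 + γ)) (TSeq.ofFun y (1 + γ))
          (TSeq.ofFun (fun i => ((b i).2.2).1) γ) := by
      intro γ hγ
      -- Agreement up to γ + 1 is required: the intermediate point has length 1 + γ, one more than
      -- the witnesses when γ is finite.
      obtain ⟨δ, hδ, hag⟩ := hb ⟨γ + 1, hκ.succ_lt hγ⟩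
      have hδ' : γ + 1 ≤ δ.1 := hδ
      have hγδ : γ ≤ δ.1 := (le_self_add).trans hδ'
      have hag' : ∀ i (hi : i < γ + 1), f δ ⟨i, hi.trans (hκ.succ_lt hγ)⟩ =
          b ⟨i, hi.trans (hκ.succ_lt hγ)⟩ := fun i hi => hag _ hi
      have hfd : ∀ i (hi : i < δ.1), f δ ⟨i, hi.trans δ.2⟩ = (⟨(v δ).val ⟨i, hv1 δ hi⟩⟩,
        ⟨(s₁ δ).val ⟨i, hv2 δ hi⟩, (hb1 δ).2 _⟩, ⟨(s₂ δ).val ⟨i, hv3 δ hi⟩, (hb2 δ).2 _⟩) :=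
        fun i hi => dif_pos hi
      have hve : (v δ).restrict (1 + γ) = TSeq.ofFun (fun i => (b i).1.down) (1 + γ) := by
        refine TSeq.ext_val ?_ fun i h₁ h₂ => ?_
        · rw [TSeq.ofFun_len _ (one_add_lt_ord hκ hγ).le, TSeq.restrict_len_of_le]
          rw [(hlen δ).1]; gcongr
        · have hi : i < γ + 1 := (lt_min_iff.1 h₁).2.trans_le (one_add_le_add_one γ)
          rw [TSeq.ofFun_val, ← hag' i hi, hfd i (hi.trans_le hδ')]
          rfl
      have hs1 : (s₁ δ).restrict γ = TSeq.ofFun (fun i => ((b i).2.1).1) γ := by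
        refine TSeq.ext_val ?_ fun i h₁ h₂ => ?_
        · rw [TSeq.ofFun_len _ hγ.le, TSeq.restrict_len_of_le]
          rwa [(hlen δ).2.1]
        · have hi : i < γ + 1 := (lt_min_iff.1 h₁).2.trans_le le_self_add
          rw [TSeq.ofFun_val, ← hag' i hi, hfd i (hi.trans_le hδ')]
          rfl
      have hs2 : (s₂ δ).restrict γ = TSeq.ofFun (fun i => ((b i).2.2).1) γ := by
        refine TSeq.ext_val ?_ fun i h₁ h₂ => ?_
        · rw [TSeq.ofFun_len _ hγ.le, TSeq.restrict_len_of_le]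
          rwa [(hlen δ).2.2]
        · have hi : i < γ + 1 := (lt_min_iff.1 h₁).2.trans_le le_self_add
          rw [TSeq.ofFun_val, ← hag' i hi, hfd i (hi.trans_le hδ')]
          rfl
      have hr : ∀ w : Below κ → Bool, (TSeq.ofFun w (1 + δ.1)).restrict (1 + γ) =
          TSeq.ofFun w (1 + γ) := fun w => by
        rw [TSeq.ofFun_restrict, min_eq_right (by gcongr)]
      have c1 := core_restrict hκ hT (h2 δ) γ
      have c2 := core_restrict hκ hT (h3 δ) γ
      rw [hve, hs1, hr] at c1
      rw [hve, hs2, hr] at c2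
      exact ⟨c1, c2⟩
    exact htrans x (fun i => (b i).1.down) y (ih _ _ (fun i => (b i).2.1) fun γ hγ => (key γ hγ).1)
      (ih _ _ (fun i => (b i).2.2) fun γ hγ => (key γ hγ).2)

theorem mem_sMap_iff {x : Cantor κ} {p : TSeq.{u} Bool} {s : TSeq.{u} Ordinal.{u}}
    (hs : s.len ≠ 0) : (p, s) ∈ sMap κ T x ↔
      (∃ (n : ℕ) (s' : TSeq.{u} Ordinal.{u}), s = TSeq.cons (n : Ordinal.{u}) s' ∧
        Core κ T n p (TSeq.ofFun (show Below κ → Bool from x) p.len) s') ∧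
      ¬(s = TSeq.const 0 p.len ∧ p ≠ TSeq.ofFun (show Below κ → Bool from x) p.len) := by
  change ((p, TSeq.ofFun (show Below κ → Bool from x) p.len, s) ∈ ⋃ n, stage κ T n) ∧ _ ↔ _
  simp only [mem_iUnion, mem_stage_iff]
  refine and_congr_left fun _ => exists_congr fun n => ⟨fun h => ?_, Or.inr⟩
  rcases h with h | h
  · exact absurd (congrArg (fun q : Triple.{u} => q.2.2.len) h) hs
  · exact h

/-- Injectivity of ρ recovers s(β) from the value of `oplus s t` at β, and that value is determined
by the entries of s and t up to β. -/
theorem oplus_isPrefix_iff {s t s' t' : TSeq.{u} Ordinal.{u}} (ht : t.len = s.len)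
    (ht' : t'.len = s'.len) (htt : s.len ≤ s'.len → t.IsPrefix t') :
    (oplus s t).IsPrefix (oplus s' t') ↔ s.IsPrefix s' := by
  have e₁ : (oplus s t).len = s.len := by rw [oplus_len, ht, min_self]
  have e₂ : (oplus s' t').len = s'.len := by rw [oplus_len, ht', min_self]
  rw [TSeq.isPrefix_iff, TSeq.isPrefix_iff]
  refine ⟨fun ⟨hl, h⟩ => ⟨by rwa [e₁, e₂] at hl, fun β h₁ h₂ => ?_⟩,
    fun ⟨hl, h⟩ => ⟨by rwa [e₁, e₂], fun β h₁ h₂ => ?_⟩⟩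
  · have o₁ : β < (oplus s t).len := lt_min h₁ (ht ▸ h₁)
    have o₂ : β < (oplus s' t').len := lt_min h₂ (ht' ▸ h₂)
    have e := h β o₁ o₂
    rcases eq_or_ne β 0 with rfl | hne
    · rw [oplus_val_zero s t o₁ h₁ (ht ▸ h₁), oplus_val_zero s' t' o₂ h₂ (ht' ▸ h₂)] at e
      exact (rho_injective e).1
    · rw [oplus_val_pos s t hne o₁ h₁ (ht ▸ h₁), oplus_val_pos s' t' hne o₂ h₂ (ht' ▸ h₂)] at e
      exact (rho_injective (rho_injective e).2).1
  · have k₁ : β < s.len := e₁ ▸ h₁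
    have k₂ : β < s'.len := e₂ ▸ h₂
    have k₃ : β < t.len := ht ▸ k₁
    have k₄ : β < t'.len := ht' ▸ k₂
    have e := (TSeq.isPrefix_iff.1 (htt hl)).2 β k₃ k₄
    have o₁ : β < (oplus s t).len := lt_min k₁ k₃
    have o₂ : β < (oplus s' t').len := lt_min k₂ k₄
    rcases eq_or_ne β 0 with rfl | hne
    · rw [oplus_val_zero s t o₁ k₁ k₃, oplus_val_zero s' t' o₂ k₂ k₄, h 0 k₁ k₂, e]
    · rw [oplus_val_pos s t hne o₁ k₁ k₃, oplus_val_pos s' t' hne o₂ k₂ k₄, h β k₁ k₂, e]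
      congr 2
      exact iSup_congr fun i => h i.1 _ _

/-- A witness of `x R y` yields a map between sequences that takes `s_T(x)` into `s_T(y)`. -/
theorem exists_map_of_rel (hκ : IsWeaklyCompact κ) (hT : IsDSTTree κ T) (c : LabelData κ)
    {x y : Cantor κ} (hxy : proj κ T x y) :
    ∃ φ : SuccSeq κ → SuccSeq κ, (∀ s, (φ s).1.len = s.1.len) ∧
      (∀ s t, (φ s).1.IsPrefix (φ t).1 ↔ s.1.IsPrefix t.1) ∧
      (∀ s, c.num s.1 ≤ c.num (φ s).1) ∧
      ∀ p (s : SuccSeq κ), (p, s.1) ∈ sMap κ T x → (p, (φ s).1) ∈ sMap κ T y := by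
  obtain ⟨ξ, hξ⟩ := hxy
  let Ξ : TSeq.{u} Ordinal.{u} := TSeq.ofFun (κ := κ) (fun β => (ξ β).1) κ.ord
  have hΞ : Ξ.len = κ.ord := TSeq.ofFun_len _ le_rfl
  -- The witness ξ with the level number 0 in front, cut to the length of s; the map sought is s ↦ s
  -- ⊕ t(s).
  let t : TSeq.{u} Ordinal.{u} → TSeq.{u} Ordinal.{u} := fun s => (TSeq.cons 0 Ξ).restrict s.len
  have hle : ∀ s : SuccSeq κ, s.1.len ≤ (TSeq.cons 0 Ξ).len := fun s => by
    rw [TSeq.cons_len, hΞ]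
    exact s.2.1.1.le.trans (le_one_add _)
  have ht : ∀ s : SuccSeq κ, (t s.1).len = s.1.len := fun s => TSeq.restrict_len_of_le (hle s)
  have htS : ∀ s : SuccSeq κ, t s.1 ∈ SuccSeq κ := fun s => by
    refine ⟨⟨(ht s).trans_lt s.2.1.1, fun ⟨β, hβ⟩ => ?_⟩, by rw [ht]; exact s.2.2⟩
    have hβ' : β < (TSeq.cons 0 Ξ).len := (lt_min_iff.1 hβ.out).2.trans_le (hle s)
    change (TSeq.cons 0 Ξ).val ⟨β, hβ'⟩ < κ.ord
    rcases one_add_cases β with rfl | ⟨β, rfl⟩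
    · exact (TSeq.cons_val_zero 0 Ξ hβ').trans_lt hκ.pos
    · rw [TSeq.cons_val_add 0 Ξ hβ' (one_add_lt_iff.1 hβ')]
      exact (ξ _).2
  have hlen : ∀ s : SuccSeq κ, (oplus s.1 (t s.1)).len = s.1.len := fun s => by
    rw [oplus_len, ht, min_self]
  refine ⟨fun s => ⟨oplus s.1 (t s.1), isSeqBelow_oplus hκ.isRegular hκ.1 s.2.1 (htS s).1,
    by rw [hlen]; exact s.2.2⟩, hlen, fun s s' => ?_, fun s => c.num_le _ s.2 _ (htS s) (ht s).symm,
    fun p s hp => ?_⟩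
  · refine oplus_isPrefix_iff (ht s) (ht s') fun hl => ?_
    exact (TSeq.restrict_isPrefix _ _).of_len_le (TSeq.restrict_isPrefix _ _)
      (by rw [ht, ht]; exact hl)
  · have hs0 : s.1.len ≠ 0 := by
      obtain ⟨γ, hγ⟩ := s.2.2
      rw [hγ]
      exact (zero_le.trans_lt (Order.lt_add_one_iff.2 (le_refl γ))).ne'
    obtain ⟨⟨n, s', hs', hcore⟩, -⟩ := (mem_sMap_iff hs0).1 hp
    obtain ⟨l1, -, l3⟩ := core_len hκ hT hcore
    have hlκ : s'.len < κ.ord := l3.1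
    have h1κ := one_add_lt_ord hκ hlκ
    have hpos : (1 + s'.len : Ordinal.{u}) ≠ 0 := (zero_lt_one.trans_le le_self_add).ne'
    have hm : ∀ x : Below κ → Bool, (TSeq.ofFun x (1 + s'.len)).minus = TSeq.ofFun x s'.len := by
      intro x
      rw [TSeq.minus_eq_of_len (TSeq.ofFun_len x h1κ.le), TSeq.ofFun_restrict,
        min_eq_right (le_one_add _)]
    have hΞs : Ξ.restrict s'.len = TSeq.ofFun (κ := κ) (fun β => (ξ β).1) s'.len := by
      rw [TSeq.ofFun_restrict, min_eq_right hlκ.le]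
    -- The triple of x, y and ξ lies at level 0, so composing it with a triple of level n that ends
    -- in x gives one of level n + 1 that ends in y. The first entry ρ(n, 0) is at least n + 1, and
    -- levels increase.
    have hc0 : Core κ T 0 (TSeq.ofFun (show Below κ → Bool from x) p.len)
        (TSeq.ofFun (show Below κ → Bool from y) p.len) (Ξ.restrict s'.len) := by
      rw [l1, hΞs]
      refine ⟨by rwa [TSeq.ofFun_len _ h1κ.le], by rwa [TSeq.ofFun_len _ h1κ.le], ?_⟩
      rw [hm, hm]
      exact Or.inl (hξ _ hlκ)
    have hcore' : Core κ T (n + 1) p (TSeq.ofFun (show Below κ → Bool from y) p.len)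
        (oplusTilde s' (Ξ.restrict s'.len)) :=
      Or.inr ⟨_, _, _, rfl, hcore, core_mono (Nat.zero_le n) hc0⟩
    obtain ⟨m, hnm, hrho⟩ := exists_rho_eq_nat.{u} n
    have hφ : oplus s.1 (t s.1) = TSeq.cons (m : Ordinal.{u}) (oplusTilde s' (Ξ.restrict s'.len)) := by
      have : t s.1 = TSeq.cons 0 (Ξ.restrict s'.len) := by
        rw [← TSeq.cons_restrict, ← TSeq.cons_len (n : Ordinal.{u}) s', ← hs']
      rw [this, hs', oplus_cons, hrho]
    refine (mem_sMap_iff (by rw [hlen]; exact hs0)).2 ⟨⟨m, _, hφ, core_mono hnm hcore'⟩, ?_⟩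
    -- The first entry m > n is not 0, so the new triple is not among those removed from S_T.
    rintro ⟨h0, -⟩
    have hz : (TSeq.cons (m : Ordinal.{u}) (oplusTilde s' (Ξ.restrict s'.len))).val
        ⟨0, TSeq.cons_len_pos _ _⟩ = 0 :=
      TSeq.val_congr (hφ.symm.trans h0) _ (l1 ▸ pos_iff_ne_zero.2 hpos)
    rw [TSeq.cons_val_zero] at hz
    exact (Nat.zero_le n).not_gt (lt_of_lt_of_eq hnm (by exact_mod_cast hz))

/-- A coherent map between sequences taking `s_T(x)` into `s_T(y)` witnesses `x R y`. -/
theorem rel_of_map (hκ : IsWeaklyCompact κ) (hT : IsDSTTree κ T)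
    (hrefl : ∀ x, proj κ T x x) (htrans : ∀ x y z, proj κ T x y → proj κ T y z → proj κ T x z)
    {x y : Cantor κ} (φ : SuccSeq κ → SuccSeq κ) (hlen : ∀ s, (φ s).1.len = s.1.len)
    (hpre : ∀ s t, s.1.IsPrefix t.1 → (φ s).1.IsPrefix (φ t).1)
    (hφ : ∀ p (s : SuccSeq κ), (p, s.1) ∈ sMap κ T x → (p, (φ s).1) ∈ sMap κ T y) :
    proj κ T x y := by
  -- Constant sequences 0 code diagonal triples of level 0, so each `z γ` is paired with an initial
  -- segment of x in s_T(x). Their images cohere and define ξ.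
  let z : Below κ → SuccSeq κ := fun γ => ⟨TSeq.const 0 (γ.1 + 1),
    ⟨hκ.succ_lt γ.2, fun _ => hκ.pos⟩, γ.1, rfl⟩
  have hzl : ∀ γ, (φ (z γ)).1.len = γ.1 + 1 := fun γ => hlen (z γ)
  have hne : ∀ γ, (φ (z γ)).1.len ≠ 0 := fun γ => by
    rw [hzl]; exact (zero_le.trans_lt (Order.lt_add_one_iff.2 (le_refl γ.1))).ne'
  have hzp : ∀ γ δ : Below κ, γ ≤ δ → (φ (z γ)).1.IsPrefix (φ (z δ)).1 := fun γ δ h => by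
    refine hpre _ _ (TSeq.isPrefix_iff.2 ⟨?_, fun _ _ _ => rfl⟩)
    change γ.1 + 1 ≤ δ.1 + 1
    gcongr
  have hlast : ∀ γ : Below κ, γ.1 < (φ (z γ)).1.len := fun γ => by
    rw [hzl]; exact Order.lt_add_one_iff.2 le_rfl
  let ξ : Below κ → Below κ := fun γ => ⟨(φ (z γ)).1.val ⟨γ.1, hlast γ⟩, (φ (z γ)).2.1.2 _⟩
  have hξ : ∀ (γ : Below κ) β (h : β < (φ (z γ)).1.len) (hβ : β < κ.ord),
      (φ (z γ)).1.val ⟨β, h⟩ = (ξ ⟨β, hβ⟩).1 := by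
    intro γ β h hβ
    have hβγ : β ≤ γ.1 := by rw [hzl] at h; exact Order.lt_add_one_iff.1 h
    exact ((TSeq.isPrefix_iff.1 (hzp ⟨β, hβ⟩ γ hβγ)).2 β (hlast ⟨β, hβ⟩) h).symm
  have hstep : ∀ γ : Below κ, ∃ (n : ℕ) (s' : TSeq.{u} Ordinal.{u}),
      (φ (z γ)).1 = TSeq.cons (n : Ordinal.{u}) s' ∧
      Core κ T n (TSeq.ofFun (show Below κ → Bool from x) (γ.1 + 1))
        (TSeq.ofFun (show Below κ → Bool from y) (γ.1 + 1)) s' := by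
    intro γ
    have hxl : (TSeq.ofFun (show Below κ → Bool from x) (γ.1 + 1)).len = γ.1 + 1 :=
      TSeq.ofFun_len _ (hκ.succ_lt γ.2).le
    have hγ0 : (γ.1 + 1 : Ordinal.{u}) ≠ 0 :=
      (zero_le.trans_lt (Order.lt_add_one_iff.2 (le_refl γ.1))).ne'
    obtain ⟨l, hl⟩ := (one_add_cases (γ.1 + 1)).resolve_left hγ0
    have hlκ : l < κ.ord := (le_one_add l).trans_lt (hl ▸ hκ.succ_lt γ.2)
    have hmem : (TSeq.ofFun (show Below κ → Bool from x) (γ.1 + 1), (z γ).1) ∈ sMap κ T x := by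
      refine (mem_sMap_iff (by exact hγ0)).2 ⟨⟨0, TSeq.const 0 l, ?_, ?_⟩, ?_⟩
      · exact TSeq.eq_cons_iff.2 ⟨hl, fun _ => by simp [z, TSeq.const], fun _ _ _ => rfl⟩
      · rw [hxl]
        refine ⟨by rw [hxl]; exact hγ0, by rw [hxl]; exact hγ0, Or.inr ⟨rfl, ?_, hlκ, fun _ => hκ.pos⟩⟩
        exact TSeq.minus_len (hxl.trans hl)
      · rw [hxl]
        exact fun h => h.2 rfl
    obtain ⟨⟨n, s', h1, h2⟩, -⟩ := (mem_sMap_iff (hne γ)).1 (hφ _ _ hmem)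
    rw [hxl] at h2
    exact ⟨n, s', h1, h2⟩
  choose N S hNS hcore using hstep
  -- The level is the common first entry of the images, hence does not vary with γ.
  have hN : ∀ γ : Below κ, (N γ : Ordinal.{u}) = (ξ ⟨0, hκ.pos⟩).1 := fun γ => by
    rw [← hξ γ 0 (pos_iff_ne_zero.2 (hne γ)) hκ.pos,
      TSeq.val_congr (hNS γ) (pos_iff_ne_zero.2 (hne γ)) (TSeq.cons_len_pos _ _),
      TSeq.cons_val_zero]
  have hN' : ∀ γ δ, N γ = N δ := fun γ δ => by exact_mod_cast (hN γ).trans (hN δ).symm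
  refine rel_of_core hκ hT hrefl htrans (N ⟨0, hκ.pos⟩) x y
    (fun β => ξ ⟨1 + β.1, one_add_lt_ord hκ β.2⟩) fun γ hγ => ?_
  have hc := core_restrict hκ hT (hcore ⟨γ, hγ⟩) γ
  rw [hN' _ ⟨0, hκ.pos⟩, TSeq.ofFun_restrict, TSeq.ofFun_restrict,
    min_eq_right (one_add_le_add_one γ)] at hc
  convert hc using 1
  have hSl : 1 + (S ⟨γ, hγ⟩).len = γ + 1 := by
    rw [← hzl ⟨γ, hγ⟩, hNS ⟨γ, hγ⟩]; rfl
  have hγS : γ ≤ (S ⟨γ, hγ⟩).len := by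
    have := (one_add_le_add_one γ).trans_eq hSl.symm
    exact (add_le_add_iff_left (1 : Ordinal.{u})).1 this
  refine TSeq.ext_val ?_ fun β h₁ h₂ => ?_
  · rw [TSeq.ofFun_len _ hγ.le, TSeq.restrict_len_of_le hγS]
  · have hβ : β < (S ⟨γ, hγ⟩).len := (lt_min_iff.1 h₂).1
    have k₁ : 1 + β < (TSeq.cons (N ⟨γ, hγ⟩ : Ordinal.{u}) (S ⟨γ, hγ⟩)).len := one_add_lt_iff.2 hβ
    have k₂ : 1 + β < (φ (z ⟨γ, hγ⟩)).1.len := (hNS ⟨γ, hγ⟩).symm ▸ k₁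
    rw [TSeq.ofFun_val, TSeq.restrict_val, ← TSeq.cons_val_add _ _ k₁ hβ,
      ← TSeq.val_congr (hNS ⟨γ, hγ⟩) k₂ k₁]
    exact (hξ _ _ k₂ _).symm

end Core
end GenTree
end

noncomputable section
namespace GenTree
open Ordinal Cardinal Set

/-! ### The labels are trees -/

section LabelTrees

variable {κ : Cardinal.{u}} {γ : Ordinal.{u}} {B : Type v} {k : ℕ}

theorem DomI.isTree {r : Below κ → Below κ → Prop} (hr : IsLinOrd r) :
    IsTree (DomI.le (γ := γ) r) := by
  refine ⟨fun a => ?_, fun a b c hab hbc => ?_, fun a b hab hba => ?_, fun x a b hax hbx => ?_⟩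
  · cases a
    exacts [.base_base (hr.1 _), .twig_twig _ le_rfl]
  · cases hab with
    | base_base h =>
      cases hbc with
      | base_base h' => exact .base_base (hr.2.1 _ _ _ h h')
      | base_twig β h' => exact .base_twig _ (hr.2.1 _ _ _ h h')
    | base_twig β h => cases hbc with | twig_twig _ h' => exact .base_twig _ h
    | twig_twig _ h => cases hbc with | twig_twig _ h' => exact .twig_twig _ (h.trans h')
  · cases hab with
    | base_base h => cases hba with | base_base h' => rw [hr.2.2.1 _ _ h h']
    | base_twig β h => cases hba
    | twig_twig _ h => cases hba with | twig_twig _ h' => rw [le_antisymm h h']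
  · replace hax := hax.1
    replace hbx := hbx.1
    cases hax with
    | base_base h => cases hbx with
      | base_base h' => exact (hr.2.2.2 _ _).imp .base_base .base_base
    | base_twig β h => cases hbx with
      | base_twig _ h' => exact (hr.2.2.2 _ _).imp .base_base .base_base
      | twig_twig _ h' => exact Or.inl (.base_twig _ h)
    | twig_twig _ h => cases hbx with
      | base_twig _ h' => exact Or.inr (.base_twig _ h')
      | twig_twig _ h' => exact (le_total _ _).imp (.twig_twig _) (.twig_twig _)

theorem Broom.isTree {r : B → B → Prop} (hr : IsLinOrd r) : IsTree (Broom.le (k := k) r) := by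
  refine ⟨fun a => ?_, fun a b c hab hbc => ?_, fun a b hab hba => ?_, fun x a b hax hbx => ?_⟩
  · cases a
    exacts [.init_init (hr.1 _), .star_star le_rfl, .fork_fork _, .tip_tip _ _]
  · cases hab <;> cases hbc <;> constructor
    · exact hr.2.1 _ _ _ ‹_› ‹_›
    · exact le_trans ‹_› ‹_›
  · cases hab with
    | init_init h => cases hba with | init_init h' => rw [hr.2.2.1 _ _ h h']
    | star_star h => cases hba with | star_star h' => rw [le_antisymm h h']
    | _ => cases hba <;> rfl
  · obtain ⟨hax, hax'⟩ := hax
    obtain ⟨hbx, hbx'⟩ := hbx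
    cases hax <;> cases hbx <;>
    first
      | exact absurd rfl hax'
      | exact absurd rfl hbx'
      | exact (hr.2.2.2 _ _).imp .init_init .init_init
      | exact (le_total _ _).imp .star_star .star_star
      | exact Or.inl (by constructor)
      | exact Or.inr (by constructor)

end LabelTrees

/-! ### The trees G are trees -/

section GTree

variable {κ : Cardinal.{u}} {c : LabelData κ}
  {𝒯 : Set (TSeq.{u} Bool × TSeq.{u} Ordinal.{u})}

theorem SuccSeq.lastIndex_lt (s : SuccSeq κ) : s.1.len = s.1.lastIndex + 1 ∧
    s.1.lastIndex < κ.ord := by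
  obtain ⟨γ, hγ⟩ := s.2.2
  rw [TSeq.lastIndex_eq hγ]
  exact ⟨hγ, (Order.lt_add_one_iff.2 le_rfl).trans (hγ ▸ s.2.1.1)⟩

theorem linOrd_L (c : LabelData κ) (s : SuccSeq κ) : IsLinOrd (c.L s.1.lastIndex) :=
  c.L_linOrd _ (SuccSeq.lastIndex_lt s).2

theorem linOrd_le {B : Type v} [LinearOrder B] : IsLinOrd fun b b' : B => b ≤ b' :=
  ⟨le_refl, fun _ _ _ => le_trans, fun _ _ => le_antisymm, le_total⟩

theorem linOrd_Lstar (c : LabelData κ)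
    (h𝒯 : ∀ p ∈ 𝒯, p.1.len = p.2.len) (s : SuccSeq κ)
    (p : {p : TSeq.{u} Bool // (p, s.1) ∈ 𝒯}) : IsLinOrd (c.Lstar p.1) :=
  c.Lstar_linOrd _ (SuccSeq.lastIndex_lt s).2 _ ((h𝒯 _ p.2).trans (SuccSeq.lastIndex_lt s).1)

/-- The trees `G` are indeed trees. -/
theorem GDom.isTree (c : LabelData κ) (h𝒯 : ∀ p ∈ 𝒯, p.1.len = p.2.len) :
    IsTree (GDom.le c 𝒯) := by
  have hI := fun s : SuccSeq κ => DomI.isTree (γ := s.1.lastIndex) (linOrd_L c s)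
  have hII := fun s : SuccSeq κ => Broom.isTree (k := 3)
    (linOrd_le (B := Set.Iio (theta 1 s.1.lastIndex (c.num s.1))))
  have hIII := fun (s : SuccSeq κ) p => Broom.isTree (k := 2) (linOrd_Lstar c h𝒯 s p)
  refine ⟨fun a => ?_, fun a b d hab hbd => ?_, fun a b hab hba => ?_, fun x a b hax hbx => ?_⟩
  · cases a with
    | node s => exact .node_node (TSeq.IsPrefix.refl _)
    | stem s z => exact .stem_stem s le_rfl
    | labI s x => exact .labI_labI s ((hI s).1 x)
    | labII s x => exact .labII_labII s ((hII s).1 x)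
    | labIII s p x => exact .labIII_labIII s p ((hIII s p).1 x)
  · cases hab with
    | node_node h => cases hbd <;> constructor <;> exact h.trans ‹_›
    | labI_labI s h => cases hbd with
      | labI_labI _ h' => exact .labI_labI s ((hI s).2.1 _ _ _ h h')
    | labII_labII s h => cases hbd with
      | labII_labII _ h' => exact .labII_labII s ((hII s).2.1 _ _ _ h h')
    | labIII_labIII s p h => cases hbd with
      | labIII_labIII _ _ h' => exact .labIII_labIII s p ((hIII s p).2.1 _ _ _ h h')
    | stem_stem s h => cases hbd with
      | stem_stem _ h' => exact .stem_stem s (h.trans h')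
      | _ => constructor
    | _ => cases hbd <;> constructor <;> assumption
  · cases hab with
    | node_node h => cases hba with
      | node_node h' => rw [Subtype.ext (h.antisymm h')]
    | stem_stem s h => cases hba with | stem_stem _ h' => rw [le_antisymm h h']
    | labI_labI s h => cases hba with
      | labI_labI _ h' => rw [(hI s).2.2.1 _ _ h h']
    | labII_labII s h => cases hba with
      | labII_labII _ h' => rw [(hII s).2.2.1 _ _ h h']
    | labIII_labIII s p h => cases hba with
      | labIII_labIII _ _ h' => rw [(hIII s p).2.2.1 _ _ h h']
    | _ => cases hba
  · obtain ⟨hax, hax'⟩ := hax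
    obtain ⟨hbx, hbx'⟩ := hbx
    cases hax with
    | labI_labI s h => cases hbx with
      | labI_labI _ h' =>
        exact ((hI s).2.2.2 _ _ _ ⟨h, fun e => hax' (by rw [e])⟩
          ⟨h', fun e => hbx' (by rw [e])⟩).imp (.labI_labI s) (.labI_labI s)
      | _ => exact Or.inr (by constructor <;> assumption)
    | labII_labII s h => cases hbx with
      | labII_labII _ h' =>
        exact ((hII s).2.2.2 _ _ _ ⟨h, fun e => hax' (by rw [e])⟩
          ⟨h', fun e => hbx' (by rw [e])⟩).imp (.labII_labII s) (.labII_labII s)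
      | _ => exact Or.inr (by constructor <;> assumption)
    | labIII_labIII s p h => cases hbx with
      | labIII_labIII _ _ h' =>
        exact ((hIII s p).2.2.2 _ _ _ ⟨h, fun e => hax' (by rw [e])⟩
          ⟨h', fun e => hbx' (by rw [e])⟩).imp (.labIII_labIII s p) (.labIII_labIII s p)
      | _ => exact Or.inr (by constructor <;> assumption)
    | stem_stem s h => cases hbx with
      | stem_stem _ h' => exact (le_total _ _).imp (.stem_stem s) (.stem_stem s)
      | _ => exact Or.inr (by constructor; assumption)
    | stem_labI s z x => cases hbx with
      | stem_labI _ _ _ => exact (le_total _ _).imp (.stem_stem s) (.stem_stem s)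
      | node_labI _ h => exact Or.inr (.node_stem _ h)
      | labI_labI _ _ => exact Or.inl (.stem_labI _ _ _)
    | stem_labII s z x => cases hbx with
      | stem_labII _ _ _ => exact (le_total _ _).imp (.stem_stem s) (.stem_stem s)
      | node_labII _ h => exact Or.inr (.node_stem _ h)
      | labII_labII _ _ => exact Or.inl (.stem_labII _ _ _)
    | stem_labIII s z x => cases hbx with
      | stem_labIII _ _ _ => exact (le_total _ _).imp (.stem_stem s) (.stem_stem s)
      | node_labIII _ _ h => exact Or.inr (.node_stem _ h)
      | labIII_labIII _ _ _ => exact Or.inl (.stem_labIII _ _ _ _)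
    | node_node h => cases hbx with
      | node_node h' => exact (h.total h').imp .node_node .node_node
    | _ =>
      rename_i h
      cases hbx <;>
      first
        | exact Or.inl (by constructor; exact h)
        | exact (TSeq.IsPrefix.total h ‹_›).imp .node_node .node_node

end GTree

/-! ### Branching above a point as an invariant of embeddings -/

section Branching

variable {D : Type v} {E : Type w} {r : D → D → Prop} {q : E → E → Prop}

/-- Incomparability. -/
def Inc (r : D → D → Prop) (a b : D) : Prop := ¬ r a b ∧ ¬ r b a

/-- Above `a` there is a full binary tree of height `n`. -/
def Branches (r : D → D → Prop) : ℕ → D → Prop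
  | 0, _ => True
  | n + 1, a => ∃ b b', r a b ∧ r a b' ∧ Inc r b b' ∧ Branches r n b ∧ Branches r n b'

/-- Above `a` there are three incomparable branching points. -/
def Triples (r : D → D → Prop) (a : D) : Prop :=
  ∃ b : Fin 3 → D, (∀ i, r a (b i) ∧ Branches r 1 (b i)) ∧ ∀ i j, i ≠ j → Inc r (b i) (b j)

theorem Inc.map (f : r ↪r q) {a b : D} (h : Inc r a b) : Inc q (f a) (f b) :=
  ⟨fun h' => h.1 (f.map_rel_iff.1 h'), fun h' => h.2 (f.map_rel_iff.1 h')⟩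

theorem Branches.map (f : r ↪r q) {n : ℕ} {a : D} (h : Branches r n a) :
    Branches q n (f a) := by
  induction n generalizing a with
  | zero => trivial
  | succ n ih =>
    obtain ⟨b, b', h1, h2, h3, h4, h5⟩ := h
    exact ⟨f b, f b', f.map_rel_iff.2 h1, f.map_rel_iff.2 h2, h3.map f, ih h4, ih h5⟩

theorem Branches.mono {n m : ℕ} (hnm : n ≤ m) {a : D} (h : Branches r m a) : Branches r n a := by
  induction n generalizing a m with
  | zero => trivial
  | succ n ih =>
    obtain ⟨m, rfl⟩ := Nat.exists_eq_succ_of_ne_zero (Nat.pos_iff_ne_zero.1 (Nat.zero_lt_of_lt hnm))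
    obtain ⟨b, b', h1, h2, h3, h4, h5⟩ := h
    have := Nat.le_of_succ_le_succ hnm
    exact ⟨b, b', h1, h2, h3, ih this h4, ih this h5⟩

theorem Triples.map (f : r ↪r q) {a : D} (h : Triples r a) : Triples q (f a) := by
  obtain ⟨b, h1, h2⟩ := h
  exact ⟨fun i => f (b i), fun i => ⟨f.map_rel_iff.2 (h1 i).1, (h1 i).2.map f⟩,
    fun i j hij => (h2 i j hij).map f⟩

/-- Branching in an upwards closed part. -/
theorem Branches.of_upper (f : r ↪r q) (hf : ∀ a e, q (f a) e → ∃ a', e = f a') {n : ℕ} {a : D}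
    (h : Branches q n (f a)) : Branches r n a := by
  induction n generalizing a with
  | zero => trivial
  | succ n ih =>
    obtain ⟨b, b', h1, h2, h3, h4, h5⟩ := h
    obtain ⟨b, rfl⟩ := hf _ _ h1
    obtain ⟨b', rfl⟩ := hf _ _ h2
    exact ⟨b, b', f.map_rel_iff.1 h1, f.map_rel_iff.1 h2,
      ⟨fun h => h3.1 (f.map_rel_iff.2 h), fun h => h3.2 (f.map_rel_iff.2 h)⟩, ih h4, ih h5⟩

theorem Triples.of_upper (f : r ↪r q) (hf : ∀ a e, q (f a) e → ∃ a', e = f a') {a : D}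
    (h : Triples q (f a)) : Triples r a := by
  obtain ⟨b, h1, h2⟩ := h
  choose b' hb using fun i => hf _ _ (h1 i).1
  obtain rfl : b = fun i => f (b' i) := funext hb
  exact ⟨b', fun i => ⟨f.map_rel_iff.1 (h1 i).1, (h1 i).2.of_upper f hf⟩,
    fun i j hij => ⟨fun h => (h2 i j hij).1 (f.map_rel_iff.2 h),
      fun h => (h2 i j hij).2 (f.map_rel_iff.2 h)⟩⟩

variable {κ : Cardinal.{u}} {γ : Ordinal.{u}} {B : Type v} {k : ℕ}

theorem DomI.eq_base_of_branches {r : Below κ → Below κ → Prop} {x : DomI κ γ}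
    (h : Branches (DomI.le r) 1 x) : ∃ α, x = .base α := by
  cases x with
  | base α => exact ⟨α, rfl⟩
  | twig α β =>
    obtain ⟨b, b', h1, h2, h3, -⟩ := h
    cases h1 with
    | @twig_twig _ _ β₁ _ =>
      cases h2 with
      | @twig_twig _ _ β₂ _ =>
        rcases le_total β₁ β₂ with h | h
        exacts [absurd (.twig_twig _ h) h3.1, absurd (.twig_twig _ h) h3.2]

/-- Branching points of a label of type I are base points, which are linearly ordered. -/
theorem DomI.not_branches_two {r : Below κ → Below κ → Prop} (hr : IsLinOrd r) (x : DomI κ γ) :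
    ¬ Branches (DomI.le r) 2 x := by
  rintro ⟨b, b', -, -, h3, h4, h5⟩
  obtain ⟨α, rfl⟩ := eq_base_of_branches h4
  obtain ⟨β, rfl⟩ := eq_base_of_branches h5
  rcases hr.2.2.2 α β with h | h
  exacts [h3.1 (.base_base h), h3.2 (.base_base h)]

/-- The linear part of a broom. -/
def Broom.Low : Broom B k → Prop
  | .init _ => True
  | .star _ => True
  | _ => False

theorem Broom.comparable {r : B → B → Prop} (hr : IsLinOrd r) {x : Broom B k} (hx : x.Low)
    (y : Broom B k) : Broom.le r x y ∨ Broom.le r y x := by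
  cases x with
  | init b =>
    cases y with
    | init b' => exact (hr.2.2.2 b b').imp .init_init .init_init
    | _ => exact Or.inl (by constructor)
  | star n =>
    cases y with
    | star m => exact (le_total m n).imp .star_star .star_star
    | init b => exact Or.inr (by constructor)
    | _ => exact Or.inl (by constructor)
  | _ => exact hx.elim

theorem Broom.low_or_fork {r : B → B → Prop} {x : Broom B k}
    (h : Branches (Broom.le r) 1 x) : x.Low ∨ ∃ i, x = .fork i := by
  cases x with
  | init b => exact Or.inl trivial
  | star n => exact Or.inl trivial
  | fork i => exact Or.inr ⟨i, rfl⟩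
  | tip i b =>
    obtain ⟨b, b', h1, h2, h3, -⟩ := h
    cases h1
    cases h2
    exact absurd (.tip_tip _ _) h3.1

theorem Broom.eq_fork {r : B → B → Prop} (hr : IsLinOrd r) {x y : Broom B k}
    (h : Branches (Broom.le r) 1 x) (hxy : Inc (Broom.le r) x y) : ∃ i, x = .fork i := by
  refine (low_or_fork h).resolve_left fun hl => ?_
  rcases comparable hr hl y with h | h
  exacts [hxy.1 h, hxy.2 h]

/-- Incomparable branching points of a broom are forks, and no fork has another fork above it. -/
theorem Broom.low_of_branches {r : B → B → Prop} (hr : IsLinOrd r) {x : Broom B k}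
    (h : Branches (Broom.le r) 2 x) : x.Low := by
  refine (low_or_fork (h.mono one_le_two)).resolve_right ?_
  rintro ⟨i, rfl⟩
  obtain ⟨b, b', h1, h2, h3, h4, h5⟩ := h
  obtain ⟨j, rfl⟩ := eq_fork hr h4 h3
  obtain ⟨j', rfl⟩ := eq_fork hr h5 ⟨h3.2, h3.1⟩
  cases h1
  cases h2
  exact h3.1 (.fork_fork _)

theorem Broom.not_branches_three {r : B → B → Prop} (hr : IsLinOrd r) (x : Broom B k) :
    ¬ Branches (Broom.le r) 3 x := by
  rintro ⟨b, b', -, -, h3, h4, -⟩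
  rcases comparable hr (low_of_branches hr h4) b' with h | h
  exacts [h3.1 h, h3.2 h]

theorem Broom.fork_branches (r : B → B → Prop) (i : Fin k) :
    Branches (Broom.le r) 1 (.fork i) :=
  ⟨.tip i true, .tip i false, .fork_tip _ _, .fork_tip _ _,
    ⟨fun h => (by cases h), fun h => (by cases h)⟩, trivial, trivial⟩

theorem Broom.fork_inc (r : B → B → Prop) {i j : Fin k} (hij : i ≠ j) :
    Inc (Broom.le r) (.fork i) (.fork j) :=
  ⟨fun h => hij (by cases h; rfl), fun h => hij (by cases h; rfl)⟩

theorem Broom.low_le_fork (r : B → B → Prop) {x : Broom B k} (hx : x.Low) (i : Fin k) :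
    Broom.le r x (.fork i) := by
  cases x with
  | init b => exact .init_fork _ _
  | star n => exact .star_fork _ _
  | _ => exact hx.elim

theorem Broom.branches_of_low (r : B → B → Prop) {x : Broom B (k + 2)} (hx : x.Low) :
    Branches (Broom.le r) 2 x :=
  ⟨.fork 0, .fork 1, low_le_fork r hx _, low_le_fork r hx _,
    fork_inc r (by simp), fork_branches r _, fork_branches r _⟩

theorem Broom.triples_of_low (r : B → B → Prop) {x : Broom B 3} (hx : x.Low) :
    Triples (Broom.le r) x :=
  ⟨fun i => .fork i, fun i => ⟨low_le_fork r hx i, fork_branches r i⟩,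
    fun _ _ hij => fork_inc r hij⟩

/-- The three points would be distinct forks, and there are only two. This distinguishes type III
from type II. -/
theorem Broom.not_triples {r : B → B → Prop} (hr : IsLinOrd r) (x : Broom B 2) :
    ¬ Triples (Broom.le r) x := by
  rintro ⟨b, h1, h2⟩
  have : ∀ i, ∃ j, b i = .fork j := fun i => by
    obtain ⟨j, hj⟩ : ∃ j, i ≠ j := ⟨i + 1, by revert i; decide⟩
    exact eq_fork hr (h1 i).2 (h2 i j hj)
  choose j hj using this
  obtain ⟨i, i', hne, heq⟩ := Fintype.exists_ne_map_eq_of_card_lt j (by simp)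
  refine (h2 i i' hne).1 ?_
  rw [hj, hj, heq]
  exact .fork_fork _

/-- In a broom there is no comb of height two. -/
theorem Broom.not_comb {r : B → B → Prop} (hr : IsLinOrd r) {x x' y : Broom B k}
    (hx : Branches (Broom.le r) 1 x) (hx' : Branches (Broom.le r) 1 x') (hxy : Inc (Broom.le r) x y)
    (hxy' : Inc (Broom.le r) x' y) (hle : Broom.le r x x') : x = x' := by
  obtain ⟨i, rfl⟩ := eq_fork hr hx hxy
  obtain ⟨i', rfl⟩ := eq_fork hr hx' hxy'
  cases hle
  rfl

/-- An embedding between the linear parts of brooms restricts to the initial parts. -/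
theorem Broom.exists_init_embedding {B' : Type w} {k' : ℕ} {r : B → B → Prop}
    {q : B' → B' → Prop} (f : Broom B k → Broom B' k')
    (hf : ∀ x y, x.Low → y.Low → (Broom.le q (f x) (f y) ↔ Broom.le r x y)) (hr : IsLinOrd r)
    (hlow : ∀ x, x.Low → (f x).Low) : Nonempty (r ↪r q) := by
  have key : ∀ b, ∃ b', f (.init b) = .init b' := by
    intro b
    have hb := hlow (.init b) trivial
    cases hfb : f (.init b) with
    | init b' => exact ⟨b', rfl⟩
    | star n =>
      exfalso
      -- The infinitely many points of ω* above b would have to fit into the finitely many points of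
      -- ω* from `star n` upwards.
      have hm : ∀ m : ℕ, ∃ j : ℕ, j ≤ n ∧ f (.star m) = .star j := by
        intro m
        have h1 := (hf (.init b) (.star m) trivial trivial).2 (.init_star b m)
        rw [hfb] at h1
        have h2 := hlow (.star m) trivial
        cases hfm : f (.star m) with
        | star j =>
          rw [hfm] at h1
          cases h1
          exact ⟨j, ‹_›, rfl⟩
        | init b' => rw [hfm] at h1; cases h1
        | _ => rw [hfm] at h2; exact h2.elim
      choose j hj hfj using hm
      have hinj : Function.Injective j := by
        intro m m' hmm
        have h1 := (hf (.star m) (.star m') trivial trivial).1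
          (by rw [hfj, hfj, hmm]; exact .star_star le_rfl)
        have h2 := (hf (.star m') (.star m) trivial trivial).1
          (by rw [hfj, hfj, hmm]; exact .star_star le_rfl)
        cases h1
        cases h2
        exact le_antisymm ‹_› ‹_›
      exact Set.infinite_range_of_injective hinj
        ((Set.finite_Iic n).subset (by rintro _ ⟨m, rfl⟩; exact hj m))
    | _ => rw [hfb] at hb; exact hb.elim
  choose g hg using key
  have hle : ∀ {B : Type v} {k : ℕ} {r : B → B → Prop} {b b'},
      Broom.le (k := k) r (.init b) (.init b') → r b b' := by
    rintro _ _ _ _ _ ⟨h⟩; exact h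
  have hle' : ∀ {B : Type w} {k : ℕ} {r : B → B → Prop} {b b'},
      Broom.le (k := k) r (.init b) (.init b') → r b b' := by
    rintro _ _ _ _ _ ⟨h⟩; exact h
  have hiff : ∀ b b', q (g b) (g b') ↔ r b b' := fun b b' => by
    have := hf (.init b) (.init b') trivial trivial
    rw [hg, hg] at this
    exact ⟨fun h => hle (this.1 (.init_init h)), fun h => hle' (this.2 (.init_init h))⟩
  refine ⟨⟨⟨g, fun b b' h => hr.2.2.1 _ _ ?_ ?_⟩, fun {b b'} => hiff b b'⟩⟩
  · have h1 := (hf (.init b) (.init b') trivial trivial).1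
    have h2 := (hf (.init b) (.init b) trivial trivial).2 (.init_init (hr.1 b))
    rw [hg, h] at h2
    rw [hg, hg, h] at h1
    exact hle (h1 h2)
  · have h1 := (hf (.init b') (.init b) trivial trivial).1
    have h2 := (hf (.init b) (.init b) trivial trivial).2 (.init_init (hr.1 b))
    rw [hg, h] at h2
    rw [hg, hg, h] at h1
    exact hle (h1 h2)

end Branching
end GenTree
end

noncomputable section
namespace GenTree
open Ordinal Cardinal Set

/-! ### Embeddings between the trees G -/

section Embeddings

variable {κ : Cardinal.{u}} {c : LabelData κ}
  {𝒯 𝒯' : Set (TSeq.{u} Bool × TSeq.{u} Ordinal.{u})}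

/-- The point of the nodes below which a point is placed. -/
def GDom.pos : GDom c 𝒯 → SuccSeq κ
  | .node s => s
  | .stem s _ => s
  | .labI s _ => s
  | .labII s _ => s
  | .labIII s _ _ => s

/-- The points of the labels. -/
def GDom.IsLabel : GDom c 𝒯 → Prop
  | .node _ => False
  | .stem _ _ => False
  | _ => True

/-- The label of type I at `s` inside the tree. -/
def GDom.embI (c : LabelData κ) (𝒯) (s : SuccSeq κ) :
    DomI.le (γ := s.1.lastIndex) (c.L s.1.lastIndex) ↪r GDom.le c 𝒯 where
  toFun := .labI s
  inj' _ _ h := by cases h; rfl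
  map_rel_iff' := ⟨fun h => by cases h; assumption, fun h => .labI_labI s h⟩

/-- The label of type II at `s` inside the tree. -/
def GDom.embII (c : LabelData κ) (𝒯) (s : SuccSeq κ) :
    Broom.le (B := Set.Iio (theta 1 s.1.lastIndex (c.num s.1))) (k := 3) (fun b b' => b ≤ b') ↪r
      GDom.le c 𝒯 where
  toFun := .labII s
  inj' _ _ h := by cases h; rfl
  map_rel_iff' := ⟨fun h => by cases h; assumption, fun h => .labII_labII s h⟩

/-- The labels of type III at `s` inside the tree. -/
def GDom.embIII (c : LabelData κ) {𝒯} (s : SuccSeq κ) (p : {p : TSeq.{u} Bool // (p, s.1) ∈ 𝒯}) :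
    Broom.le (k := 2) (c.Lstar p.1) ↪r GDom.le c 𝒯 where
  toFun := .labIII s p
  inj' _ _ h := by cases h; rfl
  map_rel_iff' := ⟨fun h => by cases h; assumption, fun h => .labIII_labIII s p h⟩

theorem GDom.branches_labI {s : SuccSeq κ} {x} {n : ℕ}
    (h : Branches (GDom.le c 𝒯) n (.labI s x)) : Branches (DomI.le (c.L s.1.lastIndex)) n x :=
  Branches.of_upper (embI c 𝒯 s) (fun a e h => by cases h; exact ⟨_, rfl⟩) h

theorem GDom.branches_labII {s : SuccSeq κ} {x} {n : ℕ}
    (h : Branches (GDom.le c 𝒯) n (.labII s x)) :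
    Branches (Broom.le fun b b' => b ≤ b') n x :=
  Branches.of_upper (embII c 𝒯 s) (fun a e h => by cases h; exact ⟨_, rfl⟩) h

theorem GDom.branches_labIII {s : SuccSeq κ} {p : {p : TSeq.{u} Bool // (p, s.1) ∈ 𝒯}} {x} {n : ℕ}
    (h : Branches (GDom.le c 𝒯) n (.labIII s p x)) : Branches (Broom.le (c.Lstar p.1)) n x :=
  Branches.of_upper (embIII c s p) (fun a e h => by cases h; exact ⟨_, rfl⟩) h

theorem GDom.inc_labII {s : SuccSeq κ} {x y} (h : Inc (GDom.le c 𝒯) (.labII s x) (.labII s y)) :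
    Inc (Broom.le fun b b' => b ≤ b') x y :=
  ⟨fun h' => h.1 (.labII_labII s h'), fun h' => h.2 (.labII_labII s h')⟩

theorem GDom.inc_labIII {s : SuccSeq κ} {p : {p : TSeq.{u} Bool // (p, s.1) ∈ 𝒯}} {x y}
    (h : Inc (GDom.le c 𝒯) (.labIII s p x) (.labIII s p y)) : Inc (Broom.le (c.Lstar p.1)) x y :=
  ⟨fun h' => h.1 (.labIII_labIII s p h'), fun h' => h.2 (.labIII_labIII s p h')⟩

theorem Triples.branches {D : Type v} {r : D → D → Prop} {a : D} (h : Triples r a) :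
    Branches r 2 a := by
  obtain ⟨b, h1, h2⟩ := h
  exact ⟨b 0, b 1, (h1 0).1, (h1 1).1, h2 0 1 (by decide), (h1 0).2, (h1 1).2⟩

theorem GDom.not_branches_three (h𝒯 : ∀ p ∈ 𝒯, p.1.len = p.2.len) {a : GDom c 𝒯}
    (ha : a.IsLabel) : ¬ Branches (GDom.le c 𝒯) 3 a := by
  intro h
  cases a with
  | labI s x =>
    exact DomI.not_branches_two (linOrd_L c s) x ((branches_labI h).mono (by norm_num))
  | labII s x => exact Broom.not_branches_three linOrd_le x (branches_labII h)
  | labIII s p x => exact Broom.not_branches_three (linOrd_Lstar c h𝒯 s p) x (branches_labIII h)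
  | _ => exact ha

theorem GDom.stem_le_or {s : SuccSeq κ} {z z' : ℤ} {a : GDom c 𝒯}
    (h : GDom.le c 𝒯 (.stem s z) a) : GDom.le c 𝒯 (.stem s z') a ∨ GDom.le c 𝒯 a (.stem s z') := by
  cases h with
  | stem_stem _ h => exact (le_total _ _).imp (.stem_stem s) (.stem_stem s)
  | _ => exact Or.inl (by constructor)

theorem GDom.label_of_inc {s : SuccSeq κ} {z : ℤ} {a b : GDom c 𝒯}
    (ha : GDom.le c 𝒯 (.stem s z) a) (hb : GDom.le c 𝒯 (.stem s z) b)
    (hab : Inc (GDom.le c 𝒯) a b) : a.IsLabel := by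
  cases ha with
  | stem_stem _ h => exact absurd (stem_le_or hb) (not_or.2 hab)
  | _ => trivial

/-- The branching height is at most 2 at a label point and at most 3 at a stem point, since
incomparable points above a stem point lie in labels. -/
theorem GDom.node_of_branches (h𝒯 : ∀ p ∈ 𝒯, p.1.len = p.2.len) {a : GDom c 𝒯}
    (h : Branches (GDom.le c 𝒯) 4 a) : ∃ s, a = .node s := by
  cases a with
  | node s => exact ⟨s, rfl⟩
  | stem s z =>
    obtain ⟨b, b', h1, h2, h3, h4, -⟩ := h
    exact absurd h4 (not_branches_three h𝒯 (label_of_inc h1 h2 h3))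
  | _ => exact absurd (h.mono (by norm_num)) (not_branches_three h𝒯 trivial)

theorem SuccSeq.exists_extensions (hκ : IsWeaklyCompact κ) (s : SuccSeq κ) :
    ∃ t t' : SuccSeq κ, s.1.IsPrefix t.1 ∧ s.1.IsPrefix t'.1 ∧ ¬ t.1.IsPrefix t'.1 ∧
      ¬ t'.1.IsPrefix t.1 := by
  have h1 : (1 : Ordinal.{u}) < κ.ord := by
    have := hκ.succ_lt hκ.pos
    rwa [zero_add] at this
  let e : Ordinal.{u} → TSeq.{u} Ordinal.{u} := fun a =>
    ⟨s.1.len + 1, fun β => if h : β.1 < s.1.len then s.1.val ⟨β.1, h⟩ else a⟩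
  have he : ∀ a < κ.ord, e a ∈ SuccSeq κ := fun a ha =>
    ⟨⟨hκ.succ_lt s.2.1.1, fun β => by
      by_cases h : β.1 < s.1.len
      · simpa [e, h] using s.2.1.2 _
      · simpa [e, h] using ha⟩, _, rfl⟩
  have hp : ∀ a, s.1.IsPrefix (e a) := fun a => by
    refine TSeq.ext_val (by simp [e, TSeq.restrict]) fun β h h' => ?_
    have : β < s.1.len := h
    simp [e, TSeq.restrict, this]
  have hlast : ∀ a a', (e a).IsPrefix (e a') → a = a' := fun a a' h => by
    have h2 := h.eq_of_len_le le_rfl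
    have h3 := TSeq.val_congr h2 (β := s.1.len) (Order.lt_add_one_iff.2 le_rfl)
      (Order.lt_add_one_iff.2 le_rfl)
    simpa [e] using h3
  exact ⟨⟨e 0, he 0 hκ.pos⟩, ⟨e 1, he 1 h1⟩, hp 0, hp 1,
    fun h => zero_ne_one (hlast _ _ h), fun h => zero_ne_one (hlast _ _ h).symm⟩

theorem GDom.branches_node (hκ : IsWeaklyCompact κ) (n : ℕ) (s : SuccSeq κ) :
    Branches (GDom.le c 𝒯) n (.node s) := by
  induction n generalizing s with
  | zero => trivial
  | succ n ih =>
    obtain ⟨t, t', h1, h2, h3, h4⟩ := SuccSeq.exists_extensions hκ s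
    exact ⟨.node t, .node t', .node_node h1, .node_node h2,
      ⟨fun h => h3 (by cases h; assumption), fun h => h4 (by cases h; assumption)⟩, ih t, ih t'⟩

theorem zero_lt_theta (i γ α : Ordinal.{u}) : 0 < theta i γ α :=
  zero_lt_one.trans_le ((le_self_add).trans le_self_add)

theorem GDom.inc_labI_labII {s : SuccSeq κ} (x y) :
    Inc (GDom.le c 𝒯) (.labI s x) (.labII s y) :=
  ⟨fun h => (by cases h), fun h => (by cases h)⟩

theorem GDom.inc_labIII_labII {s : SuccSeq κ} (p x y) :
    Inc (GDom.le c 𝒯) (.labIII s p x) (.labII s y) :=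
  ⟨fun h => (by cases h), fun h => (by cases h)⟩

/-- As L_γ has no greatest element, there is a larger base point above α, and it is incomparable
with the twig at α. -/
theorem GDom.branches_base (s : SuccSeq κ) (α : Below κ) :
    Branches (GDom.le c 𝒯) 1 (.labI s (.base α)) := by
  obtain ⟨β, hβ, hne⟩ := c.L_noMax _ (SuccSeq.lastIndex_lt s).2 α
  refine Branches.map (embI c 𝒯 s) (a := .base α) ⟨.base β, .twig α ⟨0, zero_lt_theta _ _ _⟩,
    .base_base hβ, .base_twig _ ((linOrd_L c s).1 α), ⟨fun h => ?_, fun h => by cases h⟩,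
    trivial, trivial⟩
  cases h with
  | base_twig _ h => exact hne ((linOrd_L c s).2.2.1 _ _ hβ h)

theorem GDom.triples_star (s : SuccSeq κ) (n : ℕ) :
    Triples (GDom.le c 𝒯) (.labII s (.star n)) :=
  Triples.map (embII c 𝒯 s) (Broom.triples_of_low _ (x := .star n) trivial)

theorem GDom.branches_low (s : SuccSeq κ) (p : {p : TSeq.{u} Bool // (p, s.1) ∈ 𝒯})
    {x : DomIII p.1} (hx : x.Low) : Branches (GDom.le c 𝒯) 2 (.labIII s p x) :=
  Branches.map (embIII c s p) (Broom.branches_of_low (k := 0) _ hx)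

theorem GDom.exists_node_eq (hκ : IsWeaklyCompact κ) (h𝒯' : ∀ p ∈ 𝒯', p.1.len = p.2.len)
    (f : GDom.le c 𝒯 ↪r GDom.le c 𝒯') (s : SuccSeq κ) : ∃ t, f (.node s) = .node t :=
  node_of_branches h𝒯' ((branches_node hκ 4 s).map f)

/-- Points of a stem are not mapped into labels. -/
theorem GDom.not_isLabel_stem (hκ : IsWeaklyCompact κ) (h𝒯' : ∀ p ∈ 𝒯', p.1.len = p.2.len)
    (f : GDom.le c 𝒯 ↪r GDom.le c 𝒯') (s : SuccSeq κ) (z : ℤ) : ¬ (f (.stem s z)).IsLabel := by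
  intro hl
  have h0 : (0 : Ordinal.{u}) < κ.ord := hκ.pos
  -- Above a stem point lie incomparable points of types I and II, the latter of branching height 2.
  -- Type I has no point of that height, and in a broom such a point is comparable with all others;
  -- everything above a label point stays in its label.
  have h1 : GDom.le c 𝒯' (f (.stem s z)) (f (.labI s (.base ⟨0, h0⟩))) :=
    f.map_rel_iff.2 (.stem_labI _ _ _)
  have h2 : GDom.le c 𝒯' (f (.stem s z)) (f (.labII s (.star 0))) :=
    f.map_rel_iff.2 (.stem_labII _ _ _)
  have h3 := (inc_labI_labII (c := c) (𝒯 := 𝒯) (s := s) (.base ⟨0, h0⟩) (.star 0)).map f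
  have h4 := (triples_star (c := c) (𝒯 := 𝒯) s 0).branches.map f
  cases ha : f (.stem s z) with
  | labI t x =>
    rw [ha] at h2
    cases hb : f (.labII s (.star 0)) with
    | labI t' y =>
      rw [hb] at h4
      exact DomI.not_branches_two (linOrd_L c t') y (branches_labI h4)
    | _ => rw [hb] at h2; cases h2
  | labII t x =>
    rw [ha] at h1 h2
    generalize f (.labII s (.star 0)) = b at h2 h3 h4
    generalize f (.labI s (.base ⟨0, h0⟩)) = a at h1 h3
    cases h1
    cases h2
    have := Broom.low_of_branches linOrd_le (branches_labII h4)
    exact not_or.2 (inc_labII h3) ((Broom.comparable linOrd_le this _).symm)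
  | labIII t p x =>
    rw [ha] at h1 h2
    generalize f (.labII s (.star 0)) = b at h2 h3 h4
    generalize f (.labI s (.base ⟨0, h0⟩)) = a at h1 h3
    cases h1
    cases h2
    have hr := linOrd_Lstar c h𝒯' t p
    have := Broom.low_of_branches hr (branches_labIII h4)
    exact not_or.2 (inc_labIII h3) ((Broom.comparable hr this _).symm)
  | _ => rw [ha] at hl; exact hl

/-- Lengths strictly decrease along a descending chain of nodes, so the infinite descent in a copy
of ℤ cannot be mapped into nodes. -/
theorem GDom.exists_stem_eq (hκ : IsWeaklyCompact κ) (h𝒯' : ∀ p ∈ 𝒯', p.1.len = p.2.len)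
    (f : GDom.le c 𝒯 ↪r GDom.le c 𝒯') (s : SuccSeq κ) (z : ℤ) :
    ∃ t z', f (.stem s z) = .stem t z' := by
  have key : ∀ (l : Ordinal.{u}) (t : SuccSeq κ), t.1.len = l → ∀ z,
      f (.stem s z) ≠ .node t := by
    intro l
    induction l using WellFoundedLT.induction with
    | _ l ih =>
      rintro t rfl z hz
      have h1 : GDom.le c 𝒯' (f (.stem s (z - 1))) (f (.stem s z)) :=
        f.map_rel_iff.2 (.stem_stem _ (by lia))
      rw [hz] at h1
      cases hz' : f (.stem s (z - 1)) with
      | node t' =>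
        rw [hz'] at h1
        cases h1 with
        | node_node h1 =>
          refine ih t'.1.len (lt_of_le_of_ne h1.len_le fun he => ?_) t' rfl _ hz'
          have : t' = t := Subtype.ext (h1.eq_of_len_le he.ge)
          rw [this, ← hz] at hz'
          have := f.injective hz'
          simp at this
      | _ => rw [hz'] at h1; cases h1
  cases hz : f (.stem s z) with
  | node t => exact absurd hz (key _ t rfl z)
  | stem t z' => exact ⟨t, z', rfl⟩
  | _ => exact absurd (by rw [hz]; trivial) (not_isLabel_stem hκ h𝒯' f s z)

/-- Among labels, only type II has three incomparable branching points above one point. -/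
theorem GDom.exists_labII_eq (h𝒯' : ∀ p ∈ 𝒯', p.1.len = p.2.len) (hκ : IsWeaklyCompact κ)
    {f : GDom.le c 𝒯 ↪r GDom.le c 𝒯'} {s t : SuccSeq κ} {z z' : ℤ}
    (hf : f (.stem s z) = .stem t z') :
    ∃ y : DomII c t.1, y.Low ∧ f (.labII s (.star 0)) = .labII t y := by
  have h0 : (0 : Ordinal.{u}) < κ.ord := hκ.pos
  have h1 : GDom.le c 𝒯' (f (.stem s z)) (f (.labI s (.base ⟨0, h0⟩))) :=
    f.map_rel_iff.2 (.stem_labI _ _ _)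
  have h2 : GDom.le c 𝒯' (f (.stem s z)) (f (.labII s (.star 0))) :=
    f.map_rel_iff.2 (.stem_labII _ _ _)
  have h3 := (inc_labI_labII (c := c) (𝒯 := 𝒯) (s := s) (.base ⟨0, h0⟩) (.star 0)).map f
  have h4 := (triples_star (c := c) (𝒯 := 𝒯) s 0).map f
  rw [hf] at h1 h2
  have h5 := label_of_inc h2 h1 ⟨h3.2, h3.1⟩
  generalize f (.labII s (.star 0)) = b at h2 h4 h5
  cases h2 with
  | stem_stem => exact h5.elim
  | stem_labI _ _ x => exact absurd (branches_labI h4.branches) (DomI.not_branches_two (linOrd_L c t) x)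
  | stem_labII _ _ x =>
    exact ⟨x, Broom.low_of_branches linOrd_le (branches_labII h4.branches), rfl⟩
  | stem_labIII _ _ p x =>
    exact absurd (h4.of_upper (embIII c t p) (a := x) (fun a e h => by cases h; exact ⟨_, rfl⟩))
      (Broom.not_triples (linOrd_Lstar c h𝒯' t p) x)

/-- A branching point that is incomparable to the image of a label of type II is not in a label of
type II. -/
theorem GDom.labI_or_labIII {t : SuccSeq κ} {z' : ℤ} {a : GDom c 𝒯'} {y : DomII c t.1}
    (hy : y.Low) (h1 : GDom.le c 𝒯' (.stem t z') a) (h2 : Inc (GDom.le c 𝒯') a (.labII t y)) :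
    (∃ x, a = .labI t x) ∨ ∃ p x, a = .labIII t p x := by
  cases h1 with
  | stem_stem _ h => exact absurd (stem_le_or (.stem_labII t z' y)) (not_or.2 h2)
  | stem_labI _ _ x => exact Or.inl ⟨x, rfl⟩
  | stem_labII _ _ x =>
    exact absurd (Broom.comparable linOrd_le hy x).symm (not_or.2 (inc_labII h2))
  | stem_labIII _ _ p x => exact Or.inr ⟨p, x, rfl⟩

/-- Incomparability with the image of a point of type II leaves types I and III. Type III is
excluded because no broom contains two comparable branching points that are both incomparable with a
third point. -/
theorem GDom.exists_labI_eq (h𝒯' : ∀ p ∈ 𝒯', p.1.len = p.2.len) (hκ : IsWeaklyCompact κ)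
    {f : GDom.le c 𝒯 ↪r GDom.le c 𝒯'} {s t : SuccSeq κ} {z z' : ℤ}
    (hf : f (.stem s z) = .stem t z') (α : Below κ) :
    ∃ β, f (.labI s (.base α)) = .labI t (.base β) := by
  obtain ⟨y, hy, hfy⟩ := exists_labII_eq h𝒯' hκ hf
  have hst : ∀ x, GDom.le c 𝒯' (.stem t z') (f (.labI s x)) := fun x => by
    rw [← hf]
    exact f.map_rel_iff.2 (.stem_labI _ _ _)
  have hinc : ∀ x, Inc (GDom.le c 𝒯') (f (.labI s x)) (.labII t y) := fun x => by
    rw [← hfy]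
    exact (inc_labI_labII _ _).map f
  have hbr := fun α => (branches_base (c := c) (𝒯 := 𝒯) s α).map f
  rcases labI_or_labIII hy (hst (.base α)) (hinc (.base α)) with ⟨x, hx⟩ | ⟨p, x, hx⟩
  · have := hbr α
    rw [hx] at this
    obtain ⟨β, rfl⟩ := DomI.eq_base_of_branches (branches_labI this)
    exact ⟨β, hx⟩
  · exfalso
    have hr := linOrd_L c s
    have hr' := linOrd_Lstar c h𝒯' t p
    have up : ∀ x', DomI.le (c.L s.1.lastIndex) (.base α) x' →
        ∃ y, f (.labI s x') = .labIII t p y := fun x' hx' => by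
      have := f.map_rel_iff.2 (GDom.le.labI_labI (c := c) (𝒯 := 𝒯) s hx')
      rw [hx] at this
      generalize f (.labI s x') = b at this
      cases this
      exact ⟨_, rfl⟩
    -- The base points α₁ < α₂ above α, with the twig at α beside them, form the forbidden comb.
    obtain ⟨α₁, h₁, hne₁⟩ := c.L_noMax _ (SuccSeq.lastIndex_lt s).2 α
    obtain ⟨α₂, h₂, hne₂⟩ := c.L_noMax _ (SuccSeq.lastIndex_lt s).2 α₁
    have hα₂ : α ≠ α₂ := by
      rintro rfl
      exact hne₁ (hr.2.2.1 _ _ h₁ h₂)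
    let w : DomI κ s.1.lastIndex := .twig α ⟨0, zero_lt_theta _ _ _⟩
    obtain ⟨y₁, hy₁⟩ := up (.base α₁) (.base_base h₁)
    obtain ⟨y₂, hy₂⟩ := up (.base α₂) (.base_base (hr.2.1 _ _ _ h₁ h₂))
    obtain ⟨y₃, hy₃⟩ := up w (.base_twig _ (hr.1 _))
    have hw : ∀ β, c.L s.1.lastIndex α β → α ≠ β →
        Inc (GDom.le c 𝒯) (.labI s (.base β)) (.labI s w) := fun β hβ hne => by
      change Inc _ _ (GDom.labI s (.twig α ⟨0, zero_lt_theta _ _ _⟩))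
      constructor
      · intro h
        cases h with
        | labI_labI _ h => cases h with | base_twig _ h => exact hne (hr.2.2.1 _ _ hβ h)
      · intro h
        cases h with
        | labI_labI _ h => cases h
    have hb₁ := hbr α₁
    have hb₂ := hbr α₂
    have hw₁ := (hw α₁ h₁ hne₁).map f
    have hw₂ := (hw α₂ (hr.2.1 _ _ _ h₁ h₂) hα₂).map f
    have h₁₂ := f.map_rel_iff.2
      (GDom.le.labI_labI (c := c) (𝒯 := 𝒯) s (DomI.le.base_base (γ := s.1.lastIndex) h₂))
    rw [hy₁] at hb₁ hw₁ h₁₂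
    rw [hy₂] at hb₂ hw₂ h₁₂
    rw [hy₃] at hw₁ hw₂
    have heq := Broom.not_comb hr' (branches_labIII hb₁) (branches_labIII hb₂)
      (inc_labIII hw₁) (inc_labIII hw₂) (by cases h₁₂; assumption)
    rw [← heq, ← hy₁] at hy₂
    have := f.injective hy₂
    simp only [GDom.labI.injEq, heq_eq_eq, DomI.base.injEq, true_and] at this
    exact hne₂ this.symm

/-- On base points of type I the map is an embedding of L_γ into L_γ', which exists only for γ = γ'.
-/
theorem GDom.len_eq (h𝒯' : ∀ p ∈ 𝒯', p.1.len = p.2.len) (hκ : IsWeaklyCompact κ)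
    {f : GDom.le c 𝒯 ↪r GDom.le c 𝒯'} {s t : SuccSeq κ} {z z' : ℤ}
    (hf : f (.stem s z) = .stem t z') : s.1.len = t.1.len := by
  choose g hg using exists_labI_eq h𝒯' hκ hf
  have hemb : Nonempty (c.L s.1.lastIndex ↪r c.L t.1.lastIndex) := by
    refine ⟨⟨⟨g, fun α β h => ?_⟩, fun {α β} => ?_⟩⟩
    · have : f (.labI s (.base α)) = f (.labI s (.base β)) := by rw [hg, hg, h]
      have := f.injective this
      simpa using this
    · have := f.map_rel_iff (a := .labI s (.base α)) (b := .labI s (.base β))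
      rw [hg, hg] at this
      constructor
      · intro h
        have := this.1 (.labI_labI t (.base_base h))
        cases this with
        | labI_labI _ h => cases h; assumption
      · intro h
        have := this.2 (.labI_labI s (.base_base h))
        cases this with
        | labI_labI _ h => cases h; assumption
  have hs := SuccSeq.lastIndex_lt s
  have ht := SuccSeq.lastIndex_lt t
  rw [hs.1, ht.1]
  by_contra hne
  exact (c.L_not_emb _ hs.2 _ ht.2 fun h => hne (by rw [h])).false hemb.some

/-- The linear part of a type III label has branching height 2 and is incomparable with the label of
type II, so its image lies in type III. Restricting to initial parts embeds L*_p into some L*_q with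
(q, t) present; lengths being equal, q = p. -/
theorem GDom.mem_of_embedding (h𝒯 : ∀ p ∈ 𝒯, p.1.len = p.2.len)
    (h𝒯' : ∀ p ∈ 𝒯', p.1.len = p.2.len) (hκ : IsWeaklyCompact κ)
    {f : GDom.le c 𝒯 ↪r GDom.le c 𝒯'} {s t : SuccSeq κ} {z z' : ℤ}
    (hf : f (.stem s z) = .stem t z') {p : TSeq.{u} Bool} (hp : (p, s.1) ∈ 𝒯) :
    (p, t.1) ∈ 𝒯' := by
  obtain ⟨y, hy, hfy⟩ := exists_labII_eq h𝒯' hκ hf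
  let P : {p : TSeq.{u} Bool // (p, s.1) ∈ 𝒯} := ⟨p, hp⟩
  have hr := linOrd_Lstar c h𝒯 s P
  have hbr := fun (x : DomIII P.1) (hx : x.Low) => (branches_low (c := c) s P hx).map f
  have himg : ∀ x : DomIII P.1, x.Low → ∃ q x', f (.labIII s P x) = .labIII t q x' := by
    intro x hx
    have h1 : GDom.le c 𝒯' (.stem t z') (f (.labIII s P x)) := by
      rw [← hf]
      exact f.map_rel_iff.2 (.stem_labIII _ _ _ _)
    have h2 : Inc (GDom.le c 𝒯') (f (.labIII s P x)) (.labII t y) := by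
      rw [← hfy]
      exact (inc_labIII_labII _ _ _).map f
    refine (labI_or_labIII hy h1 h2).resolve_left ?_
    rintro ⟨x', hx'⟩
    have := hbr x hx
    rw [hx'] at this
    exact DomI.not_branches_two (linOrd_L c t) x' (branches_labI this)
  obtain ⟨q, x₀, hx₀⟩ := himg (.star 0) trivial
  -- All points of the linear part are comparable with `star 0`, so their images share one label;
  -- other points receive a default value.
  have himg' : ∀ x : DomIII P.1, ∃ x', x.Low → f (.labIII s P x) = .labIII t q x' := by
    intro x
    by_cases hx : x.Low
    · obtain ⟨q', x', hx'⟩ := himg x hx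
      rcases Broom.comparable hr hx (.star 0) with h | h
      all_goals
        have := f.map_rel_iff.2 (GDom.le.labIII_labIII (c := c) (𝒯 := 𝒯) s P h)
        rw [hx', hx₀] at this
        cases this
        exact ⟨_, fun _ => hx'⟩
    · exact ⟨.star 0, fun h => absurd h hx⟩
  choose g hg using himg'
  have hemb : Nonempty (c.Lstar P.1 ↪r c.Lstar q.1) := by
    refine Broom.exists_init_embedding g (fun x x' hx hx' => ?_) hr fun x hx => ?_
    · have := f.map_rel_iff (a := .labIII s P x) (b := .labIII s P x')
      rw [hg x hx, hg x' hx'] at this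
      constructor
      · intro h
        have := this.1 (.labIII_labIII t q h)
        cases this
        assumption
      · intro h
        have := this.2 (.labIII_labIII s P h)
        cases this
        assumption
    · have := hbr x hx
      rw [hg x hx] at this
      exact Broom.low_of_branches (linOrd_Lstar c h𝒯' t q) (branches_labIII this)
  have hs := SuccSeq.lastIndex_lt s
  have hlen := len_eq h𝒯' hκ hf
  have heq : p = q.1 := by
    by_contra hne
    exact (c.Lstar_not_emb _ hs.2 p q.1 ((h𝒯 _ hp).trans hs.1)
      ((h𝒯' _ q.2).trans (hlen.symm.trans hs.1)) hne).false hemb.some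
  rw [heq]
  exact q.2

/-- The label of type I shows that the stem at s goes to a stem at some ψ s of the same length,
while the node s goes to φ s ⊆ ψ s. Equality φ s = ψ s follows because φ cannot decrease lengths;
all information in the labels at ψ s then concerns φ s. -/
theorem exists_map_of_embedding (hκ : IsWeaklyCompact κ) (h𝒯 : ∀ p ∈ 𝒯, p.1.len = p.2.len)
    (h𝒯' : ∀ p ∈ 𝒯', p.1.len = p.2.len) (f : GDom.le c 𝒯 ↪r GDom.le c 𝒯') :
    ∃ φ : SuccSeq κ → SuccSeq κ, (∀ s, (φ s).1.len = s.1.len) ∧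
      (∀ s t, s.1.IsPrefix t.1 → (φ s).1.IsPrefix (φ t).1) ∧
      ∀ p s, (p, s.1) ∈ 𝒯 → (p, (φ s).1) ∈ 𝒯' := by
  choose φ hφ using GDom.exists_node_eq hκ h𝒯' f
  choose ψ z hψ using fun s => GDom.exists_stem_eq hκ h𝒯' f s 0
  have hpre : ∀ s t, (φ s).1.IsPrefix (φ t).1 ↔ s.1.IsPrefix t.1 := fun s t => by
    have := f.map_rel_iff (a := .node s) (b := .node t)
    rw [hφ, hφ] at this
    constructor
    · intro h
      have := this.1 (.node_node h)
      cases this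
      assumption
    · intro h
      have := this.2 (.node_node h)
      cases this
      assumption
  have hφψ : ∀ s, (φ s).1.IsPrefix (ψ s).1 := fun s => by
    have := f.map_rel_iff.2 (GDom.le.node_stem (c := c) (𝒯 := 𝒯) 0 (TSeq.IsPrefix.refl s.1))
    rw [hφ, hψ] at this
    cases this
    assumption
  have hlenψ : ∀ s, s.1.len = (ψ s).1.len := fun s => GDom.len_eq h𝒯' hκ (hψ s)
  -- Proper initial segments of s of successor length go to proper initial segments of φ s, so
  -- lengths cannot drop, by induction.
  have hle : ∀ (l : Ordinal.{u}) (s : SuccSeq κ), s.1.len = l → l ≤ (φ s).1.len := by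
    intro l
    induction l using WellFoundedLT.induction with
    | _ l ih =>
      rintro s rfl
      obtain ⟨hs, -⟩ := SuccSeq.lastIndex_lt s
      obtain ⟨ht, -⟩ := SuccSeq.lastIndex_lt (φ s)
      rw [hs, ht]
      refine add_le_add_left (le_of_forall_lt fun β hβ => ?_) 1
      have hβl : β + 1 < s.1.len := by
        rw [hs]
        exact (Order.add_one_le_iff.2 hβ).trans_lt (Order.lt_add_one_iff.2 le_rfl)
      let s' : SuccSeq κ := ⟨s.1.restrict (β + 1),
        ⟨(min_le_left _ _).trans_lt s.2.1.1, fun _ => s.2.1.2 _⟩, β, min_eq_right hβl.le⟩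
      have hs' : s'.1.len = β + 1 := min_eq_right hβl.le
      have hp : s'.1.IsPrefix s.1 := TSeq.restrict_isPrefix _ _
      have hp' := (hpre s' s).2 hp
      have h1 := ih _ hβl s' hs'
      have h2 : (φ s').1.len < (φ s).1.len := by
        refine lt_of_le_of_ne hp'.len_le fun he => ?_
        have h3 := hp'.eq_of_len_le he.ge
        have h4 := (hpre s s').1 (h3 ▸ TSeq.IsPrefix.refl _)
        exact absurd h4.len_le (not_le.2 (hs' ▸ hβl))
      rw [ht] at h2
      exact Order.add_one_le_iff.1 (h1.trans (Order.lt_add_one_iff.1 h2))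
  have heq : ∀ s, φ s = ψ s := fun s =>
    Subtype.ext ((hφψ s).eq_of_len_le ((hlenψ s).symm.trans_le (hle _ s rfl)))
  refine ⟨φ, fun s => ?_, fun s t h => (hpre s t).2 h, fun p s h => ?_⟩
  · rw [heq, ← hlenψ]
  · rw [heq]
    exact GDom.mem_of_embedding h𝒯 h𝒯' hκ (hψ s) h

/-- Transport of the points of a label of type I. -/
def DomI.cast {γ γ' : Ordinal.{u}} (h : γ = γ') (x : DomI κ γ) : DomI κ γ' := h ▸ x

theorem DomI.cast_le_iff {γ γ' : Ordinal.{u}} (h : γ = γ') (x y : DomI κ γ) :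
    DomI.le (c.L γ') (x.cast h) (y.cast h) ↔ DomI.le (c.L γ) x y := by
  subst h
  rfl

/-- The map between brooms induced by a map between the initial parts. -/
def Broom.map {B : Type v} {B' : Type w} {k : ℕ} (g : B → B') : Broom B k → Broom B' k
  | .init b => .init (g b)
  | .star n => .star n
  | .fork x => .fork x
  | .tip x i => .tip x i

theorem Broom.map_le_iff {B : Type v} {B' : Type w} {k : ℕ} {r : B → B → Prop}
    {q : B' → B' → Prop} {g : B → B'} (hg : ∀ b b', q (g b) (g b') ↔ r b b') (x y : Broom B k) :
    Broom.le q (x.map g) (y.map g) ↔ Broom.le r x y := by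
  constructor
  · intro h
    cases x <;> cases y <;> cases h <;> constructor
    · exact (hg _ _).1 ‹_›
    · assumption
  · intro h
    cases h <;> constructor
    · exact (hg _ _).2 ‹_›
    · assumption

theorem GDom.pos_eq {a b : GDom c 𝒯} (h : GDom.le c 𝒯 a b) (ha : ∀ s, a ≠ .node s) :
    a.pos = b.pos := by
  cases h with
  | node_node => exact absurd rfl (ha _)
  | node_stem => exact absurd rfl (ha _)
  | node_labI => exact absurd rfl (ha _)
  | node_labII => exact absurd rfl (ha _)
  | node_labIII => exact absurd rfl (ha _)
  | _ => rfl

theorem GDom.node_le_iff {s : SuccSeq κ} {a : GDom c 𝒯} :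
    GDom.le c 𝒯 (.node s) a ↔ s.1.IsPrefix a.pos.1 := by
  constructor
  · intro h
    cases h <;> assumption
  · intro h
    cases a <;> constructor <;> exact h

/-- The map between the trees induced by a map between the nodes. -/
def GDom.map (φ : SuccSeq κ → SuccSeq κ) (hli : ∀ s, s.1.lastIndex = (φ s).1.lastIndex)
    (hth : ∀ s, theta 1 s.1.lastIndex (c.num s.1) ≤ theta 1 (φ s).1.lastIndex (c.num (φ s).1))
    (hmem : ∀ p s, (p, s.1) ∈ 𝒯 → (p, (φ s).1) ∈ 𝒯') : GDom c 𝒯 → GDom c 𝒯'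
  | .node s => .node (φ s)
  | .stem s z => .stem (φ s) z
  | .labI s x => .labI (φ s) (x.cast (hli s))
  | .labII s x => .labII (φ s) (x.map (Set.inclusion (Set.Iio_subset_Iio (hth s))))
  | .labIII s p x => .labIII (φ s) ⟨p.1, hmem _ _ p.2⟩ x

section

variable {φ : SuccSeq κ → SuccSeq κ} {hli : ∀ s, s.1.lastIndex = (φ s).1.lastIndex}
  {hth : ∀ s, theta 1 s.1.lastIndex (c.num s.1) ≤ theta 1 (φ s).1.lastIndex (c.num (φ s).1)}
  {hmem : ∀ p s, (p, s.1) ∈ 𝒯 → (p, (φ s).1) ∈ 𝒯'}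

theorem GDom.map_pos (a : GDom c 𝒯) : (GDom.map φ hli hth hmem a).pos = φ a.pos := by
  cases a <;> rfl

theorem GDom.map_II_iff (s : SuccSeq κ) (x y : DomII c s.1) :
    Broom.le (fun b b' => b ≤ b') (x.map (Set.inclusion (Set.Iio_subset_Iio (hth s))))
      (y.map (Set.inclusion (Set.Iio_subset_Iio (hth s)))) ↔ Broom.le (fun b b' => b ≤ b') x y :=
  Broom.map_le_iff (fun _ _ => Iff.rfl) x y

theorem GDom.map_le (hpre : ∀ s t, (φ s).1.IsPrefix (φ t).1 ↔ s.1.IsPrefix t.1) {a b : GDom c 𝒯}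
    (h : GDom.le c 𝒯 a b) :
    GDom.le c 𝒯' (GDom.map φ hli hth hmem a) (GDom.map φ hli hth hmem b) := by
  cases h with
  | labI_labI s h => exact .labI_labI _ ((DomI.cast_le_iff _ _ _).2 h)
  | labII_labII s h => exact .labII_labII _ ((map_II_iff (hth := hth) _ _ _).2 h)
  | labIII_labIII s p h => exact .labIII_labIII _ _ h
  | stem_stem s h => exact .stem_stem _ h
  | stem_labI => exact .stem_labI _ _ _
  | stem_labII => exact .stem_labII _ _ _
  | stem_labIII => exact .stem_labIII _ _ _ _
  | _ => exact node_le_iff.2 (by rw [map_pos]; exact (hpre _ _).2 ‹_›)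

theorem GDom.le_of_map (hpre : ∀ s t, (φ s).1.IsPrefix (φ t).1 ↔ s.1.IsPrefix t.1)
    {a b : GDom c 𝒯}
    (h : GDom.le c 𝒯' (GDom.map φ hli hth hmem a) (GDom.map φ hli hth hmem b)) :
    GDom.le c 𝒯 a b := by
  have hinj : Function.Injective φ := fun s t h => Subtype.ext <|
    ((hpre s t).1 (h ▸ TSeq.IsPrefix.refl _)).antisymm ((hpre t s).1 (h ▸ TSeq.IsPrefix.refl _))
  by_cases ha : ∃ s, a = .node s
  · obtain ⟨s, rfl⟩ := ha
    rw [node_le_iff, ← hpre, ← map_pos (hli := hli) (hth := hth) (hmem := hmem)]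
    exact GDom.node_le_iff.1 h
  have hp := GDom.pos_eq h fun s h => by
    cases a
    · exact ha ⟨_, rfl⟩
    all_goals cases h
  rw [map_pos, map_pos] at hp
  replace hp := hinj hp
  cases a with
  | node s => exact absurd ⟨s, rfl⟩ ha
  | stem s z =>
    cases b with
    | node t => exact absurd h (fun h => by cases h)
    | stem t z' =>
      obtain rfl : s = t := hp
      exact .stem_stem _ (by cases h; assumption)
    | labI t x =>
      obtain rfl : s = t := hp
      exact .stem_labI _ _ _
    | labII t x =>
      obtain rfl : s = t := hp
      exact .stem_labII _ _ _
    | labIII t p x =>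
      obtain rfl : s = t := hp
      exact .stem_labIII _ _ _ _
  | labI s x =>
    cases b with
    | labI t y =>
      obtain rfl : s = t := hp
      exact .labI_labI _ ((DomI.cast_le_iff _ _ _).1 ((GDom.embI c 𝒯' _).map_rel_iff.1 h))
    | _ => exact absurd h (fun h => by cases h)
  | labII s x =>
    cases b with
    | labII t y =>
      obtain rfl : s = t := hp
      exact .labII_labII _ ((map_II_iff (hth := hth) _ _ _).1
        ((GDom.embII c 𝒯' _).map_rel_iff.1 h))
    | _ => exact absurd h (fun h => by cases h)
  | labIII s p x =>
    cases b with
    | labIII t q y =>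
      obtain rfl : s = t := hp
      obtain ⟨p, hp⟩ := p
      obtain ⟨q, hq⟩ := q
      obtain rfl : p = q := by cases h; rfl
      exact .labIII_labIII _ _
        ((GDom.embIII c (φ s) (𝒯 := 𝒯') ⟨p, hmem _ _ hp⟩).map_rel_iff.1 h)
    | _ => exact absurd h (fun h => by cases h)

/-- The embedding of the trees induced by an embedding between the nodes. -/
def GDom.mapEmb (hli : ∀ s, s.1.lastIndex = (φ s).1.lastIndex)
    (hth : ∀ s, theta 1 s.1.lastIndex (c.num s.1) ≤ theta 1 (φ s).1.lastIndex (c.num (φ s).1))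
    (hmem : ∀ p s, (p, s.1) ∈ 𝒯 → (p, (φ s).1) ∈ 𝒯') (h𝒯 : ∀ p ∈ 𝒯, p.1.len = p.2.len)
    (hpre : ∀ s t, (φ s).1.IsPrefix (φ t).1 ↔ s.1.IsPrefix t.1) :
    GDom.le c 𝒯 ↪r GDom.le c 𝒯' where
  toFun := GDom.map φ hli hth hmem
  inj' a b h := (GDom.isTree c h𝒯).2.2.1 _ _
    (GDom.le_of_map (hli := hli) (hth := hth) (hmem := hmem) hpre
      (by rw [h]; exact GDom.map_le hpre ((GDom.isTree c h𝒯).1 _)))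
    (GDom.le_of_map (hli := hli) (hth := hth) (hmem := hmem) hpre
      (by rw [h]; exact GDom.map_le hpre ((GDom.isTree c h𝒯).1 _)))
  map_rel_iff' := ⟨GDom.le_of_map (hli := hli) (hth := hth) (hmem := hmem) hpre,
    GDom.map_le (hli := hli) (hth := hth) (hmem := hmem) hpre⟩

end

/-- Stems and labels of types I and III are copied unchanged. In type II the ordinal below ω* may
grow, and `hnum` makes the old one an initial segment of the new one. -/
theorem exists_embedding_of_map (h𝒯 : ∀ p ∈ 𝒯, p.1.len = p.2.len)
    {φ : SuccSeq κ → SuccSeq κ} (hlen : ∀ s, (φ s).1.len = s.1.len)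
    (hpre : ∀ s t, (φ s).1.IsPrefix (φ t).1 ↔ s.1.IsPrefix t.1)
    (hnum : ∀ s, c.num s.1 ≤ c.num (φ s).1)
    (hmem : ∀ p s, (p, s.1) ∈ 𝒯 → (p, (φ s).1) ∈ 𝒯') :
    Nonempty (GDom.le c 𝒯 ↪r GDom.le c 𝒯') := by
  have hli : ∀ s, s.1.lastIndex = (φ s).1.lastIndex := fun s => by
    unfold TSeq.lastIndex
    rw [hlen]
  have hth : ∀ s, theta 1 s.1.lastIndex (c.num s.1) ≤ theta 1 (φ s).1.lastIndex (c.num (φ s).1) :=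
    fun s => by
      rw [← hli]
      exact theta_mono (hnum s)
  exact ⟨GDom.mapEmb hli hth hmem h𝒯 hpre⟩

end Embeddings
end GenTree
end

noncomputable section
namespace GenTree
open Ordinal Cardinal Set

/-! ### The reduction and its continuous realization on the domain κ -/

section Reduction

variable {κ : Cardinal.{u}} {T : Set Triple.{u}}

theorem sMap_len (hκ : IsWeaklyCompact κ) (hT : IsDSTTree κ T) (x : Cantor κ) :
    ∀ p ∈ sMap κ T x, p.1.len = p.2.len := by
  rintro ⟨p, s⟩ ⟨h, -⟩
  obtain ⟨n, h⟩ := mem_iUnion.1 h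
  rcases (mem_stage_iff n _ _ _).1 h with h | ⟨s', h, h'⟩
  · exact (congrArg (fun q : Triple.{u} => q.1.len) h).trans
      (congrArg (fun q : Triple.{u} => q.2.2.len) h).symm
  · exact (core_len hκ hT h').1.trans (congrArg TSeq.len h).symm

/-- The relation with tree `T` is reduced to embeddability between the trees `G`. -/
theorem proj_iff_embedding (hκ : IsWeaklyCompact κ) (hT : IsDSTTree κ T)
    (hrefl : ∀ x, proj κ T x x) (htrans : ∀ x y z, proj κ T x y → proj κ T y z → proj κ T x z)
    (c : LabelData κ) (x y : Cantor κ) : proj κ T x y ↔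
      Nonempty (GDom.le c (sMap κ T x) ↪r GDom.le c (sMap κ T y)) := by
  constructor
  · intro h
    obtain ⟨φ, h1, h2, h3, h4⟩ := exists_map_of_rel hκ hT c h
    exact exists_embedding_of_map (sMap_len hκ hT x) h1 h2 h3 h4
  · rintro ⟨f⟩
    obtain ⟨φ, h1, h2, h3⟩ := exists_map_of_embedding hκ (sMap_len hκ hT x) (sMap_len hκ hT y) f
    exact rel_of_map hκ hT hrefl htrans φ h1 h2 h3

theorem theta_lt (hκ : IsWeaklyCompact κ) {i γ α : Ordinal.{u}} (hi : i < κ.ord)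
    (hγ : γ < κ.ord) (hα : α < κ.ord) : theta i γ α < κ.ord := by
  have h1 : (1 : Ordinal.{u}) < κ.ord := by simpa using hκ.succ_lt hκ.pos
  have h2 : (2 : Ordinal.{u}) < κ.ord := by simpa [one_add_one_eq_two] using hκ.succ_lt h1
  exact isPrincipal_add_ord hκ.1.le (isPrincipal_add_ord hκ.1.le h1
    (isPrincipal_mul_ord hκ.1.le h2 (hes_lt_ord hκ.isRegular hγ hα))) hi

/-- Hilbert's hotel: a set `S` of full size can make room for any larger set. -/
theorem exists_hotel {U : Type v} {S : Set U} (hinf : ℵ₀ ≤ #U) (hS : #U ≤ #S) :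
    ∃ w g : U → U, ∀ D : Set U, S ⊆ D →
      ∃ e : U ≃ D, ∀ a, (w a ∈ D → (e a : U) = a) ∧ (w a ∉ D → (e a : U) = g a) := by
  classical
  -- Every v outside S receives a private track j(v, 0), j(v, 1), … inside S. If v is missing from
  -- D, then v and its track are moved one step forward by g; w a is the v on whose track a lies.
  -- Hence the image of a depends only on whether w a belongs to D.
  obtain ⟨j⟩ : Nonempty (((Sᶜ : Set U) × ℕ) ↪ S) := by
    rw [← le_def]
    refine (le_trans ?_ hS)
    rw [mk_prod, Cardinal.lift_id', mk_nat, Cardinal.lift_aleph0]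
    exact (mul_le_mul' (mk_set_le _) hinf).trans_eq (mul_eq_self hinf)
  have hj : ∀ p q, (j p : U) = j q → p = q := fun p q h => j.injective (Subtype.ext h)
  let w : U → U := fun a => if h : ∃ p, (j p : U) = a then h.choose.1 else a
  let g : U → U := fun a => if h : ∃ p, (j p : U) = a then j (h.choose.1, h.choose.2 + 1) else
    if h : a ∈ Sᶜ then j (⟨a, h⟩, 0) else a
  have hnot : ∀ a ∈ Sᶜ, ¬ ∃ p, (j p : U) = a := by
    rintro a ha ⟨p, rfl⟩
    exact ha (j p).2
  have hwj : ∀ p, w (j p) = p.1 := fun p => by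
    have h : ∃ q, (j q : U) = j p := ⟨p, rfl⟩
    simp only [w, dif_pos h]
    rw [hj _ _ h.choose_spec]
  have hgj : ∀ p, g (j p) = j (p.1, p.2 + 1) := fun p => by
    have h : ∃ q, (j q : U) = j p := ⟨p, rfl⟩
    simp only [g, dif_pos h]
    rw [hj _ _ h.choose_spec]
  have hw : ∀ a, (¬ ∃ p, (j p : U) = a) → w a = a := fun a h => by simp only [w, dif_neg h]
  have hg : ∀ a (h : a ∈ Sᶜ), g a = j (⟨a, h⟩, 0) := fun a h => by
    simp only [g, dif_neg (hnot a h), dif_pos h]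
  refine ⟨w, g, fun D hD => ?_⟩
  let f : U → U := fun a => if w a ∈ D then a else g a
  let back : (Sᶜ : Set U) → ℕ → U := fun v n => n.casesOn (v : U) fun n => j (v, n)
  let f' : U → U := fun a => if w a ∈ D then a else
    if h : ∃ p, (j p : U) = a then back h.choose.1 h.choose.2 else a
  have hf1 : ∀ a, w a ∈ D → f a = a := fun a h => if_pos h
  have hf2 : ∀ a, w a ∉ D → f a = g a := fun a h => if_neg h
  have hf'1 : ∀ a, w a ∈ D → f' a = a := fun a h => if_pos h
  have hf'2 : ∀ p, (p.1 : U) ∉ D → f' (j p) = back p.1 p.2 := fun p h => by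
    have h' : ∃ q, (j q : U) = j p := ⟨p, rfl⟩
    simp only [f', hwj, if_neg h, dif_pos h']
    rw [hj _ _ h'.choose_spec]
  have hcases : ∀ a : U, (∃ p, a = j p) ∨ (∃ _ : a ∈ Sᶜ, w a = a) ∨ a ∈ D ∧ w a = a := by
    intro a
    by_cases h : ∃ p, (j p : U) = a
    · obtain ⟨p, hp⟩ := h
      exact Or.inl ⟨p, hp.symm⟩
    · by_cases ha : a ∈ Sᶜ
      exacts [Or.inr (Or.inl ⟨ha, hw _ h⟩), Or.inr (Or.inr ⟨hD (not_not.1 ha), hw _ h⟩)]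
  have hjD : ∀ p, (j p : U) ∈ D := fun p => hD (j p).2
  have hmaps : ∀ a, f a ∈ D := by
    intro a
    rcases hcases a with ⟨p, rfl⟩ | ⟨h, h'⟩ | ⟨h, h'⟩
    · by_cases hp : w (j p) ∈ D
      · rw [hf1 _ hp]; exact hjD p
      · rw [hf2 _ hp, hgj]; exact hjD _
    · by_cases hp : w a ∈ D
      · rw [hf1 _ hp, ← h']; exact hp
      · rw [hf2 _ hp, hg _ h]; exact hjD _
    · rw [hf1 _ (h'.symm ▸ h)]; exact h
  refine ⟨⟨fun a => ⟨f a, hmaps a⟩, fun d => f' d, fun a => ?_, fun d => Subtype.ext ?_⟩,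
    fun a => ⟨hf1 a, hf2 a⟩⟩
  · change f' (f a) = a
    by_cases hp : w a ∈ D
    · rw [hf1 _ hp, hf'1 _ hp]
    rw [hf2 _ hp]
    rcases hcases a with ⟨p, rfl⟩ | ⟨h, h'⟩ | ⟨h, h'⟩
    · rw [hwj] at hp
      rw [hgj, hf'2 (p.1, p.2 + 1) hp]
    · rw [h'] at hp
      rw [hg _ h]
      exact hf'2 (⟨a, h⟩, 0) hp
    · exact absurd (h'.symm ▸ h) hp
  · change f (f' d) = d
    obtain ⟨d, hd⟩ := d
    change f (f' d) = d
    by_cases hp : w d ∈ D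
    · rw [hf'1 _ hp, hf1 _ hp]
    rcases hcases d with ⟨⟨v, n⟩, rfl⟩ | ⟨h, h'⟩ | ⟨h, h'⟩
    · rw [hwj] at hp
      rw [hf'2 _ hp]
      cases n with
      | zero =>
        change f v = _
        rw [hf2 _ (by rwa [hw _ (hnot _ v.2)]), hg _ v.2]
      | succ n =>
        change f (j (v, n)) = _
        rw [hf2 _ (by rwa [hwj]), hgj]
    · exact absurd (h'.symm ▸ hd) hp
    · exact absurd (h'.symm ▸ hd) hp

/-- All pairs of sequences of the same length. -/
def allPairs : Set (TSeq.{u} Bool × TSeq.{u} Ordinal.{u}) := {p | p.1.len = p.2.len}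

section

variable (c : LabelData κ) {𝒯 𝒯' : Set (TSeq.{u} Bool × TSeq.{u} Ordinal.{u})}

/-- The inclusion between the trees belonging to different sets of pairs. -/
def GDom.incl (h𝒯 : ∀ p ∈ 𝒯, p.1.len = p.2.len) (h : 𝒯 ⊆ 𝒯') : GDom.le c 𝒯 ↪r GDom.le c 𝒯' :=
  GDom.mapEmb (φ := id) (fun _ => rfl) (fun _ => le_rfl) (fun _ _ hp => h hp) h𝒯
    fun _ _ => Iff.rfl

theorem GDom.mem_range_incl (h𝒯 : ∀ p ∈ 𝒯, p.1.len = p.2.len) (h : 𝒯 ⊆ 𝒯') {a : GDom c 𝒯'} :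
    a ∈ range (GDom.incl c h𝒯 h) ↔ ∀ s p x, a = .labIII s p x → (p.1, s.1) ∈ 𝒯 := by
  constructor
  · rintro ⟨b, rfl⟩ s p x hb
    cases b with
    | labIII t q y =>
      cases hb
      exact q.2
    | _ => cases hb
  · intro ha
    cases a with
    | node s => exact ⟨.node s, rfl⟩
    | stem s z => exact ⟨.stem s z, rfl⟩
    | labI s x => exact ⟨.labI s x, rfl⟩
    | labII s x =>
      refine ⟨.labII s x, ?_⟩
      cases x <;> rfl
    | labIII s p x => exact ⟨.labIII s ⟨p.1, ha s p x rfl⟩ x, rfl⟩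

theorem IsWeaklyCompact.mk_sigma_le' (hκ : IsWeaklyCompact κ) {ι : Type (u + 1)}
    {X : ι → Type (u + 1)} (hι : #ι ≤ Cardinal.lift.{u + 1} κ)
    (hX : ∀ i, #(X i) ≤ Cardinal.lift.{u + 1} κ) : #(Σ i, X i) ≤ Cardinal.lift.{u + 1} κ := by
  rw [mk_sigma]
  refine (sum_le_sum _ _ hX).trans ?_
  rw [sum_const']
  exact (mul_le_mul' hι le_rfl).trans_eq (mul_eq_self hκ.aleph0_lt_lift.le)

theorem IsWeaklyCompact.mk_sum_le (hκ : IsWeaklyCompact κ) {X Y : Type (u + 1)}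
    (hX : #X ≤ Cardinal.lift.{u + 1} κ) (hY : #Y ≤ Cardinal.lift.{u + 1} κ) :
    #(X ⊕ Y) ≤ Cardinal.lift.{u + 1} κ := by
  rw [← add_def]
  exact (add_le_add hX hY).trans_eq (add_eq_self hκ.aleph0_lt_lift.le)

theorem IsWeaklyCompact.mk_countable_le (hκ : IsWeaklyCompact κ) {X : Type (u + 1)} [Countable X] :
    #X ≤ Cardinal.lift.{u + 1} κ :=
  mk_le_aleph0.trans hκ.aleph0_lt_lift.le

theorem mk_Iio_le {α : Ordinal.{u}} (hα : α < κ.ord) : #(Set.Iio α) ≤ Cardinal.lift.{u + 1} κ := by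
  rw [Cardinal.mk_Iio_ordinal, Cardinal.lift_le]
  exact (lt_ord.1 hα).le

theorem Broom.mk_le (hκ : IsWeaklyCompact κ) {B : Type (u + 1)} {k : ℕ}
    (hB : #B ≤ Cardinal.lift.{u + 1} κ) : #(Broom B k) ≤ Cardinal.lift.{u + 1} κ := by
  refine (mk_le_of_surjective (α := B ⊕ ULift.{u + 1} (ℕ ⊕ Fin k ⊕ Fin k × Bool))
    (f := fun p => match p with
      | .inl b => .init b
      | .inr ⟨.inl n⟩ => .star n
      | .inr ⟨.inr (.inl x)⟩ => .fork x
      | .inr ⟨.inr (.inr (x, i))⟩ => .tip x i) ?_).trans (hκ.mk_sum_le hB hκ.mk_countable_le)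
  rintro (b | n | x | ⟨x, i⟩)
  exacts [⟨.inl b, rfl⟩, ⟨.inr ⟨.inl n⟩, rfl⟩, ⟨.inr ⟨.inr (.inl x)⟩, rfl⟩,
    ⟨.inr ⟨.inr (.inr (x, i))⟩, rfl⟩]

theorem DomI.mk_le (hκ : IsWeaklyCompact κ) {γ : Ordinal.{u}} (hγ : γ < κ.ord) :
    #(DomI κ γ) ≤ Cardinal.lift.{u + 1} κ := by
  refine (mk_le_of_surjective (α := Below κ ⊕ Σ α : Below κ, Set.Iio (theta 0 γ α.1))
    (f := fun p => match p with
      | .inl b => .base b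
      | .inr ⟨α, β⟩ => .twig α β) ?_).trans (hκ.mk_sum_le (mk_below κ).le
        (hκ.mk_sigma_le fun α => mk_Iio_le (theta_lt hκ hκ.pos hγ α.2)))
  rintro (b | ⟨α, β⟩)
  exacts [⟨.inl b, rfl⟩, ⟨.inr ⟨α, β⟩, rfl⟩]

theorem GDom.mk_le (hκ : IsWeaklyCompact κ) (h𝒯 : ∀ p ∈ 𝒯, p.1.len = p.2.len) :
    #(GDom c 𝒯) ≤ Cardinal.lift.{u + 1} κ := by
  have hs := (mk_succSeq hκ).le
  have h1 : (1 : Ordinal.{u}) < κ.ord := by simpa using hκ.succ_lt hκ.pos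
  refine (mk_le_of_surjective (α := SuccSeq κ ⊕ (Σ _ : SuccSeq κ, ULift.{u + 1} ℤ) ⊕
    (Σ s : SuccSeq κ, DomI κ s.1.lastIndex) ⊕ (Σ s : SuccSeq κ, DomII c s.1) ⊕
    (Σ s : SuccSeq κ, Σ p : {p : TSeq.{u} Bool // (p, s.1) ∈ 𝒯}, DomIII p.1))
    (f := fun p => match p with
      | .inl s => .node s
      | .inr (.inl ⟨s, ⟨z⟩⟩) => .stem s z
      | .inr (.inr (.inl ⟨s, x⟩)) => .labI s x
      | .inr (.inr (.inr (.inl ⟨s, x⟩))) => .labII s x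
      | .inr (.inr (.inr (.inr ⟨s, p, x⟩))) => .labIII s p x) ?_).trans
    (hκ.mk_sum_le hs (hκ.mk_sum_le (hκ.mk_sigma_le' hs fun _ => hκ.mk_countable_le)
      (hκ.mk_sum_le (hκ.mk_sigma_le' hs fun s => DomI.mk_le hκ (SuccSeq.lastIndex_lt s).2)
        (hκ.mk_sum_le (hκ.mk_sigma_le' hs fun s => Broom.mk_le hκ (mk_Iio_le ?_))
          (hκ.mk_sigma_le' hs fun s => hκ.mk_sigma_le' ?_ fun p => Broom.mk_le hκ ?_)))))
  · rintro (s | ⟨s, z⟩ | ⟨s, x⟩ | ⟨s, x⟩ | ⟨s, p, x⟩)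
    exacts [⟨.inl s, rfl⟩, ⟨.inr (.inl ⟨s, ⟨z⟩⟩), rfl⟩, ⟨.inr (.inr (.inl ⟨s, x⟩)), rfl⟩,
      ⟨.inr (.inr (.inr (.inl ⟨s, x⟩))), rfl⟩, ⟨.inr (.inr (.inr (.inr ⟨s, p, x⟩))), rfl⟩]
  · obtain ⟨h2, h3⟩ := SuccSeq.lastIndex_lt s
    exact theta_lt hκ h1 h3 ((c.num_bijOn _ h3).mapsTo ⟨s.2.1, h2⟩)
  · refine (mk_le_mk_of_subset (t := {p : TSeq.{u} Bool | p.len < κ.ord}) ?_).trans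
      (mk_boolSeq_le hκ)
    intro p hp
    exact (h𝒯 _ hp).trans_lt s.2.1.1
  · obtain ⟨h2, h3⟩ := SuccSeq.lastIndex_lt s
    rw [TSeq.lastIndex_eq ((h𝒯 _ p.2).trans h2), mk_below, Cardinal.lift_le]
    exact (mu_lt hκ h3).le

end

theorem isOpen_of_local {A : Type w} {U : Set (Below κ → A)}
    (h : ∀ x ∈ U, ∃ α : Below κ, ∀ y, (∀ β < α, y β = x β) → y ∈ U) :
    @IsOpen _ (boundedSeqTopology κ A) U := by
  choose α hα using h
  let := boundedSeqTopology κ A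
  have : U = ⋃ x : U, {y | ∀ β, β < α x x.2 → y β = x.1 β} := by
    ext y
    simp only [mem_iUnion]
    exact ⟨fun hy => ⟨⟨y, hy⟩, fun _ _ => rfl⟩, fun ⟨x, hy⟩ => hα x x.2 y hy⟩
  rw [this]
  exact isOpen_iUnion fun x => TopologicalSpace.isOpen_generateFrom_of_mem ⟨_, _, rfl⟩

/-- The trees `G` belonging to points of `2^κ` can be realized with domain `κ` in a continuous
way. -/
theorem exists_continuous_map (hκ : IsWeaklyCompact κ) (hT : IsDSTTree κ T) (c : LabelData κ) :
    ∃ f : Cantor κ → Trees κ, Continuous f ∧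
      ∀ x, Nonempty ((f x).1.rel ≃r GDom.le c (sMap κ T x)) := by
  classical
  have hall : ∀ p ∈ allPairs.{u}, p.1.len = p.2.len := fun p hp => hp
  have hempty : ∀ p ∈ (∅ : Set (TSeq.{u} Bool × TSeq.{u} Ordinal.{u})), p.1.len = p.2.len :=
    fun p hp => hp.elim
  have hlen := sMap_len hκ hT
  have hsub : ∀ x, sMap κ T x ⊆ allPairs := hlen
  -- All the trees in question lie inside the one with every possible label of type III, and contain
  -- the part S without such labels, which has size κ through its nodes.
  set U := GDom c allPairs.{u} with hU
  let S : Set U := range (GDom.incl c hempty (empty_subset allPairs))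
  let D : Cantor κ → Set U := fun x => range (GDom.incl c (hlen x) (hsub x))
  have hS : Cardinal.lift.{u + 1} κ ≤ #S := by
    rw [← mk_succSeq hκ]
    refine mk_le_of_injective (f := fun s => (⟨.node s, .node s, rfl⟩ : S)) fun s t h => ?_
    have := congrArg Subtype.val h
    cases this
    rfl
  have hUcard : #U = Cardinal.lift.{u + 1} κ :=
    (GDom.mk_le c hκ hall).antisymm (hS.trans (mk_set_le _))
  obtain ⟨e₀⟩ : Nonempty (Below κ ≃ U) := Cardinal.eq.1 ((mk_below κ).trans hUcard.symm)
  obtain ⟨w, g, hwg⟩ := exists_hotel (S := S) (hUcard ▸ hκ.aleph0_lt_lift.le) (hUcard ▸ hS)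
  have hSD : ∀ x, S ⊆ D x := fun x a ha =>
    (GDom.mem_range_incl c _ _).2 fun s p y h => ((GDom.mem_range_incl c _ _).1 ha s p y h).elim
  choose e he1 using fun x => hwg (D x) (hSD x)
  -- Presence of the label for (p, s) is decided by x below the length of p. Thus the position of
  -- each point depends on a bounded part of x, which is the source of continuity.
  have hloc : ∀ a, ∃ α : Below κ, ∀ x y : Cantor κ, (∀ β < α, y β = x β) →
      (w a ∈ D x ↔ w a ∈ D y) := by
    intro a
    by_cases ha : ∃ s p z, w a = .labIII s p z
    · obtain ⟨s, p, z, ha⟩ := ha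
      have hp : p.1.len < κ.ord := (hall _ p.2).trans_lt s.2.1.1
      refine ⟨⟨p.1.len, hp⟩, fun x y hxy => ?_⟩
      have hofFun : TSeq.ofFun (show Below κ → Bool from y) p.1.len =
          TSeq.ofFun (show Below κ → Bool from x) p.1.len :=
        TSeq.ofFun_eq_iff.2 fun β hβ => hxy β hβ
      have : (p.1, s.1) ∈ sMap κ T x ↔ (p.1, s.1) ∈ sMap κ T y := by
        change (p.1, TSeq.ofFun (show Below κ → Bool from x) p.1.len, s.1) ∈ bigS κ T ↔
          (p.1, TSeq.ofFun (show Below κ → Bool from y) p.1.len, s.1) ∈ bigS κ T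
        rw [hofFun]
      rw [GDom.mem_range_incl, GDom.mem_range_incl]
      constructor
      all_goals
        intro h s' p' z' heq
        rw [ha] at heq
        cases heq
      exacts [this.1 (h _ _ _ ha), this.2 (h _ _ _ ha)]
    · refine ⟨⟨0, hκ.pos⟩, fun x y _ => ?_⟩
      rw [GDom.mem_range_incl, GDom.mem_range_incl]
      exact ⟨fun _ s p z h => (ha ⟨s, p, z, h⟩).elim, fun _ s p z h => (ha ⟨s, p, z, h⟩).elim⟩
  have hloc' : ∀ a, ∃ α : Below κ, ∀ x y : Cantor κ, (∀ β < α, y β = x β) →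
      (e y a : U) = e x a := by
    intro a
    obtain ⟨α, hα⟩ := hloc a
    refine ⟨α, fun x y hxy => ?_⟩
    by_cases h : w a ∈ D x
    · rw [(he1 x a).1 h, (he1 y a).1 ((hα x y hxy).1 h)]
    · rw [(he1 x a).2 h, (he1 y a).2 (mt (hα x y hxy).2 h)]
  choose α hα using hloc'
  let M : Cantor κ → Structures κ := fun x p =>
    decide (GDom.le c allPairs (e x (e₀ p.1)) (e x (e₀ p.2)))
  have hM : ∀ x a b, (M x).rel a b ↔ GDom.le c allPairs (e x (e₀ a)) (e x (e₀ b)) := fun x a b =>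
    decide_eq_true_iff
  have hiso : ∀ x, Nonempty ((M x).rel ≃r GDom.le c (sMap κ T x)) := by
    intro x
    let i := GDom.incl c (hlen x) (hsub x)
    refine ⟨⟨(e₀.trans (e x)).trans (Equiv.ofInjective i i.injective).symm, fun {a b} => ?_⟩⟩
    rw [hM, ← i.map_rel_iff]
    simp only [Equiv.trans_apply]
    rw [Equiv.apply_ofInjective_symm i.injective, Equiv.apply_ofInjective_symm i.injective]
  have htree : ∀ x, IsTree (M x).rel := by
    intro x
    obtain ⟨i⟩ := hiso x
    obtain ⟨h1, h2, h3, h4⟩ := GDom.isTree c (hlen x)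
    refine ⟨fun a => i.map_rel_iff.1 (h1 _), fun a b d hab hbd => i.map_rel_iff.1
      (h2 _ _ _ (i.map_rel_iff.2 hab) (i.map_rel_iff.2 hbd)), fun a b hab hba => i.injective
      (h3 _ _ (i.map_rel_iff.2 hab) (i.map_rel_iff.2 hba)), fun x a b hax hbx => ?_⟩
    refine (h4 (i x) (i a) (i b) ⟨i.map_rel_iff.2 hax.1, i.injective.ne hax.2⟩
      ⟨i.map_rel_iff.2 hbx.1, i.injective.ne hbx.2⟩).imp i.map_rel_iff.1 i.map_rel_iff.1
  refine ⟨fun x => ⟨M x, htree x⟩, Continuous.subtype_mk (continuous_generateFrom_iff.2 ?_) _,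
    hiso⟩
  rintro _ ⟨d, y, hd, rfl⟩
  refine isOpen_of_local fun x hx => ?_
  obtain ⟨b, hb⟩ := hκ.exists_forall_lt hd fun p => max (α (e₀ p.1.1)) (α (e₀ p.1.2))
  refine ⟨b, fun x' hx' p hp => ?_⟩
  have h1 := max_lt_iff.1 (hb ⟨p, hp⟩)
  rw [← hx p hp]
  change decide _ = decide _
  rw [hα _ x x' fun β hβ => hx' β (hβ.trans h1.1), hα _ x x' fun β hβ => hx' β (hβ.trans h1.2)]

end Reduction
end GenTree
end

noncomputable section
namespace GenTree
open Ordinal Cardinal Set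

/-! ### The bounded topology -/

section BoundedTopology

variable {κ : Cardinal.{u}} {A : Type v} {A' : Type w}

theorem isOpen_iff_local (hκ : IsWeaklyCompact κ) {U : Set (Below κ → A)} :
    @IsOpen _ (boundedSeqTopology κ A) U ↔
      ∀ x ∈ U, ∃ α : Below κ, ∀ y, (∀ β < α, y β = x β) → y ∈ U := by
  refine ⟨fun h => ?_, isOpen_of_local⟩
  induction h with
  | basic s hs =>
    obtain ⟨α, y, rfl⟩ := hs
    exact fun x hx => ⟨α, fun z hz β hβ => (hz β hβ).trans (hx β hβ)⟩
  | univ => exact fun x _ => ⟨⟨0, hκ.pos⟩, fun _ _ => trivial⟩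
  | inter s t _ _ hs ht =>
    intro x hx
    obtain ⟨α, hα⟩ := hs x hx.1
    obtain ⟨α', hα'⟩ := ht x hx.2
    exact ⟨max α α', fun y hy => ⟨hα y fun β hβ => hy β (lt_max_of_lt_left hβ),
      hα' y fun β hβ => hy β (lt_max_of_lt_right hβ)⟩⟩
  | sUnion S _ hS =>
    rintro x ⟨s, hs, hx⟩
    obtain ⟨α, hα⟩ := hS s hs x hx
    exact ⟨α, fun y hy => ⟨s, hs, hα y hy⟩⟩

theorem continuous_of_local (hκ : IsWeaklyCompact κ) {F : (Below κ → A) → Below κ → A'}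
    (hF : ∀ x β, ∃ α : Below κ, ∀ y, (∀ γ < α, y γ = x γ) → F y β = F x β) :
    @Continuous _ _ (boundedSeqTopology κ A) (boundedSeqTopology κ A') F := by
  let := boundedSeqTopology κ A
  refine continuous_generateFrom_iff.2 ?_
  rintro _ ⟨α, z, rfl⟩
  refine isOpen_of_local fun x hx => ?_
  choose b hb using hF x
  obtain ⟨c, hc⟩ := hκ.exists_forall_lt (mk_Iio_below α) fun β => b β.1
  exact ⟨c, fun y hy β hβ => (hb β y fun γ hγ => hy γ (hγ.trans (hc ⟨β, hβ⟩))).trans (hx β hβ)⟩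

theorem isClopen_eval (hκ : IsWeaklyCompact κ) (p : A → Prop) (β : Below κ) :
    @IsClopen _ (boundedSeqTopology κ A) {x : Below κ → A | p (x β)} := by
  obtain ⟨c, hc⟩ := hκ.exists_gt β
  let := boundedSeqTopology κ A
  refine ⟨isOpen_compl_iff.1 ?_, ?_⟩
  · refine isOpen_of_local fun x hx => ⟨c, fun y hy => ?_⟩
    have : ¬ p (x β) := hx
    change ¬ p (y β)
    rwa [hy β hc]
  · refine isOpen_of_local fun x hx => ⟨c, fun y hy => ?_⟩
    have : p (x β) := hx
    change p (y β)
    rwa [hy β hc]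

theorem isClopen_basic (α : Below κ) (z : Below κ → A) :
    @IsClopen _ (boundedSeqTopology κ A) {x : Below κ → A | ∀ β, β < α → x β = z β} := by
  let := boundedSeqTopology κ A
  refine ⟨isOpen_compl_iff.1 (isOpen_of_local fun x hx => ⟨α, fun y hy h => hx fun β hβ => ?_⟩),
    isOpen_of_local fun x hx => ⟨α, fun y hy β hβ => (hy β hβ).trans (hx β hβ)⟩⟩
  exact (hy β hβ).symm.trans (h β hβ)

theorem Baire.isClopen_eval (hκ : IsWeaklyCompact κ) (p : Below κ → Prop) (β : Below κ) :
    IsClopen {x : Baire κ | p (x β)} :=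
  GenTree.isClopen_eval hκ p β

theorem Cantor.isClopen_eval (hκ : IsWeaklyCompact κ) (p : Bool → Prop) (β : Below κ) :
    IsClopen {x : Cantor κ | p (x β)} :=
  GenTree.isClopen_eval hκ p β

/-- The space `κ^κ` has a base of `κ` many clopen sets. -/
theorem Baire.exists_clopen_base (hκ : IsWeaklyCompact κ) : ∃ b : Below κ → Set (Baire κ),
    (∀ α, IsClopen (b α)) ∧ ∀ U, IsOpen U → ∀ x ∈ U, ∃ α, x ∈ b α ∧ b α ⊆ U := by
  classical
  let A := Below κ
  have : Nonempty A := ⟨⟨0, hκ.pos⟩⟩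
  have hA : #A ≤ Cardinal.lift.{u + 1} κ := (mk_below κ).le
  let B : (Σ α : Below κ, Set.Iio α → A) → Set (Baire κ) := fun p =>
    {x | ∀ β, β < p.1 → x β = if h : β < p.1 then p.2 ⟨β, h⟩ else Classical.arbitrary A}
  have hne : Nonempty (Σ α : Below κ, Set.Iio α → A) :=
    ⟨⟨⟨0, hκ.pos⟩, fun _ => Classical.arbitrary A⟩⟩
  obtain ⟨i⟩ : Nonempty ((Σ α : Below κ, Set.Iio α → A) ↪ Below κ) := by
    rw [← Cardinal.le_def, mk_below]
    exact hκ.mk_sigma_fun_le hA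
  refine ⟨fun α => B (Function.invFun i α), fun α => isClopen_basic _ _, fun U hU x hx => ?_⟩
  obtain ⟨α, hα⟩ := (isOpen_iff_local hκ).1 hU x hx
  have hB : B ⟨α, fun β => x β⟩ = {y | ∀ β, β < α → y β = x β} := by
    ext y
    refine forall_congr' fun β => forall_congr' fun h => ?_
    change y β = (if h : β < α then x β else Classical.arbitrary A) ↔ _
    rw [dif_pos h]
  refine ⟨i ⟨α, fun β => x β⟩, ?_⟩
  beta_reduce
  rw [Function.leftInverse_invFun i.injective, hB]
  exact ⟨fun _ _ => rfl, hα⟩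

end BoundedTopology

/-! ### Borel sets as projections of closed sets -/

section Coding

variable {κ : Cardinal.{u}}

/-- A point of κ^κ is to store κ many witnesses together with two further points, whence κ rows and
two spare ones. -/
theorem exists_rowEquiv (hκ : IsWeaklyCompact κ) :
    Nonempty ((Bool ⊕ Below κ) × Below κ ≃ Below κ) := by
  refine Cardinal.eq.1 ?_
  have h := hκ.aleph0_lt_lift.le
  rw [mk_prod, Cardinal.lift_id, Cardinal.lift_id, mk_sum, mk_below, Cardinal.mk_bool,
    Cardinal.lift_ofNat, Cardinal.lift_id', add_eq_right h ((ofNat_le_aleph0).trans h),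
    mul_eq_self h]

/-- The rows of a point of `κ^κ` regarded as a matrix. -/
def row (e : (Bool ⊕ Below κ) × Below κ ≃ Below κ) (i : Bool ⊕ Below κ) (x : Baire κ) : Baire κ :=
  fun β => x (e (i, β))

theorem continuous_row (hκ : IsWeaklyCompact κ) (e : (Bool ⊕ Below κ) × Below κ ≃ Below κ)
    (i : Bool ⊕ Below κ) : Continuous (row e i) := by
  refine continuous_of_local hκ fun x β => ?_
  obtain ⟨c, hc⟩ := hκ.exists_gt (e (i, β))
  exact ⟨c, fun y hy => hy _ hc⟩

theorem exists_row_eq (e : (Bool ⊕ Below κ) × Below κ ≃ Below κ)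
    (r : Bool ⊕ Below κ → Baire κ) : ∃ x, ∀ i, row e i x = r i :=
  ⟨fun α => r (e.symm α).1 (e.symm α).2, fun i => funext fun β => by simp [row]⟩

/-- Borel sets and their complements are projections of closed sets. -/
theorem IsBorelSet.exists_closed (hκ : IsWeaklyCompact κ) {C : Set (Baire κ)} {A : Set C}
    (hA : IsBorelSet κ A) : ∃ P Q : Set (Baire κ × Baire κ), IsClosed P ∧ IsClosed Q ∧
      (∀ z : C, z ∈ A ↔ ∃ x, (z.1, x) ∈ P) ∧ ∀ z : C, z ∉ A ↔ ∃ x, (z.1, x) ∈ Q := by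
  obtain ⟨e⟩ := exists_rowEquiv hκ
  let o : Below κ := ⟨0, hκ.pos⟩
  induction hA with
  | of_isOpen U hU =>
    obtain ⟨V, hV, rfl⟩ := isOpen_induced_iff.1 hU
    obtain ⟨b, hb, hb'⟩ := Baire.exists_clopen_base hκ
    let N : Below κ → Set (Baire κ) := fun α => {z | b α ⊆ V ∧ z ∈ b α}
    have hN : ∀ α, IsClosed (N α) := fun α => isClosed_const.and (hb α).1
    have hNV : ∀ z, z ∈ V ↔ ∃ α, z ∈ N α := fun z =>
      ⟨fun hz => (hb' V hV z hz).imp fun α hα => ⟨hα.2, hα.1⟩, fun ⟨α, h1, h2⟩ => h1 h2⟩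
    -- The entry of the witness at 0 selects a basic clopen subset of V that contains the point.
    refine ⟨{p | ∀ α, p.2 o = α → p.1 ∈ N α}, Prod.fst ⁻¹' Vᶜ, ?_,
      hV.isClosed_compl.preimage continuous_fst, fun z => ?_, fun z => ?_⟩
    · rw [ofPred_forall]
      exact isClosed_iInter fun α => isClosed_imp
        ((Baire.isClopen_eval hκ (· = α) o).2.preimage continuous_snd) ((hN α).preimage continuous_fst)
    · change z.1 ∈ V ↔ _
      rw [hNV]
      exact ⟨fun ⟨α, hα⟩ => ⟨fun _ => α, fun α' h => h ▸ hα⟩, fun ⟨x, hx⟩ => ⟨x o, hx _ rfl⟩⟩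
    · exact ⟨fun h => ⟨z.1, h⟩, fun ⟨x, hx⟩ => hx⟩
  | compl A _ ih =>
    obtain ⟨P, Q, h1, h2, h3, h4⟩ := ih
    exact ⟨Q, P, h2, h1, h4, fun z => by simpa using h3 z⟩
  | iUnion A _ ih =>
    choose P Q h1 h2 h3 h4 using ih
    -- Membership in the union needs one index and one witness, kept in the spare rows;
    -- non-membership needs a witness for every index, kept in the κ rows.
    refine ⟨{p | ∀ α, row e (.inl true) p.2 o = α → (p.1, row e (.inl false) p.2) ∈ P α},
      {p | ∀ α, (p.1, row e (.inr α) p.2) ∈ Q α}, ?_, ?_, fun z => ?_, fun z => ?_⟩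
    · rw [ofPred_forall]
      exact isClosed_iInter fun α => isClosed_imp
        ((Baire.isClopen_eval hκ (· = α) o).2.preimage ((continuous_row hκ e _).comp continuous_snd))
        ((h1 α).preimage (continuous_fst.prodMk ((continuous_row hκ e _).comp continuous_snd)))
    · rw [ofPred_forall]
      exact isClosed_iInter fun α =>
        (h2 α).preimage (continuous_fst.prodMk ((continuous_row hκ e _).comp continuous_snd))
    · rw [mem_iUnion]
      constructor
      · rintro ⟨α, hα⟩
        obtain ⟨x, hx⟩ := (h3 α z).1 hα
        obtain ⟨y, hy⟩ := exists_row_eq e fun i => i.elim (fun b => if b then fun _ => α else x)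
          fun _ => x
        refine ⟨y, fun α' hα' => ?_⟩
        simp only [hy] at hα' ⊢
        obtain rfl : α = α' := hα'
        exact hx
      · rintro ⟨y, hy⟩
        exact ⟨_, (h3 _ z).2 ⟨_, hy _ rfl⟩⟩
    · rw [mem_iUnion, not_exists]
      simp only [h4]
      constructor
      · intro h
        choose x hx using h
        obtain ⟨y, hy⟩ := exists_row_eq e fun i => i.elim (fun _ => z.1) x
        exact ⟨y, fun α => by
          change (z.1, row e (.inr α) y) ∈ Q α
          rw [hy]
          exact hx α⟩
      · rintro ⟨y, hy⟩ α
        exact ⟨_, hy α⟩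

/-- Borel maps into `2^κ` become continuous after a change of the domain. -/
theorem exists_continuous_comp (hκ : IsWeaklyCompact κ) {C : Set (Baire κ)} (hC : IsClosed C)
    {h : C → Cantor κ} (hh : IsBorelMap κ h) : ∃ (C' : Set (Baire κ)) (π : C' → C), IsClosed C' ∧
      Continuous π ∧ Function.Surjective π ∧ Continuous (h ∘ π) := by
  classical
  obtain ⟨e⟩ := exists_rowEquiv hκ
  let o : Below κ := ⟨0, hκ.pos⟩
  obtain ⟨o', ho'⟩ := hκ.exists_gt o
  choose P Q h1 h2 h3 h4 using fun β : Below κ =>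
    (hh {x | x β = true} (Cantor.isClopen_eval hκ (· = true) β).2).exists_closed hκ
  -- The new domain stores z, the bits of h z (with o for true) and for each bit a witness of its
  -- correctness. On it h merely reads off the stored bits.
  let C' : Set (Baire κ) := {x | row e (.inl true) x ∈ C ∧ ∀ β,
    (row e (.inl false) x β = o → (row e (.inl true) x, row e (.inr β) x) ∈ P β) ∧
    (row e (.inl false) x β ≠ o → (row e (.inl true) x, row e (.inr β) x) ∈ Q β)}
  have hcont := continuous_row hκ e
  have hC' : IsClosed C' := by
    refine (hC.preimage (hcont _)).inter ?_
    change IsClosed {x | ∀ β, _ ∧ _}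
    rw [ofPred_forall]
    refine isClosed_iInter fun β => IsClosed.and (isClosed_imp
      ((Baire.isClopen_eval hκ (· = o) β).2.preimage (hcont _))
      ((h1 β).preimage ((hcont _).prodMk (hcont _)))) (isClosed_imp
      ((Baire.isClopen_eval hκ (· ≠ o) β).2.preimage (hcont _))
      ((h2 β).preimage ((hcont _).prodMk (hcont _))))
  let π : C' → C := fun x => ⟨row e (.inl true) x.1, x.2.1⟩
  refine ⟨C', π, hC', ((hcont _).comp continuous_subtype_val).subtype_mk _, fun z => ?_, ?_⟩
  · have hw : ∀ β, ∃ x, (h z β = true → (z.1, x) ∈ P β) ∧ (h z β ≠ true → (z.1, x) ∈ Q β) := by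
      intro β
      by_cases hz : h z β = true
      · obtain ⟨x, hx⟩ := (h3 β z).1 hz
        exact ⟨x, fun _ => hx, fun h => absurd hz h⟩
      · obtain ⟨x, hx⟩ := (h4 β z).1 hz
        exact ⟨x, fun h => absurd h hz, fun _ => hx⟩
    choose x hx using hw
    obtain ⟨y, hy⟩ := exists_row_eq e fun i => i.elim
      (fun b => if b then z.1 else fun β => if h z β = true then o else o') x
    have hy1 : row e (.inl true) y = z.1 := hy _
    have hy2 : ∀ β, row e (.inl false) y β = if h z β = true then o else o' :=
      fun β => congrFun (hy _) β
    have hy3 : ∀ β, row e (.inr β) y = x β := fun β => hy _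
    refine ⟨⟨y, hy1 ▸ z.2, fun β => ?_⟩, Subtype.ext hy1⟩
    rw [hy1, hy2, hy3]
    refine ⟨fun h' => (hx β).1 ?_, fun h' => (hx β).2 ?_⟩
    · by_contra hne
      rw [if_neg hne] at h'
      exact ho'.ne' h'
    · rintro heq
      exact h' (if_pos heq)
  · have heq : h ∘ π = (fun x : Baire κ => (show Cantor κ from
        fun β => decide (row e (.inl false) x β = o))) ∘ Subtype.val := by
      refine funext fun x => funext fun β => ?_
      by_cases hb : row e (.inl false) x.1 β = o
      · have := (h3 β (π x)).2 ⟨_, (x.2.2 β).1 hb⟩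
        exact this.trans (decide_eq_true hb).symm
      · have := (h4 β (π x)).2 ⟨_, (x.2.2 β).2 hb⟩
        exact (Bool.eq_false_of_not_eq_true this).trans (decide_eq_false hb).symm
    rw [heq]
    refine Continuous.comp ?_ continuous_subtype_val
    refine continuous_of_local hκ fun x β => ?_
    obtain ⟨c, hc⟩ := hκ.exists_gt (e (.inl false, β))
    refine ⟨c, fun y hy => ?_⟩
    change decide (y _ = o) = decide (x _ = o)
    rw [hy _ hc]

end Coding
end GenTree
end

noncomputable section
namespace GenTree
open Ordinal Cardinal Set

/-! ### Analytic relations as projections of trees -/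

section Analytic

variable {κ : Cardinal.{u}}

theorem TSeq.ofFun_restrict_of_le {A : Type w} (x : Below κ → A) {α δ : Ordinal.{u}} (h : α ≤ δ) :
    (TSeq.ofFun x δ).restrict α = TSeq.ofFun x α := by
  rw [TSeq.ofFun_restrict, min_eq_right h]

/-- The triples of initial segments of points of a set. -/
theorem isDSTTree_segments (F : Set ((Below κ → Bool) × (Below κ → Bool) × (Below κ → Below κ))) :
    IsDSTTree κ {p | ∃ q ∈ F, ∃ α < κ.ord,
      p = (TSeq.ofFun q.1 α, TSeq.ofFun q.2.1 α, TSeq.ofFun (fun β => (q.2.2 β).1) α)} := by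
  rintro _ ⟨q, hq, α, hα, rfl⟩
  refine ⟨rfl, rfl, ⟨?_, fun β => (q.2.2 _).2⟩, fun δ => ⟨q, hq, min α δ,
    (min_le_left _ _).trans_lt hα, ?_⟩⟩
  · rw [TSeq.ofFun_len _ hα.le]
    exact hα
  · simp only [TSeq.ofFun_restrict]

/-- Analytic relations on `2^κ` are projections of bodies of trees. -/
theorem IsAnalyticSet.exists_tree (hκ : IsWeaklyCompact κ) {A : Set (Cantor κ × Cantor κ)}
    (hA : IsAnalyticSet κ A) :
    ∃ T : Set Triple.{u}, IsDSTTree κ T ∧ ∀ x y, (x, y) ∈ A ↔ proj κ T x y := by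
  obtain ⟨C, g, hC, hg, rfl⟩ := hA
  let F : Set ((Below κ → Bool) × (Below κ → Bool) × (Below κ → Below κ)) :=
    {q | ∃ h : q.2.2 ∈ C, g ⟨q.2.2, h⟩ = (q.1, q.2.1)}
  refine ⟨_, isDSTTree_segments F, fun x y => ⟨?_, ?_⟩⟩
  · rintro ⟨ξ, hξ⟩
    exact ⟨ξ.1, fun α hα => ⟨(x, y, ξ.1), ⟨ξ.2, hξ⟩, α, hα, rfl⟩⟩
  · rintro ⟨ξ, hξ⟩
    have happ : ∀ α : Below κ, ∃ (x' y' : Cantor κ) (ξ' : C), g ξ' = (x', y') ∧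
        (∀ β < α, x' β = x β) ∧ (∀ β < α, y' β = y β) ∧ ∀ β < α, ξ'.1 β = ξ β := by
      intro α
      obtain ⟨⟨x', y', ξ'⟩, ⟨h1, h2⟩, α', hα', heq⟩ := hξ α.1 α.2
      obtain ⟨e1, e2⟩ := Prod.mk.inj heq
      obtain ⟨e2, e3⟩ := Prod.mk.inj e2
      obtain rfl : α.1 = α' := by
        have := congrArg TSeq.len e1
        exact (TSeq.ofFun_len (show Below κ → Bool from x) α.2.le).symm.trans
          (this.trans (TSeq.ofFun_len _ hα'.le))
      refine ⟨x', y', ⟨ξ', h1⟩, h2, fun β hβ => (TSeq.ofFun_eq_iff.1 e1 β hβ).symm,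
        fun β hβ => (TSeq.ofFun_eq_iff.1 e2 β hβ).symm, fun β hβ =>
          Subtype.ext ((TSeq.ofFun_eq_iff (x := fun β => (ξ β).1)
            (y := fun β => (ξ' β).1)).1 e3 β hβ).symm⟩
    choose x' y' ξ' h1 h2 h3 h4 using happ
    -- Points of the graph of g agree with (x, y, ξ) up to any given length, and C is closed.
    have hξC : ξ ∈ C := by
      by_contra hn
      obtain ⟨α, hα⟩ := (isOpen_iff_local hκ).1 hC.isOpen_compl ξ hn
      exact hα _ (h4 α) (ξ' α).2
    -- By continuity each coordinate of g ξ is fixed by an initial segment of ξ, which late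
    -- approximations share; their values there are those of x and y.
    have key : ∀ (z : Cantor κ) (γ : Below κ) (pr : Cantor κ × Cantor κ → Cantor κ),
        Continuous pr → (∀ α, ∀ β < α, pr (x' α, y' α) β = z β) → pr (g ⟨ξ, hξC⟩) γ = z γ := by
      intro z γ pr hpr hz
      let U : Set (Cantor κ) := {w | w γ = pr (g ⟨ξ, hξC⟩) γ}
      have hU : IsOpen U := (Cantor.isClopen_eval hκ (· = pr (g ⟨ξ, hξC⟩) γ) γ).2
      obtain ⟨V, hV, hVU⟩ := isOpen_induced_iff.1 (hU.preimage (hpr.comp hg))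
      have hξV : ξ ∈ V := by
        have : (⟨ξ, hξC⟩ : C) ∈ Subtype.val ⁻¹' V := by
          rw [hVU]
          exact rfl
        exact this
      obtain ⟨α, hα⟩ := (isOpen_iff_local hκ).1 hV ξ hξV
      obtain ⟨δ, hδ⟩ := hκ.exists_gt (max α γ)
      have h5 : ξ' δ ∈ Subtype.val ⁻¹' V :=
        hα _ fun β hβ => h4 δ β (hβ.trans ((le_max_left _ _).trans_lt hδ))
      rw [hVU] at h5
      have h6 : pr (g (ξ' δ)) γ = pr (g ⟨ξ, hξC⟩) γ := h5
      rw [← h6, h1]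
      exact hz δ γ ((le_max_right _ _).trans_lt hδ)
    refine ⟨⟨ξ, hξC⟩, Prod.ext (funext fun γ => ?_) (funext fun γ => ?_)⟩
    · exact key x γ Prod.fst continuous_fst fun α β hβ => h2 α β hβ
    · exact key y γ Prod.snd continuous_snd fun α β hβ => h3 α β hβ

theorem IsDSTTree.hat {T : Set Triple.{u}} (hT : IsDSTTree κ T) : IsDSTTree κ (hat κ T) := by
  rintro p (hp | ⟨h1, h2, h3⟩)
  · obtain ⟨h1, h2, h3, h4⟩ := hT p hp
    exact ⟨h1, h2, h3, fun α => Or.inl (h4 α)⟩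
  · refine ⟨h2, h1 ▸ h2, h3, fun α => Or.inr ⟨?_, ?_, (min_le_left _ _).trans_lt h3.1,
      fun β => h3.2 _⟩⟩
    · rw [h1]
    · change min _ _ = min _ _
      rw [h2]

/-- At lengths beyond a difference of x and y the diagonal triples are excluded, so the added
triples contribute just the diagonal. -/
theorem proj_hat (hκ : IsWeaklyCompact κ) {T : Set Triple.{u}} (hT : IsDSTTree κ T)
    (x y : Cantor κ) : proj κ (hat κ T) x y ↔ x = y ∨ proj κ T x y := by
  constructor
  · rintro ⟨ξ, hξ⟩
    by_cases hxy : x = y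
    · exact Or.inl hxy
    obtain ⟨γ, hγ⟩ : ∃ γ, x γ ≠ y γ := by
      by_contra! h
      exact hxy (funext h)
    refine Or.inr ⟨ξ, fun α hα => ?_⟩
    let δ := max α (γ.1 + 1)
    have hδ : δ < κ.ord := max_lt hα (hκ.succ_lt γ.2)
    have hαδ : α ≤ δ := le_max_left _ _
    rcases hξ δ hδ with h | ⟨h, -⟩
    · exact Eq.subst (motive := fun q => q ∈ T) (Prod.ext (TSeq.ofFun_restrict_of_le _ hαδ)
        (Prod.ext (TSeq.ofFun_restrict_of_le _ hαδ) (TSeq.ofFun_restrict_of_le _ hαδ)))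
        ((hT _ h).2.2.2 α)
    · exact absurd (TSeq.ofFun_eq_iff.1 h γ
        ((Order.lt_add_one_iff.2 le_rfl).trans_le (le_max_right _ _))) hγ
  · rintro (rfl | ⟨ξ, hξ⟩)
    · exact ⟨fun _ => ⟨0, hκ.pos⟩, fun α hα => Or.inr ⟨rfl, rfl,
        (min_le_right _ _).trans_lt hα, fun _ => hκ.pos⟩⟩
    · exact ⟨ξ, fun α hα => Or.inl (hξ α hα)⟩

end Analytic

/-! ### Transfer of analytic quasi-orders to 2^κ -/

section Completeness

variable {κ : Cardinal.{u}} {X : Type v} {Y : Type w} [TopologicalSpace X] [TopologicalSpace Y]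

theorem IsBorelMap.preimage {f : X → Y} (hf : IsBorelMap κ f) {A : Set Y} (hA : IsBorelSet κ A) :
    IsBorelSet κ (f ⁻¹' A) := by
  induction hA with
  | of_isOpen U hU => exact hf U hU
  | compl A _ ih => exact ih.compl
  | iUnion A _ ih =>
    rw [preimage_iUnion]
    exact .iUnion _ ih

theorem _root_.Continuous.isBorelMap {f : X → Y} (hf : Continuous f) : IsBorelMap κ f :=
  fun _ hU => .of_isOpen _ (hU.preimage hf)

theorem IsBorelMap.comp {Z : Type*} [TopologicalSpace Z] {g : Y → Z} {f : X → Y}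
    (hg : IsBorelMap κ g) (hf : IsBorelMap κ f) : IsBorelMap κ (g ∘ f) :=
  fun U hU => hf.preimage (hg U hU)

/-- There is a continuous injection of `κ^κ` into `2^κ`. -/
theorem exists_continuous_injection (hκ : IsWeaklyCompact κ) :
    ∃ i : Baire κ → Cantor κ, Continuous i ∧ Function.Injective i := by
  classical
  obtain ⟨e⟩ : Nonempty (Below κ × Below κ ≃ Below κ) := Cardinal.eq.1 (by
    rw [mk_prod, Cardinal.lift_id]
    exact mul_eq_self ((mk_below κ).symm ▸ hκ.aleph0_lt_lift.le))
  -- The characteristic function of the graph of x.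
  refine ⟨fun x => (fun α => decide (x (e.symm α).1 = (e.symm α).2) : Below κ → Bool), ?_,
    fun x y hxy => funext fun β => ?_⟩
  · refine continuous_of_local hκ fun x β => ?_
    obtain ⟨c, hc⟩ := hκ.exists_gt (e.symm β).1
    refine ⟨c, fun y hy => ?_⟩
    rw [hy _ hc]
  · have := congrFun hxy (e (β, x β))
    simp only [Equiv.symm_apply_apply] at this
    exact (show y β = x β by simpa using this).symm

/-- Every analytic quasi-order is reducible to one on `2^κ`. -/
theorem exists_reduction_cantor (hκ : IsWeaklyCompact κ) (hX : IsStandardBorel κ X)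
    {R : X → X → Prop} (hR : IsAnalyticQuasiOrder κ R) :
    ∃ (j : X → Cantor κ) (T : Set Triple.{u}), IsBorelMap κ j ∧ IsDSTTree κ T ∧
      (∀ x, proj κ T x x) ∧ (∀ x y z, proj κ T x y → proj κ T y z → proj κ T x z) ∧
      ∀ a b, R a b ↔ proj κ T (j a) (j b) := by
  obtain ⟨-, D, e, -, he, -⟩ := hX
  obtain ⟨hrefl, htrans, C, g, hC, hg, hgR⟩ := hR
  obtain ⟨i, hi, hinj⟩ := exists_continuous_injection hκ
  let j : X → Cantor κ := i ∘ Subtype.val ∘ e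
  have hj : IsBorelMap κ j := (hi.comp continuous_subtype_val).isBorelMap.comp he
  have hjinj : Function.Injective j := hinj.comp (Subtype.val_injective.comp e.injective)
  -- Since j is only Borel, the two coordinates of (j × j) ∘ g are made continuous one after the
  -- other, by passing to closed sets that map onto the previous domain.
  obtain ⟨C₁, π₁, hC₁, hπ₁, hs₁, hc₁⟩ := exists_continuous_comp hκ hC (h := j ∘ Prod.fst ∘ g)
    (hj.comp (continuous_fst.comp hg).isBorelMap)
  obtain ⟨C₂, π₂, hC₂, hπ₂, hs₂, hc₂⟩ := exists_continuous_comp hκ hC₁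
    (h := j ∘ Prod.snd ∘ g ∘ π₁)
    (hj.comp (continuous_snd.comp (hg.comp hπ₁)).isBorelMap)
  have hA : IsAnalyticSet κ {p : Cantor κ × Cantor κ | ∃ a b, R a b ∧ p = (j a, j b)} := by
    refine ⟨C₂, fun z => (j (g (π₁ (π₂ z))).1, j (g (π₁ (π₂ z))).2), hC₂,
      (hc₁.comp hπ₂).prodMk hc₂, Set.ext fun p => ⟨?_, ?_⟩⟩
    · rintro ⟨z, rfl⟩
      refine ⟨_, _, ?_, rfl⟩
      have : g (π₁ (π₂ z)) ∈ {p : X × X | R p.1 p.2} := hgR ▸ mem_range_self _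
      exact this
    · rintro ⟨a, b, hab, rfl⟩
      have : (a, b) ∈ range g := by
        rw [hgR]
        exact hab
      obtain ⟨z, hz⟩ := this
      obtain ⟨z, rfl⟩ := hs₁ z
      obtain ⟨z, rfl⟩ := hs₂ z
      exact ⟨z, by simp only [hz]⟩
  obtain ⟨T, hT, hTA⟩ := hA.exists_tree hκ
  have hp : ∀ x y, proj κ (hat κ T) x y ↔ x = y ∨ ∃ a b, R a b ∧ x = j a ∧ y = j b := by
    intro x y
    rw [proj_hat hκ hT, ← hTA]
    simp [Prod.ext_iff]
  refine ⟨j, hat κ T, hj, hT.hat, fun x => (hp x x).2 (Or.inl rfl), fun x y z hxy hyz => ?_,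
    fun a b => ?_⟩
  · rw [hp] at *
    rcases hxy with rfl | ⟨a, b, hab, rfl, rfl⟩
    · exact hyz
    rcases hyz with rfl | ⟨b', d, hbd, hb, rfl⟩
    · exact Or.inr ⟨a, b, hab, rfl, rfl⟩
    · obtain rfl := hjinj hb
      exact Or.inr ⟨a, d, htrans _ _ _ hab hbd, rfl, rfl⟩
  · rw [hp]
    constructor
    · exact fun h => Or.inr ⟨a, b, h, rfl, rfl⟩
    · rintro (h | ⟨a', b', h, ha, hb⟩)
      · obtain rfl := hjinj h
        exact hrefl a
      · obtain rfl := hjinj ha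
        obtain rfl := hjinj hb
        exact h

end Completeness
end GenTree
end

noncomputable section
namespace GenTree
open Ordinal Cardinal Set

/-! ### The space of trees and the complexity of embeddability -/

section TreeSpace

variable {κ : Cardinal.{u}}

theorem Structures.isOpen_of_local {U : Set (Structures κ)}
    (h : ∀ M ∈ U, ∃ d : Set (Below κ × Below κ), #d < Cardinal.lift.{u + 1} κ ∧
      ∀ N : Structures κ, (∀ p ∈ d, N p = M p) → N ∈ U) : IsOpen U := by
  choose d hd hU using h
  have : U = ⋃ M : U, {N : Structures κ | ∀ p ∈ d M M.2, N p = M.1 p} := by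
    ext N
    simp only [mem_iUnion]
    exact ⟨fun hN => ⟨⟨N, hN⟩, fun _ _ => rfl⟩, fun ⟨M, hN⟩ => hU M M.2 N hN⟩
  rw [this]
  exact isOpen_iUnion fun M =>
    TopologicalSpace.isOpen_generateFrom_of_mem ⟨_, _, hd M M.2, rfl⟩

theorem Structures.continuous_eval (hκ : IsWeaklyCompact κ) (p : Below κ × Below κ) :
    Continuous fun M : Structures κ => M p := by
  refine continuous_def.2 fun s _ => isOpen_of_local fun M hM => ⟨{p}, ?_, fun N hN => ?_⟩
  · rw [mk_singleton]
    exact one_lt_aleph0.trans hκ.aleph0_lt_lift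
  · rw [mem_preimage, hN p rfl]
    exact hM

theorem Structures.isClopen_rel (hκ : IsWeaklyCompact κ) (a b : Below κ) :
    IsClopen {M : Structures κ | M.rel a b} :=
  (isClopen_discrete {true}).preimage (continuous_eval hκ (a, b))

/-- The axioms of trees are universal, so they form an intersection of clopen conditions on finitely
many entries. -/
theorem Structures.isClosed_isTree (hκ : IsWeaklyCompact κ) :
    IsClosed {M : Structures κ | IsTree M.rel} := by
  have h := isClopen_rel hκ
  unfold IsTree
  refine IsClosed.and ?_ (IsClosed.and ?_ (IsClosed.and ?_ ?_))
  · rw [ofPred_forall]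
    exact isClosed_iInter fun a => (h a a).1
  · simp only [ofPred_forall]
    exact isClosed_iInter fun a => isClosed_iInter fun b => isClosed_iInter fun c =>
      isClosed_imp (h a b).2 (isClosed_imp (h b c).2 (h a c).1)
  · simp only [ofPred_forall]
    exact isClosed_iInter fun a => isClosed_iInter fun b =>
      isClosed_imp (h a b).2 (isClosed_imp (h b a).2 isClosed_const)
  · simp only [ofPred_forall]
    exact isClosed_iInter fun x => isClosed_iInter fun a => isClosed_iInter fun b =>
      isClosed_imp ((h a x).2.and isOpen_const) (isClosed_imp ((h b x).2.and isOpen_const)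
        ((h a b).1.union (h b a).1))

/-- The structure coded by a point of `κ^κ`: pairs with value `0` are related. -/
def decode (e : Below κ ≃ Below κ × Below κ) (o : Below κ) (x : Baire κ) : Structures κ :=
  fun p => open Classical in decide (x (e.symm p) = o)

theorem continuous_decode (hκ : IsWeaklyCompact κ) (e : Below κ ≃ Below κ × Below κ)
    (o : Below κ) : Continuous (decode e o) := by
  refine continuous_generateFrom_iff.2 ?_
  rintro _ ⟨d, y, hd, rfl⟩
  refine isOpen_of_local fun x hx => ?_
  obtain ⟨c, hc⟩ := hκ.exists_forall_lt hd fun p => e.symm p.1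
  refine ⟨c, fun z hz p hp => (?_ : _ = _).trans (hx p hp)⟩
  unfold decode
  rw [hz _ (hc ⟨p, hp⟩)]

theorem exists_pairEquiv (hκ : IsWeaklyCompact κ) :
    Nonempty (Below κ ≃ Below κ × Below κ) := Cardinal.eq.1 (by
  rw [mk_prod, Cardinal.lift_id]
  exact (mul_eq_self ((mk_below κ).symm ▸ hκ.aleph0_lt_lift.le)).symm)

/-- The code of a structure. -/
def encode (e : Below κ ≃ Below κ × Below κ) (o o' : Below κ) (M : Structures κ) : Baire κ :=
  fun α => if M (e α) = true then o else o'

theorem decode_encode (e : Below κ ≃ Below κ × Below κ) {o o' : Below κ} (h : o' ≠ o)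
    (M : Structures κ) : decode e o (encode e o o' M) = M := by
  refine funext fun p => ?_
  unfold decode encode
  cases hp : M p <;> simp [hp, h]

theorem continuous_encode (e : Below κ ≃ Below κ × Below κ) (o o' : Below κ) :
    Continuous (encode e o o') := by
  refine continuous_generateFrom_iff.2 ?_
  rintro _ ⟨α, y, rfl⟩
  refine Structures.isOpen_of_local fun M hM => ⟨e '' Set.Iio α, mk_image_le.trans_lt
    (mk_Iio_below α), fun N hN β hβ => (?_ : _ = _).trans (hM β hβ)⟩
  unfold encode
  rw [hN _ (mem_image_of_mem _ hβ)]

/-- Encoding is continuous with continuous inverse `decode`, and its range is a closed subset of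
κ^κ; the base is pulled back from there. -/
theorem isStandardBorel_trees (hκ : IsWeaklyCompact κ) : IsStandardBorel κ (Trees κ) := by
  obtain ⟨e⟩ := exists_pairEquiv hκ
  let o : Below κ := ⟨0, hκ.pos⟩
  obtain ⟨o', ho'⟩ := hκ.exists_gt o
  have hne : o' ≠ o := ho'.ne'
  have henc := continuous_encode e o o'
  have hdec := continuous_decode hκ e o
  constructor
  · obtain ⟨b, hb, hb'⟩ := Baire.exists_clopen_base hκ
    let i : Trees κ → Baire κ := fun M => encode e o o' M.1
    have hi : Continuous i := henc.comp continuous_subtype_val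
    refine ⟨range fun α => i ⁻¹' b α,
      TopologicalSpace.isTopologicalBasis_of_isOpen_of_nhds ?_ ?_, ?_⟩
    · rintro _ ⟨α, rfl⟩
      exact (hb α).2.preimage hi
    · intro M U hM hU
      obtain ⟨V, hV, rfl⟩ := isOpen_induced_iff.1 hU
      have hM' : i M ∈ decode e o ⁻¹' V := by
        change decode e o (encode e o o' M.1) ∈ V
        rw [decode_encode e hne]
        exact hM
      obtain ⟨α, h1, h2⟩ := hb' _ (hV.preimage hdec) _ hM'
      refine ⟨_, ⟨α, rfl⟩, h1, fun N hN => ?_⟩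
      have : decode e o (encode e o o' N.1) ∈ V := h2 hN
      rwa [decode_encode e hne] at this
    · refine (Cardinal.lift_le.2 mk_range_le).trans ?_
      rw [mk_below]
      simp
  · let D : Set (Baire κ) := {x | IsTree (decode e o x).rel ∧ ∀ α, x α = o ∨ x α = o'}
    have hD : IsClosed D := by
      refine IsClosed.and ((Structures.isClosed_isTree hκ).preimage hdec) ?_
      rw [ofPred_forall]
      exact isClosed_iInter fun α => (Baire.isClopen_eval hκ (fun β => β = o ∨ β = o') α).1
    let E : Trees κ ≃ D :=
      { toFun := fun M => ⟨encode e o o' M.1, by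
          refine ⟨?_, fun α => ?_⟩
          · rw [decode_encode e hne]
            exact M.2
          · unfold encode
            split_ifs
            exacts [Or.inl rfl, Or.inr rfl]⟩
        invFun := fun x => ⟨decode e o x.1, x.2.1⟩
        left_inv := fun M => Subtype.ext (decode_encode e hne M.1)
        right_inv := fun x => Subtype.ext (funext fun α => by
          change (if decode e o x.1 (e α) = true then o else o') = x.1 α
          unfold decode
          rcases x.2.2 α with h | h
          · simp [h]
          · simp [h, hne]) }
    refine ⟨D, E, ?_, ?_, ?_⟩
    · rw [← compl_compl D]
      exact .compl _ (.of_isOpen _ hD.isOpen_compl)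
    · exact Continuous.isBorelMap ((henc.comp continuous_subtype_val).subtype_mk _)
    · exact Continuous.isBorelMap ((hdec.comp continuous_subtype_val).subtype_mk _)

/-- Codes of two trees together with a map preserving and reflecting the order form a closed set.
Injectivity need not be demanded, as it follows from reflexivity and antisymmetry. -/
theorem isAnalyticQuasiOrder_treeEmb (hκ : IsWeaklyCompact κ) :
    IsAnalyticQuasiOrder κ (TreeEmb κ) := by
  refine ⟨fun M => ⟨RelEmbedding.refl _⟩, fun M N L ⟨f⟩ ⟨g⟩ => ⟨f.trans g⟩, ?_⟩
  obtain ⟨e⟩ := exists_pairEquiv hκ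
  obtain ⟨r⟩ := exists_rowEquiv hκ
  let o : Below κ := ⟨0, hκ.pos⟩
  obtain ⟨o', ho'⟩ := hκ.exists_gt o
  have hne : o' ≠ o := ho'.ne'
  let M : Baire κ → Structures κ := fun x => decode e o (row r (.inl true) x)
  let N : Baire κ → Structures κ := fun x => decode e o (row r (.inl false) x)
  let f : Baire κ → Baire κ := row r (.inr o)
  have hM : Continuous M := (continuous_decode hκ e o).comp (continuous_row hκ r _)
  have hN : Continuous N := (continuous_decode hκ e o).comp (continuous_row hκ r _)
  have hf : Continuous f := continuous_row hκ r _
  let C : Set (Baire κ) := {x | IsTree (M x).rel ∧ IsTree (N x).rel ∧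
    ∀ a b a' b', f x a = a' → f x b = b' → N x (a', b') = M x (a, b)}
  have hC : IsClosed C := by
    refine IsClosed.and ((Structures.isClosed_isTree hκ).preimage hM)
      (IsClosed.and ((Structures.isClosed_isTree hκ).preimage hN) ?_)
    simp only [ofPred_forall]
    exact isClosed_iInter fun a => isClosed_iInter fun b => isClosed_iInter fun a' =>
      isClosed_iInter fun b' => isClosed_imp ((Baire.isClopen_eval hκ (· = a') a).2.preimage hf)
        (isClosed_imp ((Baire.isClopen_eval hκ (· = b') b).2.preimage hf)
          (isClosed_eq ((Structures.continuous_eval hκ (a', b')).comp hN)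
            ((Structures.continuous_eval hκ (a, b)).comp hM)))
  refine ⟨C, fun x => (⟨M x, x.2.1⟩, ⟨N x, x.2.2.1⟩), hC,
    ((hM.comp continuous_subtype_val).subtype_mk _).prodMk
      ((hN.comp continuous_subtype_val).subtype_mk _), Set.ext fun p => ⟨?_, ?_⟩⟩
  · rintro ⟨x, rfl⟩
    have hmap : ∀ a b, (N x).rel (f x a) (f x b) ↔ (M x).rel a b := fun a b => by
      unfold Structures.rel
      rw [x.2.2.2 a b _ _ rfl rfl]
    obtain ⟨hr, -, ha, -⟩ := x.2.1
    exact ⟨⟨⟨f x, fun a b hab => ha a b ((hmap a b).1 (hab ▸ (hmap b b).2 (hr b)))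
      ((hmap b a).1 (hab ▸ (hmap b b).2 (hr b)))⟩, hmap _ _⟩⟩
  · obtain ⟨P, Q⟩ := p
    rintro ⟨g⟩
    obtain ⟨x, hx⟩ := exists_row_eq r fun i => i.elim
      (fun b => if b then encode e o o' P.1 else encode e o o' Q.1)
      fun _ => (fun a => g a : Below κ → Below κ)
    have h1 : M x = P.1 := by
      change decode e o (row r (.inl true) x) = _
      rw [hx]
      exact decode_encode e hne _
    have h2 : N x = Q.1 := by
      change decode e o (row r (.inl false) x) = _
      rw [hx]
      exact decode_encode e hne _
    have h3 : ∀ a, f x a = g a := fun a => congrFun (hx (.inr o)) a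
    refine ⟨⟨x, h1 ▸ P.2, h2 ▸ Q.2, fun a b a' b' ha hb => ?_⟩,
      Prod.ext (Subtype.ext h1) (Subtype.ext h2)⟩
    rw [h1, h2, ← ha, ← hb, h3, h3, Bool.eq_iff_iff]
    exact g.map_rel_iff

end TreeSpace

/-! ### Completeness -/

section Main

variable {κ : Cardinal.{u}}

/-- The continuous realization of the trees `G` is a reduction. -/
theorem exists_reduction_trees (hκ : IsWeaklyCompact κ) {T : Set Triple.{u}} (hT : IsDSTTree κ T)
    (hrefl : ∀ x, proj κ T x x) (htrans : ∀ x y z, proj κ T x y → proj κ T y z → proj κ T x z)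
    (c : LabelData κ) : ∃ f : Cantor κ → Trees κ,
      (∀ x, Nonempty ((f x).1.rel ≃r GDom.le c (sMap κ T x))) ∧
      IsBorelReduction κ (proj κ T) (TreeEmb κ) f := by
  obtain ⟨f, hf, hiso⟩ := exists_continuous_map hκ hT c
  refine ⟨f, hiso, hf.isBorelMap, fun x y => ?_⟩
  rw [proj_iff_embedding hκ hT hrefl htrans c]
  obtain ⟨i⟩ := hiso x
  obtain ⟨i'⟩ := hiso y
  exact ⟨fun ⟨g⟩ => ⟨(i.toRelEmbedding.trans g).trans i'.symm.toRelEmbedding⟩,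
    fun ⟨g⟩ => ⟨(i.symm.toRelEmbedding.trans g).trans i'.toRelEmbedding⟩⟩

theorem isCompleteAnalyticQuasiOrder_treeEmb (hκ : IsWeaklyCompact κ) :
    IsCompleteAnalyticQuasiOrder.{u, u + 1, w} κ (TreeEmb κ) := by
  refine ⟨isStandardBorel_trees hκ, isAnalyticQuasiOrder_treeEmb hκ, fun X _ R hX hR => ?_⟩
  obtain ⟨c⟩ := nonempty_labelData hκ
  obtain ⟨j, T, hj, hT, hrefl, htrans, hred⟩ := exists_reduction_cantor hκ hX hR
  obtain ⟨f, -, hf, hf'⟩ := exists_reduction_trees hκ hT hrefl htrans c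
  exact ⟨f ∘ j, hf.comp hj, fun a b => (hred a b).trans (hf' _ _)⟩

end Main
end GenTree
end

theorem mainTheorem3 (κ : Cardinal.{u}) (hκ : GenTree.IsWeaklyCompact κ) :
    GenTree.IsCompleteAnalyticQuasiOrder.{u, u + 1, w} κ (GenTree.TreeEmb κ) ∧
    Nonempty (GenTree.LabelData κ) ∧
    ∀ R : GenTree.Cantor κ → GenTree.Cantor κ → Prop, GenTree.IsAnalyticQuasiOrder κ R →
      (∃ T : Set GenTree.Triple.{u}, GenTree.IsDSTTree κ T ∧ R = GenTree.proj κ T) ∧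
      ∀ T : Set GenTree.Triple.{u}, GenTree.IsDSTTree κ T → R = GenTree.proj κ T →
        ∀ c : GenTree.LabelData κ, ∃ f : GenTree.Cantor κ → GenTree.Trees κ,
          (∀ x, Nonempty ((f x).1.rel ≃r GenTree.GDom.le c (GenTree.sMap κ T x))) ∧
          GenTree.IsBorelReduction κ R (GenTree.TreeEmb κ) f := by
  refine ⟨GenTree.isCompleteAnalyticQuasiOrder_treeEmb hκ, GenTree.nonempty_labelData hκ,
    fun R hR => ⟨?_, ?_⟩⟩
  · obtain ⟨T, hT, h⟩ := hR.2.2.exists_tree hκ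
    exact ⟨T, hT, funext fun x => funext fun y => propext (h x y)⟩
  · rintro T hT rfl c
    exact GenTree.exists_reduction_trees hκ hT hR.1 hR.2.1 c
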